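/- Let $M$ be a compact smooth manifold (without boundary) of dimension $m$, let $n<m$ with $m-n$ odd, and let $f:M\to\mathbb R^n$ be a smooth Morin map. This means that every singular point $p$ of $f$ is of type $A_k$ for some $1\le k\le n$: there are local coordinates $x$ centred at $p$ and $y$ around $f(p)$, and an integer $1\le\lambda\le m-n+1$, with $y_i\circ f=x_i$ for $i\le n-1$ and $$y_n\circ f=x_n^{k+1}+\sum_{i=1}^{k-1}x_ix_n^{k-i}+x_{n+1}^2+\dots+x_{n+\lambda-1}^2-x_{n+\lambda}^2-\dots-x_m^2 .$$ Let $A_k(f)$ be the set of points of type $A_k$. For odd $k$, let $A_k^+(f)$ and $A_k^-(f)$ be the subsets of $A_k(f)$ where $\lambda$ is even, respectively odd. The sets $A_k(f)$ and $\overline{A_k(f)}$ are submanifolds of dimension $n-k$; for odd $k$, $\overline{A_k^{\pm}(f)}$ are manifolds of dimension $n-k$ with common boundary $\overline{A_{k+1}(f)}$. For a smooth function $g$ on a manifold $N$ with boundary, a point $q\in\partial N$ is a correct critical point of $g$ if $q$ is critical for $g|_{\partial N}$ and $dg(q)\ne0$ on $T_qN$. At such a point the gradient points inwards if $dg(q)$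 is positive on the vectors pointing into $N$. The function $g$ is a correct Morse function if $g|_{N\setminus\partial N}$ and $g|_{\partial N}$ have only non-degenerate critical points and all critical points of $g|_{\partial N}$ are correct. In the Morse count of $\chi(N)$, a critical point $q$ of $g|_{N\setminus\partial N}$ contributes $(-1)^{\mathrm{Ind}(g,q)}$, and a correct critical point $q\in\partial N$ contributes $(-1)^{\mathrm{Ind}(g|_{\partial N},q)}$ if the gradient points inwards at $q$ and $0$ otherwise. Let $a\in\mathbb R^n\setminus\{0\}$ and $L_a(x)=\sum_i a_ix_i$ be such that $L_a\circ f$ and its restrictions to $A_j(f)$ and to $\overline{A_j(f)}$, $1\le j\le n$, are Morse functions. Let $k$ be odd, $k+1\le n$, and let $p\in A_{k+1}(f)$ be a non-correct critical point of $L_a\circ f|_{\overline{A_k(f)}}$, that is, a critical point of both $L_a\circ f|_{\overline{A_{k+1}(f)}}$ and $L_a\circ f|_{\overline{A_k(f)}}$. Then there are local coordinates $(x_1,\dots,x_m)$ of $M$ centred at $p$ in which $\overline{A_k(f)}=\{x_{n-k+1}=\dots=x_m=0\}$ and $\overline{A_{k+1}(f)}=\{x_{n-k}=\dots=x_m=0\}$.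 For any such coordinates and any neighbourhood $O$ of $p$ there are open sets $p\in V\subseteq U\subseteq O$, with $U$ in the coordinate domain, a smooth function $\chi:M\to\mathbb R$ with support in $U$ and $\chi=1$ on $V$, and $\varepsilon_0>0$, such that for every $0<\varepsilon<\varepsilon_0$ the smooth function $$\widetilde{L_a\circ f}=L_a\circ f+\varepsilon\,\chi\,x_{n-k}$$ (equal to $L_a\circ f+\varepsilon x_{n-k}$ on $V$ and to $L_a\circ f$ outside $U$) has the following properties. 1. It is a correct Morse function on $\overline{A_k^+(f)}\cap U$ and on $\overline{A_k^-(f)}\cap U$, both with boundary $\overline{A_{k+1}(f)}\cap U$, and $p$ is a correct critical point of it on both. 2. Its restriction to $\overline{A_k(f)}\cap U$ has exactly one critical point $\tilde p$. This point is non-degenerate, is not a critical point of $L_a\circ f|_{\overline{A_k(f)}}$, and lies in $V\cap(A_k^+(f)\cup A_k^-(f))$. 3. The total contribution of $p$ and $\tilde p$ to the Morse count of $\chi(\overline{A_k^+(f)})$ equals their total contribution to the Morse count of $\chi(\overline{A_k^-(f)})$; that is, in $\chi(\overline{A_k^+(f)})-\chi(\overline{A_k^-(f)})$ their contributions cancel.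 -/

import Mathlib

open scoped Manifold ContDiff Topology

noncomputable section

namespace MorinPerturbation

/-- The Euclidean space `ℝ^d`. -/
abbrev Euc (d : ℕ) : Type := EuclideanSpace ℝ (Fin d)

/-- The coordinate `x_i` of a vector, numbered `x_1, …, x_d` (and `0` for `i` outside `1, …, d`). -/
def crd {d : ℕ} (x : Euc d) (i : ℕ) : ℝ :=
  if h : 1 ≤ i ∧ i ≤ d then x ⟨i - 1, by omega⟩ else 0

/-- Change of the number of coordinates: truncation to the first `b` coordinates if `b ≤ a`,
and padding by zeros (the inclusion `ℝ^a = ℝ^a × 0 ⊆ ℝ^b`) if `a ≤ b`. -/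
def resize {a : ℕ} (b : ℕ) (x : Euc a) : Euc b :=
  WithLp.toLp 2 fun i : Fin b => crd x ((i : ℕ) + 1)

/-- The linear form `L_a(x) = a_1 x_1 + ⋯ + a_n x_n`. -/
def linForm {n : ℕ} (a x : Euc n) : ℝ := ∑ i, a i * x i

section Charts

variable {m : ℕ} {M : Type*} [TopologicalSpace M] [ChartedSpace (Euc m) M]

/-- `Φ` is a smooth chart of `M` in which `S` is the slice `x_{d+1} = ⋯ = x_m = 0`. -/
structure IsSliceChart (S : Set M) (d : ℕ) (Φ : OpenPartialHomeomorph M (Euc m)) : Prop where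
  dim_le : d ≤ m
  mem_atlas : Φ ∈ IsManifold.maximalAtlas (𝓡 m) ∞ M
  mem_iff : ∀ q ∈ Φ.source, q ∈ S ↔ ∀ i, d < i → i ≤ m → crd (Φ q) i = 0

/-- `Φ` is a smooth chart of `M` in which the pair `(N, B)` is a `d`-dimensional half-space and its
boundary hyperplane: `N = {x_{d+1} = ⋯ = x_m = 0, x_d ≤ 0}` and `B = {x_d = ⋯ = x_m = 0}`. -/
structure IsBoundaryChart (N B : Set M) (d : ℕ) (Φ : OpenPartialHomeomorph M (Euc m)) :
    Prop where
  one_le : 1 ≤ d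
  dim_le : d ≤ m
  mem_atlas : Φ ∈ IsManifold.maximalAtlas (𝓡 m) ∞ M
  mem_iff : ∀ q ∈ Φ.source,
    q ∈ N ↔ (∀ i, d < i → i ≤ m → crd (Φ q) i = 0) ∧ crd (Φ q) d ≤ 0
  mem_bdry_iff : ∀ q ∈ Φ.source, q ∈ B ↔ ∀ i, d ≤ i → i ≤ m → crd (Φ q) i = 0

/-- The restriction of `g` to the slice `x_{d+1} = ⋯ = x_m = 0` of the chart `Φ`, as a function of
`(x_1, …, x_d)`. -/
def localRep (Φ : OpenPartialHomeomorph M (Euc m)) (d : ℕ) (g : M → ℝ) : Euc d → ℝ :=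
  fun v => g (Φ.symm (resize m v))

/-- The first derivative of `localRep Φ d g` at the point of the slice that corresponds to `q`. -/
def localDeriv (Φ : OpenPartialHomeomorph M (Euc m)) (d : ℕ) (g : M → ℝ) (q : M) :
    Euc d →L[ℝ] ℝ :=
  fderiv ℝ (localRep Φ d g) (resize d (Φ q))

/-- The Hessian of `localRep Φ d g` at the point of the slice that corresponds to `q`. -/
def localHess (Φ : OpenPartialHomeomorph M (Euc m)) (d : ℕ) (g : M → ℝ) (q : M) :
    Euc d →L[ℝ] Euc d →L[ℝ] ℝ :=
  fderiv ℝ (fderiv ℝ (localRep Φ d g)) (resize d (Φ q))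

variable (m)

/-- `q` is a critical point of `g|_S`, where `S` is a `d`-dimensional submanifold near `q`. -/
def IsCritOn (S : Set M) (d : ℕ) (g : M → ℝ) (q : M) : Prop :=
  q ∈ S ∧ ∃ Φ : OpenPartialHomeomorph M (Euc m),
    IsSliceChart S d Φ ∧ q ∈ Φ.source ∧ localDeriv Φ d g q = 0

/-- `q` is a non-degenerate critical point of `g|_S`. -/
def IsNondegCritOn (S : Set M) (d : ℕ) (g : M → ℝ) (q : M) : Prop :=
  q ∈ S ∧ ∃ Φ : OpenPartialHomeomorph M (Euc m),
    IsSliceChart S d Φ ∧ q ∈ Φ.source ∧ localDeriv Φ d g q = 0 ∧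
      ∀ v, (∀ w, localHess Φ d g q v w = 0) → v = 0

/-- `g|_S` is a Morse function on the `d`-dimensional submanifold `S`. -/
def IsMorseOn (S : Set M) (d : ℕ) (g : M → ℝ) : Prop :=
  ∀ q, IsCritOn m S d g q → IsNondegCritOn m S d g q

/-- The Morse index of `g|_S` at a critical point `q`: the largest dimension of a subspace on which
the Hessian is negative definite. (At a critical point all slice charts give the same number.) -/
def morseIndex (S : Set M) (d : ℕ) (g : M → ℝ) (q : M) : ℕ :=
  sSup {r | ∃ Φ : OpenPartialHomeomorph M (Euc m), IsSliceChart S d Φ ∧ q ∈ Φ.source ∧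
    ∃ W : Submodule ℝ (Euc d), Module.finrank ℝ W = r ∧
      ∀ v ∈ W, v ≠ 0 → localHess Φ d g q v v < 0}

/-- `q ∈ B = ∂N` is a correct critical point of `g|_N`: critical for `g|_B`, but not for (an
extension across the boundary of) `g|_N`. -/
def IsCorrectCrit (N B : Set M) (d : ℕ) (g : M → ℝ) (q : M) : Prop :=
  IsCritOn m B (d - 1) g q ∧ ∃ Φ : OpenPartialHomeomorph M (Euc m),
    IsBoundaryChart N B d Φ ∧ q ∈ Φ.source ∧ localDeriv Φ d g q ≠ 0

/-- The gradient of `g|_N` at `q ∈ B = ∂N` points inwards: in a chart with `N = {x_d ≤ 0}`, the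
derivative is negative on the half-space `x_d > 0`. -/
def PointsInward (N B : Set M) (d : ℕ) (g : M → ℝ) (q : M) : Prop :=
  q ∈ B ∧ ∃ Φ : OpenPartialHomeomorph M (Euc m),
    IsBoundaryChart N B d Φ ∧ q ∈ Φ.source ∧
      ∀ v : Euc d, 0 < crd v d → localDeriv Φ d g q v < 0

/-- Within the open set `U`, `N` is a `d`-dimensional smooth manifold with boundary `B`, and `g` is
a correct Morse function on it. -/
structure IsCorrectMorseOn (N B : Set M) (d : ℕ) (U : Set M) (g : M → ℝ) : Prop where
  smooth : ContMDiffOn (𝓡 m) 𝓘(ℝ, ℝ) ∞ g U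
  boundary_chart : ∀ q ∈ U, q ∈ B →
    ∃ Φ : OpenPartialHomeomorph M (Euc m), IsBoundaryChart N B d Φ ∧ q ∈ Φ.source
  interior_chart : ∀ q ∈ U, q ∈ N → q ∉ B →
    ∃ Φ : OpenPartialHomeomorph M (Euc m), IsSliceChart N d Φ ∧ q ∈ Φ.source
  interior_nondeg : ∀ q ∈ U, q ∉ B →
    IsCritOn m N d g q → IsNondegCritOn m N d g q
  boundary_nondeg : ∀ q ∈ U,
    IsCritOn m B (d - 1) g q → IsNondegCritOn m B (d - 1) g q
  boundary_correct : ∀ q ∈ U,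
    IsCritOn m B (d - 1) g q → IsCorrectCrit m N B d g q

open Classical in
/-- The contribution of `q ∈ ∂N = B` to the Morse count of `χ(N)`: `(-1)^{ind(g|_B, q)}` if the
gradient points inwards, and `0` otherwise. -/
def boundaryContribution (N B : Set M) (d : ℕ) (g : M → ℝ) (q : M) : ℤ :=
  if PointsInward m N B d g q then (-1) ^ morseIndex m B (d - 1) g q else 0

open Classical in
/-- The contribution of a critical point `q` to the Morse count of a manifold with interior `S`:
`(-1)^{ind(g|_S, q)}` if `q` lies in `S`, and `0` otherwise. -/
def interiorContribution (S : Set M) (d : ℕ) (g : M → ℝ) (q : M) : ℤ :=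
  if q ∈ S then (-1) ^ morseIndex m S d g q else 0

end Charts

section Morin

variable {m n : ℕ} {M : Type*} [TopologicalSpace M] [ChartedSpace (Euc m) M]

/-- The last component of the normal form of a Morin singularity,
`x_n^{k+1} + ∑_{i=1}^{k-1} x_i x_n^{k-i} + x_{n+1}² + ⋯ + x_{n+l-1}² - x_{n+l}² - ⋯ - x_m²`. -/
def morinForm (n k l : ℕ) (x : Euc m) : ℝ :=
  crd x n ^ (k + 1) + ∑ i ∈ Finset.Icc 1 (k - 1), crd x i * crd x n ^ (k - i)
    + ∑ j ∈ Finset.Icc (n + 1) (n + l - 1), crd x j ^ 2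
    - ∑ j ∈ Finset.Icc (n + l) m, crd x j ^ 2

variable (m)

/-- In suitable local coordinates `x` centred at `p` and `y` around `f p`, the map `f` has the
normal form of type `A_k` with the parameter `l`. -/
def HasMorinForm (f : M → Euc n) (k l : ℕ) (p : M) : Prop :=
  1 ≤ k ∧ k ≤ n ∧ 1 ≤ l ∧ n + l ≤ m + 1 ∧
  ∃ Φ ∈ IsManifold.maximalAtlas (𝓡 m) ∞ M, ∃ Ψ ∈ IsManifold.maximalAtlas (𝓡 n) ∞ (Euc n),
    p ∈ Φ.source ∧ Φ p = 0 ∧ ∀ q ∈ Φ.source, f q ∈ Ψ.source ∧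
      (∀ i, 1 ≤ i → i ≤ n - 1 → crd (Ψ (f q)) i = crd (Φ q) i) ∧
      crd (Ψ (f q)) n = morinForm n k l (Φ q)

/-- The set `A_k(f)`. -/
def morinSet (f : M → Euc n) (k : ℕ) : Set M := {p | ∃ l, HasMorinForm m f k l p}

/-- The set `A_k^+(f)` (used for odd `k` and odd `m - n`). -/
def morinSetPos (f : M → Euc n) (k : ℕ) : Set M := {p | ∃ l, Even l ∧ HasMorinForm m f k l p}

/-- The set `A_k^-(f)` (used for odd `k` and odd `m - n`). -/
def morinSetNeg (f : M → Euc n) (k : ℕ) : Set M := {p | ∃ l, Odd l ∧ HasMorinForm m f k l p}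

/-- `f` is a smooth map all of whose singular points are Morin singular points. -/
def IsMorinMap (f : M → Euc n) : Prop :=
  ContMDiff (𝓡 m) (𝓡 n) ∞ f ∧
    ∀ p, ¬ Function.Surjective (mfderiv (𝓡 m) (𝓡 n) f p) → ∃ k, p ∈ morinSet m f k

/-- `L_a ∘ f` and its restrictions to all `A_j(f)` and to all their closures are Morse
functions. -/
structure IsGenericForm (f : M → Euc n) (a : Euc n) : Prop where
  ne_zero : a ≠ 0
  morse : IsMorseOn m Set.univ m (fun q => linForm a (f q))
  morse_stratum : ∀ j, 1 ≤ j → j ≤ n →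
    IsMorseOn m (morinSet m f j) (n - j) (fun q => linForm a (f q))
  morse_closure : ∀ j, 1 ≤ j → j ≤ n →
    IsMorseOn m (closure (morinSet m f j)) (n - j) (fun q => linForm a (f q))

variable {m}

/-- A smooth chart of `M` centred at `p` whose first `n - k` coordinates are local coordinates of
the closure of `A_k(f)` such that `x_{n-k} = 0` describes the closure of `A_{k+1}(f)`. -/
structure IsAdaptedChart (f : M → Euc n) (k : ℕ) (p : M)
    (Φ : OpenPartialHomeomorph M (Euc m)) : Prop where
  mem_source : p ∈ Φ.source
  map_eq_zero : Φ p = 0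
  slice : IsSliceChart (closure (morinSet m f k)) (n - k) Φ
  slice_succ : IsSliceChart (closure (morinSet m f (k + 1))) (n - (k + 1)) Φ

/-- The function `L_a ∘ f + ε χ x_{n-k}`, where `x_{n-k}` is a coordinate of the chart `Φ`. -/
def perturbed (f : M → Euc n) (a : Euc n) (k : ℕ) (Φ : OpenPartialHomeomorph M (Euc m))
    (χ : M → ℝ) (ε : ℝ) : M → ℝ :=
  fun q => linForm a (f q) + ε * (χ q * crd (Φ q) (n - k))

end Morin

end MorinPerturbation

end

/-! Write g for `L_a ∘ f` and d for n - k. The theorem is local at p. It combines the geometry of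
the closure of A_k along A_(k+1) with a computation in Morse theory on a half-space.

Geometry. In a normal form of type A_(k+1), put P_x(T) = T^(k+2) + ∑ x_i T^(k+1-i). A point is of
type A_j exactly if x_(n+1) = … = x_m = 0 and x_n is a root of P_x' of multiplicity exactly j
(`mem_morinSet_iff`). Types are defined by the existence of charts, so this needs a notion that
charts do not affect: curves that have contact of order N with the fibre and with the singular set
(`IsContact.comp`, `HasMorinForm.contact_iff`). A root t of multiplicity at least k forces P_x' =
(k+2)(T-t)^k(T+kt). Hence the closure of A_k is a graph x_i = c_i(x_n), i ≤ k, on which A_(k+1) is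
given by x_n = 0.

Sides. At a point of this graph the normal form along the x_n-axis starts with (k+2) x_n s^(k+1),
where k+1 is even. For k = 1 this is one more square in the intrinsic quadratic form on the kernel;
for odd k ≥ 3 it fixes the sign of the target coordinate change. In both cases Sylvester's law and
the oddness of m-n show that the parity of λ changes across x_n = 0 (`even_param_iff`).
Straightening the graph gives a chart in which A_k^+ and A_k^- are the two open halves of a slice
(`exists_chart_of_mem_morinSet`), and connectedness carries this to every adapted chart
(`AreSides.transfer`).

Morse theory. Let h be g on the slice, H its Hessian at 0, and H₀ the restriction of H to x_d = 0;
both are non-degenerate. Choose u with H(u, ·) = dx_d. Then u is H-orthogonal to the hyperplane and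
H(u, u) = u_d ≠ 0, so ind H = ind H₀ + 1 if u_d < 0 and ind H = ind H₀ otherwise
(`exists_splitting`). Near 0, a critical point of h + ε x_d solves Dh = -ε dx_d. For small ε there
is exactly one (`exists_solution`, `eq_of_fderiv_perturb_eq_zero`); it is close to -εu, so its x_d
has the sign opposite to u_d (`exists_ball_sign`), and its index is ind H. At p the new gradient is
ε dx_d, which points into the half x_d > 0 only. If the new point has x_d < 0, it has index ind H₀
and gives its half what p gives to the other. If it has x_d > 0, its index is ind H₀ + 1 and it
cancels p in that half, while the other half receives nothing (`AreSides.contributions_eq`). -/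

noncomputable section

namespace MorinPerturbation

set_option linter.unusedSectionVars false

/-! ### Coordinates numbered from 1, truncation and padding. -/

section Coordinates

/-- The coordinate `x_i` as a continuous linear form. -/
def crdL (d i : ℕ) : Euc d →L[ℝ] ℝ :=
  if h : 1 ≤ i ∧ i ≤ d then EuclideanSpace.proj (⟨i - 1, by omega⟩ : Fin d) else 0

theorem crdL_apply {d : ℕ} (i : ℕ) (x : Euc d) : crdL d i x = crd x i := by
  unfold crdL crd
  split_ifs <;> simp

theorem crd_zero {d : ℕ} (i : ℕ) : crd (0 : Euc d) i = 0 := by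
  rw [← crdL_apply, map_zero]

theorem crd_add {d : ℕ} (x y : Euc d) (i : ℕ) : crd (x + y) i = crd x i + crd y i := by
  simp only [← crdL_apply, map_add]

theorem crd_sub {d : ℕ} (x y : Euc d) (i : ℕ) : crd (x - y) i = crd x i - crd y i := by
  simp only [← crdL_apply, map_sub]

theorem crd_smul {d : ℕ} (c : ℝ) (x : Euc d) (i : ℕ) : crd (c • x) i = c * crd x i := by
  simp only [← crdL_apply, map_smul, smul_eq_mul]

theorem crd_of_not {d : ℕ} {i : ℕ} (h : ¬ (1 ≤ i ∧ i ≤ d)) (x : Euc d) : crd x i = 0 := by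
  simp [crd, h]

theorem crd_succ {d : ℕ} (x : Euc d) (i : Fin d) : crd x ((i : ℕ) + 1) = x i := by
  have : 1 ≤ (i : ℕ) + 1 ∧ (i : ℕ) + 1 ≤ d := by omega
  simp [crd, this]

theorem euc_ext {d : ℕ} {x y : Euc d} (h : ∀ i, 1 ≤ i → i ≤ d → crd x i = crd y i) : x = y := by
  ext i
  rw [← crd_succ, ← crd_succ]
  exact h _ (by omega) (by omega)

/-- The vector with the coordinates `c 1, …, c d`. -/
def ofCrd (d : ℕ) (c : ℕ → ℝ) : Euc d := WithLp.toLp 2 fun i : Fin d => c ((i : ℕ) + 1)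

theorem crd_ofCrd {d : ℕ} (c : ℕ → ℝ) {i : ℕ} (h1 : 1 ≤ i) (h2 : i ≤ d) :
    crd (ofCrd d c) i = c i := by
  have : i - 1 + 1 = i := by omega
  simp [crd, ofCrd, h1, h2, this]

theorem crd_resize {a b : ℕ} (x : Euc a) {i : ℕ} (h1 : 1 ≤ i) (h2 : i ≤ b) :
    crd (resize b x) i = crd x i :=
  crd_ofCrd (crd x) h1 h2

/-- `resize` as a continuous linear map. -/
def resizeL (a b : ℕ) : Euc a →L[ℝ] Euc b :=
  LinearMap.toContinuousLinearMap
    { toFun := resize b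
      map_add' := fun x y => by
        ext i
        simp [resize, crd_add]
      map_smul' := fun c x => by
        ext i
        simp [resize, crd_smul] }

theorem resize_zero {a b : ℕ} : resize b (0 : Euc a) = 0 := map_zero (resizeL a b)

theorem resize_resize_of_le {a b : ℕ} (h : a ≤ b) (x : Euc a) : resize a (resize b x) = x :=
  euc_ext fun i h1 h2 => by rw [crd_resize _ h1 h2, crd_resize _ h1 (h2.trans h)]

theorem resize_resize_of_crd {a b : ℕ} (x : Euc b)
    (hx : ∀ i, a < i → i ≤ b → crd x i = 0) : resize b (resize a x) = x :=
  euc_ext fun i h1 h2 => by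
    rw [crd_resize _ h1 h2]
    by_cases h : i ≤ a
    · rw [crd_resize _ h1 h]
    · rw [crd_of_not (by omega), hx i (by omega) h2]

theorem resize_resize_trans {a b c : ℕ} (hab : a ≤ b) (x : Euc a) :
    resize c (resize b x) = resize c x :=
  euc_ext fun i h1 h2 => by
    rw [crd_resize _ h1 h2, crd_resize _ h1 h2]
    by_cases h : i ≤ b
    · rw [crd_resize _ h1 h]
    · rw [crd_of_not (by omega), crd_of_not (by omega)]

/-- The basis vector `e_i`. -/
def bvec (d i : ℕ) : Euc d := ofCrd d fun j => if j = i then 1 else 0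

theorem crd_bvec {d i j : ℕ} (h1 : 1 ≤ j) (h2 : j ≤ d) :
    crd (bvec d i) j = if j = i then 1 else 0 := crd_ofCrd _ h1 h2

theorem crdL_coe {d : ℕ} (i : ℕ) : (fun x : Euc d => crd x i) = crdL d i := by
  ext x
  rw [crdL_apply]

theorem contDiff_crd {d : ℕ} {n : WithTop ℕ∞} (i : ℕ) : ContDiff ℝ n fun x : Euc d => crd x i := by
  rw [crdL_coe]
  exact (crdL d i).contDiff

theorem continuous_crd {d : ℕ} (i : ℕ) : Continuous fun x : Euc d => crd x i :=
  (contDiff_crd (n := 0) i).continuous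

theorem contDiff_resize {a b : ℕ} {n : WithTop ℕ∞} : ContDiff ℝ n (resize b : Euc a → Euc b) :=
  (resizeL a b).contDiff

theorem hasFDerivAt_crd {d : ℕ} (i : ℕ) (x : Euc d) :
    HasFDerivAt (fun x : Euc d => crd x i) (crdL d i) x := by
  rw [crdL_coe]
  exact (crdL d i).hasFDerivAt

theorem contDiffAt_euc {E : Type*} [NormedAddCommGroup E] [NormedSpace ℝ E] {d : ℕ}
    {n : WithTop ℕ∞} {F : E → Euc d} {x : E}
    (h : ∀ i, 1 ≤ i → i ≤ d → ContDiffAt ℝ n (fun y => crd (F y) i) x) : ContDiffAt ℝ n F x := by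
  rw [contDiffAt_euclidean]
  intro i
  simpa only [crd_succ] using h (i + 1) (by omega) (by omega)

theorem norm_resize_of_le {a b : ℕ} (h : a ≤ b) (x : Euc a) : ‖resize b x‖ = ‖x‖ := by
  obtain ⟨c, rfl⟩ := Nat.exists_eq_add_of_le h
  rw [EuclideanSpace.norm_eq, EuclideanSpace.norm_eq, Fin.sum_univ_add]
  congr 1
  have h1 : ∀ i : Fin a, resize (a + c) x (Fin.castAdd c i) = x i := fun i => by
    rw [← crd_succ, crd_resize _ (by omega) (by omega), ← crd_succ]; rfl
  have h2 : ∀ i : Fin c, resize (a + c) x (Fin.natAdd a i) = 0 := fun i => by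
    rw [← crd_succ, crd_resize _ (by omega) (by omega)]
    exact crd_of_not (by simp) _
  simp [h1, h2]

end Coordinates

/-! ### Index and inertia of quadratic forms. -/

section Index

variable {V : Type*} [AddCommGroup V] [Module ℝ V]

/-- `q` is negative definite on the subspace `W`. -/
def NegDefOn (q : V → ℝ) (W : Submodule ℝ V) : Prop := ∀ v ∈ W, v ≠ 0 → q v < 0

/-- `q` is positive definite on the subspace `W`. -/
def PosDefOn (q : V → ℝ) (W : Submodule ℝ V) : Prop := ∀ v ∈ W, v ≠ 0 → 0 < q v

variable [FiniteDimensional ℝ V]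

/-- A common non-zero vector would have q < 0 and q ≥ 0. Only semidefiniteness is required on `W'`,
which the comparison of inertia needs when some weights vanish. -/
theorem finrank_add_le_of_negDefOn {q : V → ℝ} {W W' : Submodule ℝ V} (h : NegDefOn q W)
    (h' : ∀ v ∈ W', 0 ≤ q v) :
    Module.finrank ℝ W + Module.finrank ℝ W' ≤ Module.finrank ℝ V := by
  apply Submodule.finrank_add_finrank_le_of_disjoint
  rw [Submodule.disjoint_def]
  intro v hv hv'
  by_contra hne
  exact absurd (h v hv hne) (not_lt.2 (h' v hv'))

/-- A splitting into subspaces of dimensions `a` and `b` on which `q` is negative and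
positive definite. -/
structure IsSplitting (q : V → ℝ) (W W' : Submodule ℝ V) : Prop where
  neg : NegDefOn q W
  pos : PosDefOn q W'
  finrank_eq : Module.finrank ℝ W + Module.finrank ℝ W' = Module.finrank ℝ V

/-- The complementary dimension of `W'` bounds every competitor of `W`. This replaces the supremum
in `morseIndex` by the dimension of one known subspace. -/
theorem sSup_negDefOn_eq {q : V → ℝ} {W W' : Submodule ℝ V} (h : NegDefOn q W)
    (h' : ∀ v ∈ W', 0 ≤ q v)
    (hd : Module.finrank ℝ W + Module.finrank ℝ W' = Module.finrank ℝ V) :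
    sSup {r | ∃ X : Submodule ℝ V, Module.finrank ℝ X = r ∧ NegDefOn q X} =
      Module.finrank ℝ W := by
  apply IsGreatest.csSup_eq
  refine ⟨⟨W, rfl, h⟩, ?_⟩
  rintro r ⟨X, rfl, hX⟩
  have := finrank_add_le_of_negDefOn hX h'
  omega

theorem PosDefOn.nonneg {B : V →ₗ[ℝ] V →ₗ[ℝ] ℝ} {W : Submodule ℝ V}
    (h : PosDefOn (fun v => B v v) W) : ∀ v ∈ W, 0 ≤ B v v := by
  intro v hv
  by_cases h0 : v = 0
  · simp [h0]
  · exact (h v hv h0).le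

theorem IsSplitting.sSup_eq {B : V →ₗ[ℝ] V →ₗ[ℝ] ℝ} {W W' : Submodule ℝ V}
    (h : IsSplitting (fun v => B v v) W W') :
    sSup {r | ∃ X : Submodule ℝ V, Module.finrank ℝ X = r ∧ NegDefOn (fun v => B v v) X} =
      Module.finrank ℝ W :=
  sSup_negDefOn_eq h.neg h.pos.nonneg h.finrank_eq

theorem IsSplitting.isCompl {q : V → ℝ} {W W' : Submodule ℝ V} (h : IsSplitting q W W') :
    IsCompl W W' := by
  have hd : Disjoint W W' := by
    rw [Submodule.disjoint_def]
    intro v hv hv'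
    by_contra hne
    exact absurd (h.neg v hv hne) (not_lt.2 (h.pos v hv' hne).le)
  refine ⟨hd, ?_⟩
  rw [codisjoint_iff]
  apply Submodule.eq_top_of_finrank_eq
  have := Submodule.finrank_sup_add_finrank_inf_eq W W'
  rw [hd.eq_bot, finrank_bot] at this
  rw [← h.finrank_eq, ← this, add_zero]

/-- For v = x + y along the splitting, pairing v with x and with y gives B(x,x) = -B(x,y) = B(y,y),
where the left side is ≤ 0 and the right side is ≥ 0; so both parts vanish. Non-degeneracy thus
comes with a splitting and persists with it. -/
theorem IsSplitting.eq_zero {B : V →ₗ[ℝ] V →ₗ[ℝ] ℝ} {W W' : Submodule ℝ V}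
    (h : IsSplitting (fun v => B v v) W W') (hs : ∀ v w, B v w = B w v) {v : V}
    (hv : ∀ w, B v w = 0) : v = 0 := by
  have hmem : v ∈ W ⊔ W' := by rw [h.isCompl.sup_eq_top]; trivial
  obtain ⟨x, hx, y, hy, rfl⟩ := Submodule.mem_sup.1 hmem
  have h1 := hv x
  have h2 := hv y
  simp only [map_add, LinearMap.add_apply] at h1 h2
  have h3 := hs x y
  have hx0 : x = 0 := by
    by_contra hne
    have h4 := h.neg x hx hne
    have h5 := h.pos.nonneg y hy
    linarith
  have hy0 : y = 0 := by
    by_contra hne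
    have h4 := h.pos y hy hne
    simp only [hx0] at h2 h4
    simp at h2
    linarith
  simp [hx0, hy0]

theorem finrank_span_subset {ι : Type*} [Fintype ι] (b : Module.Basis ι ℝ V) (p : ι → Prop) :
    Module.finrank ℝ (Submodule.span ℝ (b '' {i | p i})) = Nat.card {i // p i} := by
  classical
  have h : LinearIndependent ℝ fun i : {i // p i} => b i :=
    b.linearIndependent.comp _ Subtype.val_injective
  have := finrank_span_eq_card h
  rw [Nat.card_eq_fintype_card, ← this, Set.image_eq_range]
  rfl

/-- On a sum of squares with weights, in a basis, the quadratic form is positive on the span of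
those basis vectors whose weights are positive. -/
theorem diag_pos_of_mem_span {ι : Type*} [Fintype ι] (b : Module.Basis ι ℝ V) (w : ι → ℝ)
    (p : ι → Prop) (hp : ∀ i, p i → 0 < w i) {v : V}
    (hv : v ∈ Submodule.span ℝ (b '' {i | p i})) (hne : v ≠ 0) :
    0 < ∑ i, w i * b.repr v i ^ 2 := by
  classical
  rw [Module.Basis.mem_span_image] at hv
  have hz : ∀ i, ¬ p i → b.repr v i = 0 := by
    intro i hi
    by_contra h
    exact hi (hv (Finsupp.mem_support_iff.2 h))
  obtain ⟨j, hj⟩ : ∃ j, b.repr v j ≠ 0 := by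
    by_contra! h
    apply hne
    apply b.repr.injective
    ext i
    simp [h i]
  apply Finset.sum_pos'
  · intro i _
    by_cases hi : p i
    · exact mul_nonneg (hp i hi).le (sq_nonneg _)
    · simp [hz i hi]
  · have hpj : p j := by
      by_contra h
      exact hj (hz j h)
    exact ⟨j, Finset.mem_univ _, mul_pos (hp j hpj) (by positivity)⟩

theorem isSplitting_diag {ι : Type*} [Fintype ι] (b : Module.Basis ι ℝ V) (w : ι → ℝ)
    (hw : ∀ i, w i ≠ 0) :
    IsSplitting (fun v => ∑ i, w i * b.repr v i ^ 2)
      (Submodule.span ℝ (b '' {i | w i < 0})) (Submodule.span ℝ (b '' {i | ¬ w i < 0})) := by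
  classical
  refine ⟨?_, ?_, ?_⟩
  · intro v hv hne
    have := diag_pos_of_mem_span b (fun i => - w i) _ (fun i hi => neg_pos.2 hi) hv hne
    simp only [neg_mul, Finset.sum_neg_distrib] at this
    simpa using this
  · intro v hv hne
    exact diag_pos_of_mem_span b w _ (fun i hi => lt_of_le_of_ne (not_lt.1 hi) (hw i).symm) hv hne
  · rw [finrank_span_subset, finrank_span_subset, Module.finrank_eq_card_basis b,
      Nat.card_eq_fintype_card, Nat.card_eq_fintype_card]
    rw [Fintype.card_subtype_compl]
    have := Fintype.card_subtype_le fun i => w i < 0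
    omega

/-- Take an orthogonal basis. A basis vector with B(b_i,b_i) = 0 would lie in the kernel, so every
diagonal entry has a sign. -/
theorem exists_isSplitting (B : V →ₗ[ℝ] V →ₗ[ℝ] ℝ) (hs : ∀ v w, B v w = B w v)
    (hn : ∀ v, (∀ w, B v w = 0) → v = 0) :
    ∃ W W' : Submodule ℝ V, IsSplitting (fun v => B v v) W W' := by
  classical
  obtain ⟨b, hb⟩ := LinearMap.BilinForm.exists_orthogonal_basis (B := B) ⟨fun v w => hs v w⟩
  have hB : ∀ v, B v v = ∑ i, B (b i) (b i) * b.repr v i ^ 2 := by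
    intro v
    conv_lhs => rw [← b.sum_repr v]
    simp only [map_sum, LinearMap.sum_apply, map_smul, LinearMap.smul_apply, smul_eq_mul]
    refine Finset.sum_congr rfl fun i _ => ?_
    rw [Finset.sum_eq_single i]
    · ring
    · intro j _ hj
      have : B (b j) (b i) = 0 := hb hj
      simp [this]
    · simp
  have hne : ∀ i, B (b i) (b i) ≠ 0 := by
    intro i h0
    apply b.ne_zero i
    apply hn
    intro w
    rw [← b.sum_repr w]
    simp only [map_sum, map_smul, smul_eq_mul]
    refine Finset.sum_eq_zero fun j _ => ?_
    by_cases hj : j = i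
    · simp [hj, h0]
    · have : B (b i) (b j) = 0 := hb (Ne.symm hj)
      simp [this]
  have := isSplitting_diag b (fun i => B (b i) (b i)) hne
  simp only [← hB] at this
  exact ⟨_, _, this⟩

/-- Sylvester's law of inertia for weighted sums of squares. -/
theorem card_neg_weights_eq {ι : Type*} [Fintype ι] {V' : Type*} [AddCommGroup V'] [Module ℝ V']
    [FiniteDimensional ℝ V'] (b : Module.Basis ι ℝ V) (b' : Module.Basis ι ℝ V') (w w' : ι → ℝ)
    (A : V ≃ₗ[ℝ] V')
    (h : ∀ v, ∑ i, w i * b.repr v i ^ 2 = ∑ i, w' i * b'.repr (A v) i ^ 2) :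
    Nat.card {i // w i < 0} ≤ Nat.card {i // w' i < 0} := by
  classical
  have h1 : NegDefOn (fun v => ∑ i, w i * b.repr v i ^ 2)
      (Submodule.span ℝ (b '' {i | w i < 0})) := by
    intro v hv hne
    have := diag_pos_of_mem_span b (fun i => - w i) _ (fun i hi => neg_pos.2 hi) hv hne
    simp only [neg_mul, Finset.sum_neg_distrib] at this
    simpa using this
  -- The non-negative part of the second form, pulled back along `A`, is semidefinite for the first
  -- one, so it bounds the dimension of the negative part of the first.
  have h2 : ∀ v ∈ (Submodule.span ℝ (Set.image b' {i | ¬ w' i < 0})).comap A.toLinearMap,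
      0 ≤ ∑ i, w i * b.repr v i ^ 2 := by
    intro v hv
    rw [h v]
    rw [Submodule.mem_comap, Module.Basis.mem_span_image] at hv
    refine Finset.sum_nonneg fun i _ => ?_
    by_cases hi : w' i < 0
    · have : b'.repr (A v) i = 0 := by
        by_contra h0
        exact hv (Finsupp.mem_support_iff.2 h0) hi
      simp [this]
    · exact mul_nonneg (not_lt.1 hi) (sq_nonneg _)
  have h3 := finrank_add_le_of_negDefOn h1 h2
  rw [finrank_span_subset] at h3
  have h4 : Module.finrank ℝ ((Submodule.span ℝ (Set.image b' {i | ¬ w' i < 0})).comap A.toLinearMap) =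
      Nat.card {i // ¬ w' i < 0} := by
    rw [← finrank_span_subset b']
    exact LinearEquiv.finrank_eq (A.submoduleMap _ |>.trans (LinearEquiv.ofEq _ _
      (Submodule.map_comap_eq_of_surjective A.surjective _)))
  rw [h4, Module.finrank_eq_card_basis b] at h3
  rw [Nat.card_eq_fintype_card, Nat.card_eq_fintype_card, Fintype.card_subtype_compl] at h3
  have h5 := Fintype.card_subtype_le fun i => w' i < 0
  rw [Nat.card_eq_fintype_card, Nat.card_eq_fintype_card]
  omega

end Index

/-! ### Index of a form and of its restriction to a hyperplane. -/

section Hyperplane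

variable {V V' : Type*} [AddCommGroup V] [Module ℝ V] [FiniteDimensional ℝ V]
  [AddCommGroup V'] [Module ℝ V'] [FiniteDimensional ℝ V']

theorem apply_add_smul_of_ortho {B : V →ₗ[ℝ] V →ₗ[ℝ] ℝ} (hs : ∀ v w, B v w = B w v)
    {u w : V} (h : B u w = 0) (c : ℝ) :
    B (w + c • u) (w + c • u) = B w w + c ^ 2 * B u u := by
  have := hs w u
  simp only [map_add, map_smul, LinearMap.add_apply, LinearMap.smul_apply, smul_eq_mul, h,
    this]
  ring

/-- A splitting of the restriction of `B` to the hyperplane `j(V')` and a vector `u`, orthogonal to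
the hyperplane, with `B u u ≠ 0`, give a splitting for `B`. -/
theorem IsSplitting.of_hyperplane {B : V →ₗ[ℝ] V →ₗ[ℝ] ℝ} (hs : ∀ v w, B v w = B w v)
    (j : V' →ₗ[ℝ] V) (hj : Function.Injective j)
    (hd : Module.finrank ℝ V = Module.finrank ℝ V' + 1)
    {u : V} (hu : ∀ w, B u (j w) = 0) (hne : B u u ≠ 0) {W W' : Submodule ℝ V'}
    (h : IsSplitting (fun v => B (j v) (j v)) W W') :
    ∃ X X' : Submodule ℝ V, IsSplitting (fun v => B v v) X X' ∧
      Module.finrank ℝ X = Module.finrank ℝ W + if B u u < 0 then 1 else 0 := by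
  have hu0 : u ≠ 0 := by
    rintro rfl
    simp at hne
  have hdisj : ∀ Y : Submodule ℝ V', Disjoint (Y.map j) (ℝ ∙ u) := by
    intro Y
    rw [Submodule.disjoint_def]
    rintro v ⟨y, -, rfl⟩ hv
    obtain ⟨c, hc⟩ := Submodule.mem_span_singleton.1 hv
    have h1 := hu y
    rw [← hc] at h1
    simp only [map_smul, smul_eq_mul, mul_eq_zero, hne, or_false] at h1
    rw [← hc, h1, zero_smul]
  have hfin : ∀ Y : Submodule ℝ V', Module.finrank ℝ (Y.map j) = Module.finrank ℝ Y := fun Y =>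
    (Submodule.equivMapOfInjective j hj Y).finrank_eq.symm
  have hfin' : ∀ Y : Submodule ℝ V', Module.finrank ℝ (Y.map j ⊔ (ℝ ∙ u) : Submodule ℝ V) =
      Module.finrank ℝ Y + 1 := by
    intro Y
    have := Submodule.finrank_sup_add_finrank_inf_eq (Y.map j) (ℝ ∙ u)
    rw [(hdisj Y).eq_bot, finrank_bot, finrank_span_singleton hu0, hfin] at this
    omega
  have hform : ∀ {Y : Submodule ℝ V'} {v : V}, v ∈ Y.map j ⊔ (ℝ ∙ u) →
      ∃ y ∈ Y, ∃ c : ℝ, v = j y + c • u ∧ B v v = B (j y) (j y) + c ^ 2 * B u u := by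
    intro Y v hv
    obtain ⟨_, ⟨y, hy, rfl⟩, x, hx, rfl⟩ := Submodule.mem_sup.1 hv
    obtain ⟨c, rfl⟩ := Submodule.mem_span_singleton.1 hx
    exact ⟨y, hy, c, rfl, apply_add_smul_of_ortho hs (hu y) c⟩
  -- The line through u joins the negative or the positive summand according to the sign of B(u,u);
  -- orthogonality makes the two parts of the form add up.
  by_cases hneg : B u u < 0
  · refine ⟨W.map j ⊔ (ℝ ∙ u), W'.map j, ⟨?_, ?_, ?_⟩, ?_⟩
    · intro v hv hv0
      obtain ⟨y, hy, c, rfl, hB⟩ := hform hv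
      simp only [hB]
      by_cases hy0 : y = 0
      · have hc : c ≠ 0 := by
          rintro rfl
          simp [hy0] at hv0
        have : 0 < c ^ 2 := by positivity
        simp only [hy0, map_zero]
        nlinarith
      · have := h.neg y hy hy0
        nlinarith [sq_nonneg c]
    · rintro _ ⟨y, hy, rfl⟩ hv0
      exact h.pos y hy (by rintro rfl; simp at hv0)
    · rw [hfin', hfin, hd, ← h.finrank_eq]
      omega
    · rw [hfin', if_pos hneg]
  · have hpos : 0 < B u u := lt_of_le_of_ne (not_lt.1 hneg) hne.symm
    refine ⟨W.map j, W'.map j ⊔ (ℝ ∙ u), ⟨?_, ?_, ?_⟩, ?_⟩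
    · rintro _ ⟨y, hy, rfl⟩ hv0
      exact h.neg y hy (by rintro rfl; simp at hv0)
    · intro v hv hv0
      obtain ⟨y, hy, c, rfl, hB⟩ := hform hv
      simp only [hB]
      by_cases hy0 : y = 0
      · have hc : c ≠ 0 := by
          rintro rfl
          simp [hy0] at hv0
        have : 0 < c ^ 2 := by positivity
        simp only [hy0, map_zero]
        nlinarith
      · have := h.pos y hy hy0
        nlinarith [sq_nonneg c]
    · rw [hfin', hfin, hd, ← h.finrank_eq]
      omega
    · rw [hfin, if_neg hneg, add_zero]

end Hyperplane

/-! ### Definiteness is an open condition. -/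

section Openness

variable {V : Type*} [NormedAddCommGroup V] [NormedSpace ℝ V] [FiniteDimensional ℝ V]

/-- A bilinear form given by a continuous linear map, as a purely algebraic object. -/
def toBilin (B : V →L[ℝ] V →L[ℝ] ℝ) : V →ₗ[ℝ] V →ₗ[ℝ] ℝ :=
  LinearMap.mk₂ ℝ (fun v w => B v w) (by simp) (by simp) (by simp) (by simp)

theorem toBilin_apply (B : V →L[ℝ] V →L[ℝ] ℝ) (v w : V) : toBilin B v w = B v w := rfl

/-- On the compact unit sphere of `W` positivity is stable under small changes of the form;
homogeneity of degree two extends it to all of `W`. -/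
theorem eventually_posDefOn {B : V →L[ℝ] V →L[ℝ] ℝ} {W : Submodule ℝ V}
    (h : PosDefOn (fun v => B v v) W) :
    ∀ᶠ B' : V →L[ℝ] V →L[ℝ] ℝ in 𝓝 B, PosDefOn (fun v => B' v v) W := by
  let S : Set V := (W : Set V) ∩ Metric.sphere 0 1
  have hS : IsCompact S := (isCompact_sphere (0 : V) 1).inter_left W.closed_of_finiteDimensional
  have hev : ∀ᶠ B' : V →L[ℝ] V →L[ℝ] ℝ in 𝓝 B, ∀ v ∈ S, 0 < B' v v := by
    have hpt : ∀ v ∈ S, ∀ᶠ z : (V →L[ℝ] V →L[ℝ] ℝ) × V in 𝓝 B ×ˢ 𝓝 v, 0 < z.1 z.2 z.2 := by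
      intro v hv
      rw [← nhds_prod_eq]
      have hc : Continuous fun z : (V →L[ℝ] V →L[ℝ] ℝ) × V => z.1 z.2 z.2 := by fun_prop
      have hv0 : v ≠ 0 := by
        rintro rfl
        simpa using hv.2
      exact hc.continuousAt.eventually (lt_mem_nhds (h v hv.1 hv0))
    exact hS.eventually_forall_of_forall_eventually fun v hv => by
      have := hpt v hv
      rwa [nhds_prod_eq] 
  filter_upwards [hev] with B' hB' v hv hv0
  have hn : 0 < ‖v‖ := norm_pos_iff.2 hv0
  have h1 := hB' (‖v‖⁻¹ • v) ⟨W.smul_mem _ hv, by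
    simp [norm_smul, inv_mul_cancel₀ hn.ne']⟩
  simp only [map_smul, _root_.smul_apply, smul_eq_mul] at h1
  have h2 : 0 < ‖v‖⁻¹ := inv_pos.2 hn
  rw [← mul_assoc] at h1
  exact (mul_pos_iff_of_pos_left (mul_pos h2 h2)).1 h1

theorem eventually_negDefOn {B : V →L[ℝ] V →L[ℝ] ℝ} {W : Submodule ℝ V}
    (h : NegDefOn (fun v => B v v) W) :
    ∀ᶠ B' : V →L[ℝ] V →L[ℝ] ℝ in 𝓝 B, NegDefOn (fun v => B' v v) W := by
  have h1 : PosDefOn (fun v => (-B) v v) W := fun v hv hv0 => by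
    have := h v hv hv0
    simpa using this
  have hc : Continuous fun B' : V →L[ℝ] V →L[ℝ] ℝ => -B' :=
    (LinearIsometryEquiv.neg ℝ (E := V →L[ℝ] V →L[ℝ] ℝ)).continuous
  have h2 := (hc.tendsto B).eventually (eventually_posDefOn h1)
  filter_upwards [h2] with B' hB' v hv hv0
  have := hB' v hv hv0
  simpa using this

/-- The same two subspaces serve for all nearby forms, so the index at the perturbed critical point
is the one at p. -/
theorem IsSplitting.eventually {B : V →L[ℝ] V →L[ℝ] ℝ} {W W' : Submodule ℝ V}
    (h : IsSplitting (fun v => B v v) W W') :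
    ∀ᶠ B' : V →L[ℝ] V →L[ℝ] ℝ in 𝓝 B, IsSplitting (fun v => B' v v) W W' := by
  filter_upwards [eventually_negDefOn h.neg, eventually_posDefOn h.pos] with B' h1 h2
  exact ⟨h1, h2, h.finrank_eq⟩

end Openness

/-! ### Critical points, Hessians and indices do not depend on the slice chart. -/

section Charts

variable {m : ℕ} {M : Type*} [TopologicalSpace M] [ChartedSpace (Euc m) M]

theorem two_le_infty : (2 : WithTop ℕ∞) ≤ ∞ := ENat.LEInfty.out

theorem mem_contDiffGroupoid_iff {d : ℕ} (e : OpenPartialHomeomorph (Euc d) (Euc d)) :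
    e ∈ contDiffGroupoid ∞ (𝓡 d) ↔ ContDiffOn ℝ ∞ e e.source ∧ ContDiffOn ℝ ∞ e.symm e.target := by
  rw [contDiffGroupoid, mem_groupoid_of_pregroupoid]
  simp [contDiffPregroupoid]

theorem contDiffOn_transition {Φ Φ' : OpenPartialHomeomorph M (Euc m)}
    (h : Φ ∈ IsManifold.maximalAtlas (𝓡 m) ∞ M) (h' : Φ' ∈ IsManifold.maximalAtlas (𝓡 m) ∞ M) :
    ContDiffOn ℝ ∞ (Φ.symm.trans Φ') (Φ.symm.trans Φ').source :=
  ((mem_contDiffGroupoid_iff _).1 (StructureGroupoid.compatible_of_mem_maximalAtlas h h')).1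

theorem contDiffAt_transition {Φ Φ' : OpenPartialHomeomorph M (Euc m)}
    (h : Φ ∈ IsManifold.maximalAtlas (𝓡 m) ∞ M) (h' : Φ' ∈ IsManifold.maximalAtlas (𝓡 m) ∞ M)
    {x : Euc m} (hx : x ∈ Φ.target) (hx' : Φ.symm x ∈ Φ'.source) :
    ContDiffAt ℝ ∞ (fun y => Φ' (Φ.symm y)) x :=
  (contDiffOn_transition h h').contDiffAt
    ((Φ.symm.trans Φ').open_source.mem_nhds (by simp [hx, hx']))

theorem trans_mem_maximalAtlas {Φ : OpenPartialHomeomorph M (Euc m)}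
    {e : OpenPartialHomeomorph (Euc m) (Euc m)}
    (h : Φ ∈ IsManifold.maximalAtlas (𝓡 m) ∞ M) (he : e ∈ contDiffGroupoid ∞ (𝓡 m)) :
    Φ.trans e ∈ IsManifold.maximalAtlas (𝓡 m) ∞ M := by
  have h0 : ∀ e' ∈ atlas (Euc m) M, Φ.symm.trans e' ∈ contDiffGroupoid ∞ (𝓡 m) ∧
      e'.symm.trans Φ ∈ contDiffGroupoid ∞ (𝓡 m) := h
  intro e' he'
  refine ⟨?_, ?_⟩
  · rw [OpenPartialHomeomorph.trans_symm_eq_symm_trans_symm, OpenPartialHomeomorph.trans_assoc]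
    exact StructureGroupoid.trans _ (StructureGroupoid.symm _ he) (h0 e' he').1
  · rw [← OpenPartialHomeomorph.trans_assoc]
    exact StructureGroupoid.trans _ (h0 e' he').2 he

theorem restr_mem_maximalAtlas {Φ : OpenPartialHomeomorph M (Euc m)}
    (h : Φ ∈ IsManifold.maximalAtlas (𝓡 m) ∞ M) {U : Set M} (hU : IsOpen U) :
    Φ.restr U ∈ IsManifold.maximalAtlas (𝓡 m) ∞ M :=
  _root_.restr_mem_maximalAtlas _ h hU

theorem contDiffAt_comp_chart_symm {Φ : OpenPartialHomeomorph M (Euc m)}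
    (h : Φ ∈ IsManifold.maximalAtlas (𝓡 m) ∞ M) {E : Type*} [NormedAddCommGroup E]
    [NormedSpace ℝ E] {g : M → E} {x : Euc m} (hx : x ∈ Φ.target)
    (hg : ContMDiffAt (𝓡 m) 𝓘(ℝ, E) ∞ g (Φ.symm x)) :
    ContDiffAt ℝ ∞ (fun y => g (Φ.symm y)) x := by
  rw [← contMDiffAt_iff_contDiffAt]
  exact hg.comp x ((contMDiffOn_symm_of_mem_maximalAtlas h).contMDiffAt
    (Φ.open_target.mem_nhds hx))

/-- The coordinate change between two slices. -/
def sliceMap (Φ Φ' : OpenPartialHomeomorph M (Euc m)) (d : ℕ) : Euc d → Euc d :=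
  fun v => resize d (Φ' (Φ.symm (resize m v)))

theorem IsSliceChart.resize_resize {S : Set M} {d : ℕ} {Φ : OpenPartialHomeomorph M (Euc m)}
    (h : IsSliceChart S d Φ) {q : M} (hq : q ∈ Φ.source) (hS : q ∈ S) :
    resize m (resize d (Φ q)) = Φ q :=
  resize_resize_of_crd _ ((h.mem_iff q hq).1 hS)

theorem IsSliceChart.symm_mem {S : Set M} {d : ℕ} {Φ : OpenPartialHomeomorph M (Euc m)}
    (h : IsSliceChart S d Φ) {v : Euc d} (hv : resize m v ∈ Φ.target) :
    Φ.symm (resize m v) ∈ S := by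
  rw [h.mem_iff _ (Φ.map_target hv), Φ.right_inv hv]
  intro i h1 h2
  rw [crd_resize _ (by omega) h2, crd_of_not (by omega)]

variable {S : Set M} {d : ℕ} {Φ Φ' : OpenPartialHomeomorph M (Euc m)} {q : M}

theorem resize_sliceMap (h : IsSliceChart S d Φ) (h' : IsSliceChart S d Φ') {v : Euc d}
    (hv : resize m v ∈ Φ.target) (hv' : Φ.symm (resize m v) ∈ Φ'.source) :
    resize m (sliceMap Φ Φ' d v) = Φ' (Φ.symm (resize m v)) :=
  h'.resize_resize hv' (h.symm_mem hv)

theorem localRep_sliceMap (h : IsSliceChart S d Φ) (h' : IsSliceChart S d Φ') {v : Euc d}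
    (hv : resize m v ∈ Φ.target) (hv' : Φ.symm (resize m v) ∈ Φ'.source) (g : M → ℝ) :
    localRep Φ' d g (sliceMap Φ Φ' d v) = localRep Φ d g v := by
  rw [localRep, localRep, resize_sliceMap h h' hv hv', Φ'.left_inv hv']

theorem sliceMap_sliceMap (h : IsSliceChart S d Φ) (h' : IsSliceChart S d Φ') {v : Euc d}
    (hv : resize m v ∈ Φ.target) (hv' : Φ.symm (resize m v) ∈ Φ'.source) :
    sliceMap Φ' Φ d (sliceMap Φ Φ' d v) = v := by
  rw [sliceMap, resize_sliceMap h h' hv hv', Φ'.left_inv hv', Φ.right_inv hv,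
    resize_resize_of_le h.dim_le]

theorem sliceMap_resize (h : IsSliceChart S d Φ) (hq : q ∈ Φ.source) (hS : q ∈ S) :
    sliceMap Φ Φ' d (resize d (Φ q)) = resize d (Φ' q) := by
  rw [sliceMap, h.resize_resize hq hS, Φ.left_inv hq]

theorem eventually_mem_slice (h : IsSliceChart S d Φ) (hq : q ∈ Φ.source) (hq' : q ∈ Φ'.source)
    (hS : q ∈ S) : ∀ᶠ v in 𝓝 (resize d (Φ q)),
      resize m v ∈ Φ.target ∧ Φ.symm (resize m v) ∈ Φ'.source := by
  have h1 : resize m (resize d (Φ q)) ∈ (Φ.symm.trans Φ').source := by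
    rw [h.resize_resize hq hS]
    simp [hq, hq']
  have h2 := (contDiff_resize (n := 0) (a := d) (b := m)).continuous.continuousAt.preimage_mem_nhds
    ((Φ.symm.trans Φ').open_source.mem_nhds h1)
  filter_upwards [h2] with v hv
  simpa using hv

theorem contDiffAt_sliceMap (h : IsSliceChart S d Φ) (h' : IsSliceChart S d Φ')
    (hq : q ∈ Φ.source) (hq' : q ∈ Φ'.source) (hS : q ∈ S) :
    ContDiffAt ℝ ∞ (sliceMap Φ Φ' d) (resize d (Φ q)) := by
  have h1 : ContDiffAt ℝ ∞ (fun y => Φ' (Φ.symm y)) (resize m (resize d (Φ q))) := by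
    rw [h.resize_resize hq hS]
    exact contDiffAt_transition h.mem_atlas h'.mem_atlas (Φ.map_source hq)
      (by rwa [Φ.left_inv hq])
  exact contDiff_resize.contDiffAt.comp _ (h1.comp _ contDiff_resize.contDiffAt)

theorem contDiffAt_localRep {g : M → ℝ} (hΦ : Φ ∈ IsManifold.maximalAtlas (𝓡 m) ∞ M)
    {v : Euc d} (hv : resize m v ∈ Φ.target)
    (hg : ContMDiffAt (𝓡 m) 𝓘(ℝ, ℝ) ∞ g (Φ.symm (resize m v))) :
    ContDiffAt ℝ ∞ (localRep Φ d g) v :=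
  (contDiffAt_comp_chart_symm hΦ hv hg).comp v contDiff_resize.contDiffAt

theorem contDiffAt_localRep_point {g : M → ℝ} (h : IsSliceChart S d Φ) (hq : q ∈ Φ.source)
    (hS : q ∈ S) (hg : ContMDiff (𝓡 m) 𝓘(ℝ, ℝ) ∞ g) :
    ContDiffAt ℝ ∞ (localRep Φ d g) (resize d (Φ q)) :=
  contDiffAt_localRep h.mem_atlas (by rw [h.resize_resize hq hS]; exact Φ.map_source hq) hg.contMDiffAt

/-- The second derivative of a composite has one further term, Dh applied to the second derivative
of τ; it vanishes at a critical point. -/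
theorem fderiv_fderiv_comp_of_crit {E F : Type*} [NormedAddCommGroup E] [NormedSpace ℝ E]
    [NormedAddCommGroup F] [NormedSpace ℝ F] {h : F → ℝ} {τ : E → F} {x : E}
    (hh : ContDiffAt ℝ 2 h (τ x)) (hτ : ContDiffAt ℝ 2 τ x) (hc : fderiv ℝ h (τ x) = 0) (v w : E) :
    fderiv ℝ (fderiv ℝ (h ∘ τ)) x v w =
      fderiv ℝ (fderiv ℝ h) (τ x) (fderiv ℝ τ x v) (fderiv ℝ τ x w) := by
  have e1 : fderiv ℝ (h ∘ τ) =ᶠ[𝓝 x] fun y => (fderiv ℝ h (τ y)).comp (fderiv ℝ τ y) := by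
    have h1 : ∀ᶠ y in 𝓝 x, ContDiffAt ℝ 2 τ y := hτ.eventually (by simp)
    have h2 : ∀ᶠ y in 𝓝 x, ContDiffAt ℝ 2 h (τ y) :=
      hτ.continuousAt.eventually (hh.eventually (by simp))
    filter_upwards [h1, h2] with y hy1 hy2
    exact fderiv_comp y (hy2.differentiableAt (by simp)) (hy1.differentiableAt (by simp))
  have d1 : HasFDerivAt (fderiv ℝ h) (fderiv ℝ (fderiv ℝ h) (τ x)) (τ x) :=
    ((hh.fderiv_right (m := 1) (by norm_num)).differentiableAt (by simp)).hasFDerivAt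
  have d2 : HasFDerivAt (fderiv ℝ τ) (fderiv ℝ (fderiv ℝ τ) x) x :=
    ((hτ.fderiv_right (m := 1) (by norm_num)).differentiableAt (by simp)).hasFDerivAt
  have d3 : HasFDerivAt τ (fderiv ℝ τ x) x := (hτ.differentiableAt (by simp)).hasFDerivAt
  have d4 := (d1.comp x d3).clm_comp d2
  rw [e1.fderiv_eq]
  have d5 := d4.fderiv
  simp only [Function.comp_def] at d5
  rw [d5]
  simp [hc]

variable {g : M → ℝ}

theorem localDeriv_eq_comp (hg : ContMDiff (𝓡 m) 𝓘(ℝ, ℝ) ∞ g) (h : IsSliceChart S d Φ)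
    (h' : IsSliceChart S d Φ') (hq : q ∈ Φ.source) (hq' : q ∈ Φ'.source) (hS : q ∈ S) :
    localDeriv Φ d g q =
      (localDeriv Φ' d g q).comp (fderiv ℝ (sliceMap Φ Φ' d) (resize d (Φ q))) := by
  have e : localRep Φ d g =ᶠ[𝓝 (resize d (Φ q))] localRep Φ' d g ∘ sliceMap Φ Φ' d := by
    filter_upwards [eventually_mem_slice h hq hq' hS] with v hv
    exact (localRep_sliceMap h h' hv.1 hv.2 g).symm
  rw [localDeriv, e.fderiv_eq, fderiv_comp, sliceMap_resize h hq hS]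
  · rfl
  · rw [sliceMap_resize h hq hS]
    exact (contDiffAt_localRep_point h' hq' hS hg).differentiableAt (by simp)
  · exact (contDiffAt_sliceMap h h' hq hq' hS).differentiableAt (by simp)

theorem fderiv_sliceMap_comp (h : IsSliceChart S d Φ)
    (h' : IsSliceChart S d Φ') (hq : q ∈ Φ.source) (hq' : q ∈ Φ'.source) (hS : q ∈ S) (v : Euc d) :
    fderiv ℝ (sliceMap Φ' Φ d) (resize d (Φ' q))
      (fderiv ℝ (sliceMap Φ Φ' d) (resize d (Φ q)) v) = v := by
  have e : sliceMap Φ' Φ d ∘ sliceMap Φ Φ' d =ᶠ[𝓝 (resize d (Φ q))] id := by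
    filter_upwards [eventually_mem_slice h hq hq' hS] with v hv
    exact sliceMap_sliceMap h h' hv.1 hv.2
  have e1 := e.fderiv_eq (𝕜 := ℝ)
  rw [fderiv_comp, sliceMap_resize h hq hS, fderiv_id] at e1
  · exact congrArg (fun L : Euc d →L[ℝ] Euc d => L v) e1
  · rw [sliceMap_resize h hq hS]
    exact (contDiffAt_sliceMap h' h hq' hq hS).differentiableAt (by simp)
  · exact (contDiffAt_sliceMap h h' hq hq' hS).differentiableAt (by simp)

theorem localHess_eq_comp (hg : ContMDiff (𝓡 m) 𝓘(ℝ, ℝ) ∞ g) (h : IsSliceChart S d Φ)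
    (h' : IsSliceChart S d Φ') (hq : q ∈ Φ.source) (hq' : q ∈ Φ'.source) (hS : q ∈ S)
    (hc : localDeriv Φ' d g q = 0) (v w : Euc d) :
    localHess Φ d g q v w =
      localHess Φ' d g q (fderiv ℝ (sliceMap Φ Φ' d) (resize d (Φ q)) v)
        (fderiv ℝ (sliceMap Φ Φ' d) (resize d (Φ q)) w) := by
  have e : localRep Φ d g =ᶠ[𝓝 (resize d (Φ q))] localRep Φ' d g ∘ sliceMap Φ Φ' d := by
    filter_upwards [eventually_mem_slice h hq hq' hS] with v hv
    exact (localRep_sliceMap h h' hv.1 hv.2 g).symm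
  have e2 := sliceMap_resize (Φ' := Φ') h hq hS
  rw [localHess, e.fderiv.fderiv_eq, fderiv_fderiv_comp_of_crit, e2]
  · rfl
  · rw [e2]
    exact (contDiffAt_localRep_point h' hq' hS hg).of_le two_le_infty
  · exact (contDiffAt_sliceMap h h' hq hq' hS).of_le two_le_infty
  · rw [e2]
    exact hc

theorem localDeriv_eq_zero_iff (hg : ContMDiff (𝓡 m) 𝓘(ℝ, ℝ) ∞ g) (h : IsSliceChart S d Φ)
    (h' : IsSliceChart S d Φ') (hq : q ∈ Φ.source) (hq' : q ∈ Φ'.source) (hS : q ∈ S) :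
    localDeriv Φ d g q = 0 ↔ localDeriv Φ' d g q = 0 := by
  constructor <;> intro hz
  · rw [localDeriv_eq_comp hg h' h hq' hq hS, hz, ContinuousLinearMap.zero_comp]
  · rw [localDeriv_eq_comp hg h h' hq hq' hS, hz, ContinuousLinearMap.zero_comp]

/-- The derivatives in two slice charts differ by composition with the derivative of the coordinate
change. Hence the existential quantifier over charts can be evaluated in any one of them. -/
theorem isCritOn_iff (hg : ContMDiff (𝓡 m) 𝓘(ℝ, ℝ) ∞ g) (h : IsSliceChart S d Φ)
    (hq : q ∈ Φ.source) : IsCritOn m S d g q ↔ q ∈ S ∧ localDeriv Φ d g q = 0 := by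
  constructor
  · rintro ⟨hS, Φ', h', hq', hc⟩
    exact ⟨hS, (localDeriv_eq_zero_iff hg h h' hq hq' hS).2 hc⟩
  · rintro ⟨hS, hc⟩
    exact ⟨hS, Φ, h, hq, hc⟩

theorem isNondegCritOn_iff (hg : ContMDiff (𝓡 m) 𝓘(ℝ, ℝ) ∞ g) (h : IsSliceChart S d Φ)
    (hq : q ∈ Φ.source) : IsNondegCritOn m S d g q ↔ q ∈ S ∧ localDeriv Φ d g q = 0 ∧
      ∀ v, (∀ w, localHess Φ d g q v w = 0) → v = 0 := by
  constructor
  · rintro ⟨hS, Φ', h', hq', hc, hn⟩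
    refine ⟨hS, (localDeriv_eq_zero_iff hg h h' hq hq' hS).2 hc, fun v hv => ?_⟩
    have h1 := hn (fderiv ℝ (sliceMap Φ Φ' d) (resize d (Φ q)) v) fun w => by
      rw [← fderiv_sliceMap_comp h' h hq' hq hS w, ← localHess_eq_comp hg h h' hq hq' hS hc]
      exact hv _
    rw [← fderiv_sliceMap_comp h h' hq hq' hS v, h1, map_zero]
  · rintro ⟨hS, hc, hn⟩
    exact ⟨hS, Φ, h, hq, hc, hn⟩

/-- A negative definite subspace found in another chart is carried to `Φ` by the injective
derivative of the slice map, without change of its dimension. -/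
theorem morseIndex_eq (hg : ContMDiff (𝓡 m) 𝓘(ℝ, ℝ) ∞ g) (h : IsSliceChart S d Φ)
    (hq : q ∈ Φ.source) (hS : q ∈ S) (hc : localDeriv Φ d g q = 0) :
    morseIndex m S d g q = sSup {r | ∃ W : Submodule ℝ (Euc d), Module.finrank ℝ W = r ∧
      NegDefOn (fun v => localHess Φ d g q v v) W} := by
  rw [morseIndex]
  congr 1
  ext r
  constructor
  · rintro ⟨Φ', h', hq', W, rfl, hW⟩
    have hinj : Function.Injective
        (fderiv ℝ (sliceMap Φ' Φ d) (resize d (Φ' q))).toLinearMap := fun v w hvw => by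
      rw [← fderiv_sliceMap_comp h' h hq' hq hS v, ← fderiv_sliceMap_comp h' h hq' hq hS w]
      exact congrArg _ hvw
    refine ⟨W.map (fderiv ℝ (sliceMap Φ' Φ d) (resize d (Φ' q))).toLinearMap,
      (Submodule.equivMapOfInjective _ hinj W).finrank_eq.symm, ?_⟩
    rintro _ ⟨w, hw, rfl⟩ hne
    have := hW w hw (by rintro rfl; simp at hne)
    rwa [localHess_eq_comp hg h' h hq' hq hS hc] at this
  · rintro ⟨W, rfl, hW⟩
    exact ⟨Φ, h, hq, W, rfl, hW⟩

theorem morseIndex_eq_of_isSplitting (hg : ContMDiff (𝓡 m) 𝓘(ℝ, ℝ) ∞ g)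
    (h : IsSliceChart S d Φ) (hq : q ∈ Φ.source) (hS : q ∈ S) (hc : localDeriv Φ d g q = 0)
    {W W' : Submodule ℝ (Euc d)} (hW : IsSplitting (fun v => localHess Φ d g q v v) W W') :
    morseIndex m S d g q = Module.finrank ℝ W := by
  rw [morseIndex_eq hg h hq hS hc]
  exact IsSplitting.sSup_eq (B := toBilin (localHess Φ d g q)) hW

theorem localHess_symm (hg : ContMDiff (𝓡 m) 𝓘(ℝ, ℝ) ∞ g)
    (h : IsSliceChart S d Φ) (hq : q ∈ Φ.source) (hS : q ∈ S) (v w : Euc d) :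
    localHess Φ d g q v w = localHess Φ d g q w v :=
  ((contDiffAt_localRep_point h hq hS hg).isSymmSndFDerivAt
    (by simp only [minSmoothness_of_isRCLikeNormedField]; exact two_le_infty)).eq v w

/-- Shrinking a chart lets two sets that agree near a point be exchanged; this is how the stratum,
its closure and one half of it are compared. -/
theorem IsSliceChart.restr {S' : Set M} (h : IsSliceChart S d Φ) {U : Set M} (hU : IsOpen U)
    (hS : ∀ q ∈ U, q ∈ Φ.source → (q ∈ S ↔ q ∈ S')) : IsSliceChart S' d (Φ.restr U) where
  dim_le := h.dim_le
  mem_atlas := restr_mem_maximalAtlas h.mem_atlas hU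
  mem_iff q hq := by
    rw [OpenPartialHomeomorph.restr_source' _ _ hU] at hq
    rw [← hS q hq.2 hq.1]
    exact h.mem_iff q hq.1

theorem IsCritOn.congr_set {S' : Set M} {U : Set M} (hU : IsOpen U) (hqU : q ∈ U)
    (hS : ∀ q ∈ U, (q ∈ S ↔ q ∈ S')) (h : IsCritOn m S d g q) : IsCritOn m S' d g q := by
  obtain ⟨hqS, Φ, hΦ, hq, hc⟩ := h
  refine ⟨(hS q hqU).1 hqS, Φ.restr U, hΦ.restr hU fun x hx _ => hS x hx, ?_, hc⟩
  rw [OpenPartialHomeomorph.restr_source' _ _ hU]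
  exact ⟨hq, hqU⟩

theorem IsNondegCritOn.congr_set {S' : Set M} {U : Set M} (hU : IsOpen U) (hqU : q ∈ U)
    (hS : ∀ q ∈ U, (q ∈ S ↔ q ∈ S')) (h : IsNondegCritOn m S d g q) :
    IsNondegCritOn m S' d g q := by
  obtain ⟨hqS, Φ, hΦ, hq, hc⟩ := h
  refine ⟨(hS q hqU).1 hqS, Φ.restr U, hΦ.restr hU fun x hx _ => hS x hx, ?_, hc⟩
  rw [OpenPartialHomeomorph.restr_source' _ _ hU]
  exact ⟨hq, hqU⟩

end Charts

section

open Asymptotics Polynomial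

/-! ### Contact of curves with the fibre and with the singular set. -/

section Contact

variable {m n : ℕ}

/-- The curve `γ` through `x` has contact of order `N` with the fibre of `g` and with the
singular set of `g`; the latter is witnessed by the covectors `η s`. -/
structure IsContact (g : Euc m → Euc n) (x : Euc m) (γ : ℝ → Euc m) (η : ℝ → Euc n →L[ℝ] ℝ)
    (N : ℕ) : Prop where
  map_zero : γ 0 = x
  deriv : ∃ v, v ≠ 0 ∧ HasDerivAt γ v 0
  cont : ContinuousAt η 0
  ne : η 0 ≠ 0
  contact : (fun s => g (γ s) - g x) =O[𝓝 0] fun s : ℝ => s ^ N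
  conormal : (fun s => (η s).comp (fderiv ℝ g (γ s))) =O[𝓝 0] fun s : ℝ => s ^ N

/-- The germs of `g` at `x` and of `g'` at `x'` agree after the local diffeomorphisms `e` of the
source and `e'` of the target. -/
structure IsLocEquiv (g : Euc m → Euc n) (x : Euc m) (g' : Euc m → Euc n) (x' : Euc m)
    (e : OpenPartialHomeomorph (Euc m) (Euc m)) (e' : OpenPartialHomeomorph (Euc n) (Euc n)) :
    Prop where
  mem_source : x ∈ e.source
  map_eq : e x = x'
  mem_groupoid : e ∈ contDiffGroupoid ∞ (𝓡 m)
  mem_groupoid' : e' ∈ contDiffGroupoid ∞ (𝓡 n)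
  map_mem : ∀ y ∈ e.source, g y ∈ e'.source
  comm : ∀ y ∈ e.source, e' (g y) = g' (e y)

variable {g g' : Euc m → Euc n} {x x' : Euc m} {e : OpenPartialHomeomorph (Euc m) (Euc m)}
  {e' : OpenPartialHomeomorph (Euc n) (Euc n)}

theorem IsLocEquiv.symm (h : IsLocEquiv g x g' x' e e') :
    IsLocEquiv g' x' g x e.symm e'.symm where
  mem_source := by
    rw [← h.map_eq]
    exact e.map_source h.mem_source
  map_eq := by rw [← h.map_eq, e.left_inv h.mem_source]
  mem_groupoid := StructureGroupoid.symm _ h.mem_groupoid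
  mem_groupoid' := StructureGroupoid.symm _ h.mem_groupoid'
  map_mem y hy := by
    have h1 := h.comm _ (e.map_target hy)
    rw [e.right_inv hy] at h1
    rw [← h1]
    exact e'.map_source (h.map_mem _ (e.map_target hy))
  comm y hy := by
    have h1 := h.comm _ (e.map_target hy)
    rw [e.right_inv hy] at h1
    rw [← h1, e'.left_inv (h.map_mem _ (e.map_target hy))]

theorem contDiffAt_of_mem_groupoid {d : ℕ} {e : OpenPartialHomeomorph (Euc d) (Euc d)}
    (he : e ∈ contDiffGroupoid ∞ (𝓡 d)) {x : Euc d} (hx : x ∈ e.source) : ContDiffAt ℝ ∞ e x :=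
  ((mem_contDiffGroupoid_iff e).1 he).1.contDiffAt (e.open_source.mem_nhds hx)

theorem fderiv_symm_comp_fderiv {d : ℕ} {e : OpenPartialHomeomorph (Euc d) (Euc d)}
    (he : e ∈ contDiffGroupoid ∞ (𝓡 d)) {x : Euc d} (hx : x ∈ e.source) :
    (fderiv ℝ e.symm (e x)).comp (fderiv ℝ e x) = ContinuousLinearMap.id ℝ (Euc d) := by
  have e1 : e.symm ∘ e =ᶠ[𝓝 x] id := by
    filter_upwards [e.open_source.mem_nhds hx] with y hy using e.left_inv hy
  have e2 := e1.fderiv_eq (𝕜 := ℝ)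
  rwa [fderiv_comp, fderiv_id] at e2
  · exact (contDiffAt_of_mem_groupoid (StructureGroupoid.symm _ he)
      (e.map_source hx)).differentiableAt (by simp)
  · exact (contDiffAt_of_mem_groupoid he hx).differentiableAt (by simp)

theorem fderiv_comp_fderiv_symm {d : ℕ} {e : OpenPartialHomeomorph (Euc d) (Euc d)}
    (he : e ∈ contDiffGroupoid ∞ (𝓡 d)) {x : Euc d} (hx : x ∈ e.source) :
    (fderiv ℝ e x).comp (fderiv ℝ e.symm (e x)) = ContinuousLinearMap.id ℝ (Euc d) := by
  have := fderiv_symm_comp_fderiv (StructureGroupoid.symm _ he) (e.map_source hx)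
  rwa [OpenPartialHomeomorph.symm_symm, e.left_inv hx] at this

theorem IsLocEquiv.fderiv_eq (h : IsLocEquiv g x g' x' e e') (hg : ContDiff ℝ ∞ g) {y : Euc m}
    (hy : y ∈ e.source) : fderiv ℝ g' (e y) =
      ((fderiv ℝ e' (g y)).comp (fderiv ℝ g y)).comp (fderiv ℝ e.symm (e y)) := by
  have hy' := e.map_source hy
  have e1 : g' =ᶠ[𝓝 (e y)] (e' ∘ g) ∘ e.symm := by
    filter_upwards [e.open_target.mem_nhds hy'] with z hz
    have := h.comm _ (e.map_target hz)
    rw [e.right_inv hz] at this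
    exact this.symm
  have d1 : DifferentiableAt ℝ e' (g y) :=
    (contDiffAt_of_mem_groupoid h.mem_groupoid' (h.map_mem y hy)).differentiableAt (by simp)
  have d2 : DifferentiableAt ℝ g y := hg.contDiffAt.differentiableAt (by simp)
  have d3 : DifferentiableAt ℝ e.symm (e y) :=
    (contDiffAt_of_mem_groupoid (StructureGroupoid.symm _ h.mem_groupoid)
      hy').differentiableAt (by simp)
  rw [e1.fderiv_eq, fderiv_comp, e.left_inv hy, fderiv_comp _ d1 d2]
  · rw [e.left_inv hy]
    exact d1.comp y d2
  · exact d3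

/-- The curve is pushed forward by `e`. The fibre condition survives because e' is Lipschitz at g x
to first order, the conormal condition because the derivative of `e.symm` stays bounded along the
curve. -/
theorem IsContact.comp (h : IsLocEquiv g x g' x' e e') (hg : ContDiff ℝ ∞ g) {γ : ℝ → Euc m}
    {η : ℝ → Euc n →L[ℝ] ℝ} {N : ℕ} (hc : IsContact g x γ η N) :
    ∃ η', IsContact g' x' (e ∘ γ) η' N := by
  have hx : γ 0 ∈ e.source := by rw [hc.map_zero]; exact h.mem_source
  obtain ⟨v, hv, hγ⟩ := hc.deriv
  have hev : ∀ᶠ s in 𝓝 (0 : ℝ), γ s ∈ e.source :=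
    hγ.continuousAt.eventually (e.open_source.mem_nhds hx)
  have he1 : ContDiffAt ℝ ∞ e x := contDiffAt_of_mem_groupoid h.mem_groupoid h.mem_source
  have hgx := h.map_mem x h.mem_source
  have hgx' : e' (g x) ∈ e'.target := e'.map_source hgx
  have he' : ContDiffAt ℝ ∞ e' (g x) := contDiffAt_of_mem_groupoid h.mem_groupoid' hgx
  have he's : ContDiffAt ℝ ∞ e'.symm (e' (g x)) :=
    contDiffAt_of_mem_groupoid (StructureGroupoid.symm _ h.mem_groupoid') hgx'
  have hes : ContDiffAt ℝ ∞ e.symm (e x) :=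
    contDiffAt_of_mem_groupoid (StructureGroupoid.symm _ h.mem_groupoid)
      (e.map_source h.mem_source)
  have hγe : HasDerivAt (e ∘ γ) (fderiv ℝ e x v) 0 := by
    have h1 : HasFDerivAt e (fderiv ℝ e x) (γ 0) := by
      rw [hc.map_zero]
      exact (he1.differentiableAt (by simp)).hasFDerivAt
    exact h1.comp_hasDerivAt 0 hγ
  have hgc : ContinuousAt (fun s => g (γ s)) 0 :=
    hg.continuous.continuousAt.comp hγ.continuousAt
  have hec : ContinuousAt (fun s => e' (g (γ s))) 0 :=
    ContinuousAt.comp (g := e') (by rw [hc.map_zero]; exact he'.continuousAt) hgc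
  -- Since Dg' = De' ∘ Dg ∘ (De)⁻¹, composing η with (De')⁻¹ leaves η ∘ Dg ∘ (De)⁻¹.
  refine ⟨fun s => (η s).comp (fderiv ℝ e'.symm (e' (g (γ s)))), ?_, ?_, ?_, ?_, ?_, ?_⟩
  · simp [hc.map_zero, h.map_eq]
  · refine ⟨_, ?_, hγe⟩
    intro h0
    apply hv
    have := congrArg (fun L : Euc m →L[ℝ] Euc m => L v)
      (fderiv_symm_comp_fderiv h.mem_groupoid h.mem_source)
    simpa [h0] using this.symm
  · have h1 : ContinuousAt (fderiv ℝ e'.symm) (e' (g x)) :=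
      (he's.fderiv_right (m := 0) (by simp)).continuousAt
    have h2 : ContinuousAt (fun s => fderiv ℝ e'.symm (e' (g (γ s)))) 0 :=
      ContinuousAt.comp (g := fderiv ℝ e'.symm) (by rw [hc.map_zero]; exact h1) hec
    exact hc.cont.clm_comp h2
  · intro h0
    apply hc.ne
    have h1 := congrArg (fun L : Euc n →L[ℝ] ℝ => L.comp (fderiv ℝ e' (g x))) h0
    simp only [hc.map_zero, ContinuousLinearMap.comp_assoc,
      fderiv_symm_comp_fderiv h.mem_groupoid' hgx] at h1
    simpa using h1
  · have h1 : (fun y => e' y - e' (g x)) =O[𝓝 (g x)] fun y => y - g x :=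
      ((he'.differentiableAt (by simp)).hasFDerivAt).isBigO_sub
    have h2 : Filter.Tendsto (fun s => g (γ s)) (𝓝 0) (𝓝 (g x)) := by
      have := hgc.tendsto
      rwa [hc.map_zero] at this
    have h3 := (h1.comp_tendsto h2).trans hc.contact
    refine IsBigO.congr' h3 ?_ Filter.EventuallyEq.rfl
    filter_upwards [hev] with s hs
    simp only [Function.comp_def]
    rw [h.comm _ hs, h.comm _ h.mem_source, h.map_eq]
  · have h1 : (fun s => fderiv ℝ e.symm (e (γ s))) =O[𝓝 0] fun _ => (1 : ℝ) := by
      have h2 : ContinuousAt (fderiv ℝ e.symm) (e x) :=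
        (hes.fderiv_right (m := 0) (by simp)).continuousAt
      have h3 : ContinuousAt (fun s => fderiv ℝ e.symm (e (γ s))) 0 :=
        ContinuousAt.comp (g := fderiv ℝ e.symm) (by rw [hc.map_zero]; exact h2)
          hγe.continuousAt
      exact h3.tendsto.isBigO_one ℝ
    have h4 : (fun s => ((η s).comp (fderiv ℝ g (γ s))).comp (fderiv ℝ e.symm (e (γ s))))
        =O[𝓝 0] fun s : ℝ => s ^ N := by
      have h5 := hc.conormal.norm_left.mul h1.norm_left
      simp only [mul_one] at h5
      exact (IsBigO.of_norm_le fun s => ContinuousLinearMap.opNorm_comp_le _ _).trans h5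
    refine IsBigO.congr' h4 ?_ Filter.EventuallyEq.rfl
    filter_upwards [hev] with s hs
    rw [Function.comp, h.fderiv_eq hg hs]
    have h6 := fderiv_symm_comp_fderiv h.mem_groupoid' (h.map_mem _ hs)
    ext w
    have h7 := congrArg (fun L : Euc n →L[ℝ] Euc n =>
      L (fderiv ℝ g (γ s) (fderiv ℝ e.symm (e (γ s)) w))) h6
    simp only [ContinuousLinearMap.comp_apply, ContinuousLinearMap.id_apply] at h7
    simp only [ContinuousLinearMap.comp_apply, h7]

end Contact

/-! ### Order of vanishing of a polynomial along a curve. -/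

section Polynomial

/-- Split off the full power r of the root τ(0). The cofactor stays away from 0 and τ(s) - τ(0) is
comparable to s, so s^r = O(s^N), which is impossible for r < N. -/
theorem X_sub_C_pow_dvd_of_isBigO {R : ℝ[X]} (hR : R ≠ 0) {τ : ℝ → ℝ} {u : ℝ}
    (hτ : HasDerivAt τ u 0) (hu : u ≠ 0) {N : ℕ}
    (h : (fun s => R.eval (τ s)) =O[𝓝 0] fun s : ℝ => s ^ N) : (X - C (τ 0)) ^ N ∣ R := by
  obtain ⟨Q, hQ, hQ'⟩ := exists_eq_pow_rootMultiplicity_mul_and_not_dvd R hR (τ 0)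
  set r := rootMultiplicity (τ 0) R
  by_cases hr : N ≤ r
  · exact (pow_dvd_pow _ hr).trans ⟨Q, hQ⟩
  exfalso
  have hQ0 : Q.eval (τ 0) ≠ 0 := fun h0 => hQ' (dvd_iff_isRoot.2 h0)
  have hc : ContinuousAt (fun s => Q.eval (τ s)) 0 :=
    ContinuousAt.comp (g := fun t => Q.eval t) Q.continuous.continuousAt hτ.continuousAt
  have h1 : (fun s => (Q.eval (τ s))⁻¹) =O[𝓝 0] fun _ => (1 : ℝ) :=
    (hc.inv₀ hQ0).tendsto.isBigO_one ℝ
  have h2 := h.mul h1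
  have h3 : (fun s => (τ s - τ 0) ^ r) =O[𝓝 0] fun s : ℝ => s ^ N := by
    refine h2.congr' ?_ (by simp)
    filter_upwards [hc.eventually_ne hQ0] with s hs
    rw [hQ]
    simp only [eval_mul, eval_pow, eval_sub, eval_X, eval_C]
    field_simp
  have h4 : (fun s : ℝ => s - 0) =O[𝓝 0] fun s => τ s - τ 0 := by
    have h9 := (HasDerivAtFilter.isTheta_sub hτ hu).2
    exact h9.comp_tendsto (k := fun s : ℝ => (s, (0 : ℝ)))
      (Filter.tendsto_id.prodMk (Filter.tendsto_pure.2 (by simp)))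
  have h5 := (h4.pow r).trans h3
  simp only [sub_zero] at h5
  have h6 : (fun s : ℝ => s ^ N) =o[𝓝 0] fun s : ℝ => s ^ r := isLittleO_pow_pow (not_le.1 hr)
  have h7 := h5.trans_isLittleO h6
  have h8 : ∃ᶠ s : ℝ in 𝓝 0, s ^ r ≠ 0 := by
    have : ∃ᶠ s : ℝ in 𝓝 0, s ≠ 0 := by
      have h9 : (𝓝[≠] (0 : ℝ)).NeBot := inferInstance
      exact (mem_closure_iff_frequently.1 (mem_closure_iff_nhdsWithin_neBot.2 h9))
    exact this.mono fun s hs => pow_ne_zero _ hs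
  exact isLittleO_irrefl h8 h7

/-- The unfolding `T^(k+1) + ∑ x_i T^(k-i)` of the singularity `A_k`. -/
def morinPoly {m : ℕ} (k : ℕ) (x : Euc m) : ℝ[X] :=
  X ^ (k + 1) + ∑ i ∈ Finset.Icc 1 (k - 1), C (crd x i) * X ^ (k - i)

theorem eval_derivative_morinPoly {m : ℕ} (k : ℕ) (x : Euc m) (t : ℝ) :
    (derivative (morinPoly k x)).eval t = (k + 1) * t ^ k +
      ∑ i ∈ Finset.Icc 1 (k - 1), crd x i * (((k - i : ℕ) : ℝ) * t ^ (k - i - 1)) := by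
  simp [morinPoly, eval_finsetSum, derivative_X_pow]

theorem coeff_derivative_morinPoly_top {m : ℕ} {k : ℕ} (x : Euc m) :
    (derivative (morinPoly k x)).coeff k = k + 1 := by
  have h : ∀ i ∈ Finset.Icc 1 (k - 1), (C (crd x i) * X ^ (k - i)).coeff (k + 1) = (0 : ℝ) := by
    intro i hi
    rw [Finset.mem_Icc] at hi
    simp only [coeff_C_mul, coeff_X_pow]
    rw [if_neg (by omega), mul_zero]
  rw [coeff_derivative, morinPoly, coeff_add, finsetSum_coeff, Finset.sum_eq_zero h]
  simp

theorem derivative_morinPoly_ne_zero {m : ℕ} {k : ℕ} (x : Euc m) :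
    derivative (morinPoly k x) ≠ 0 := by
  intro h
  have := coeff_derivative_morinPoly_top (k := k) x
  rw [h] at this
  simp only [coeff_zero] at this
  linarith [(Nat.cast_nonneg k : (0 : ℝ) ≤ k)]

end Polynomial

/-! ### The last component of the normal form and its derivative. -/

section NormalForm

variable {m : ℕ}

/-- The sign of `x_j²` in the normal form. -/
def morinSign (n l j : ℕ) : ℝ := if j ≤ n + l - 1 then 1 else -1

theorem morinSign_ne_zero (n l j : ℕ) : morinSign n l j ≠ 0 := by
  unfold morinSign
  split_ifs <;> norm_num

theorem morinForm_eq {n k l : ℕ} (hl : 1 ≤ l) (hlm : n + l ≤ m + 1) (x : Euc m) :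
    morinForm n k l x = (morinPoly k x).eval (crd x n) +
      ∑ j ∈ Finset.Icc (n + 1) m, morinSign n l j * crd x j ^ 2 := by
  have h1 : Finset.Icc (n + 1) m = Finset.Icc (n + 1) (n + l - 1) ∪ Finset.Icc (n + l) m := by
    ext j
    simp only [Finset.mem_union, Finset.mem_Icc]
    omega
  have h2 : Disjoint (Finset.Icc (n + 1) (n + l - 1)) (Finset.Icc (n + l) m) := by
    rw [Finset.disjoint_left]
    intro j
    simp only [Finset.mem_Icc]
    omega
  have h3 : ∑ j ∈ Finset.Icc (n + 1) (n + l - 1), morinSign n l j * crd x j ^ 2 =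
      ∑ j ∈ Finset.Icc (n + 1) (n + l - 1), crd x j ^ 2 := by
    refine Finset.sum_congr rfl fun j hj => ?_
    rw [Finset.mem_Icc] at hj
    rw [morinSign, if_pos hj.2, one_mul]
  have h4 : ∑ j ∈ Finset.Icc (n + l) m, morinSign n l j * crd x j ^ 2 =
      - ∑ j ∈ Finset.Icc (n + l) m, crd x j ^ 2 := by
    rw [← Finset.sum_neg_distrib]
    refine Finset.sum_congr rfl fun j hj => ?_
    rw [Finset.mem_Icc] at hj
    rw [morinSign, if_neg (by omega), neg_one_mul]
  rw [h1, Finset.sum_union h2, h3, h4, morinForm, morinPoly]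
  simp only [eval_add, eval_pow, eval_X, eval_finsetSum, eval_mul, eval_C]
  ring

/-- The derivative of the last component of the normal form. -/
def morinFormDeriv (n k l : ℕ) (x : Euc m) : Euc m →L[ℝ] ℝ :=
  (derivative (morinPoly k x)).eval (crd x n) • crdL m n
    + ∑ i ∈ Finset.Icc 1 (k - 1), crd x n ^ (k - i) • crdL m i
    + ∑ j ∈ Finset.Icc (n + 1) m, (2 * morinSign n l j * crd x j) • crdL m j

theorem hasFDerivAt_morinForm {n k l : ℕ} (hl : 1 ≤ l) (hlm : n + l ≤ m + 1) (x : Euc m) :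
    HasFDerivAt (morinForm n k l : Euc m → ℝ) (morinFormDeriv n k l x) x := by
  have e : (morinForm n k l : Euc m → ℝ) = fun x : Euc m => crd x n ^ (k + 1) +
      ∑ i ∈ Finset.Icc 1 (k - 1), crd x i * crd x n ^ (k - i) +
      ∑ j ∈ Finset.Icc (n + 1) m, morinSign n l j * crd x j ^ 2 := by
    ext y
    rw [morinForm_eq hl hlm, morinPoly]
    simp only [eval_add, eval_pow, eval_X, eval_finsetSum, eval_mul, eval_C]
  rw [e]
  have d1 := (hasFDerivAt_crd n x).pow (k + 1)
  have d2 := HasFDerivAt.fun_sum (u := Finset.Icc 1 (k - 1)) fun i _ =>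
    (hasFDerivAt_crd i x).mul ((hasFDerivAt_crd n x).pow (k - i))
  have d3 := HasFDerivAt.fun_sum (u := Finset.Icc (n + 1) m) fun j _ =>
    ((hasFDerivAt_crd j x).pow 2).const_mul (morinSign n l j)
  refine ((d1.add d2).add d3).congr_fderiv ?_
  ext v
  rw [morinFormDeriv, eval_derivative_morinPoly]
  simp only [add_apply, sum_apply, smul_apply, smul_eq_mul, Finset.sum_add_distrib, add_mul,
    Finset.sum_mul]
  simp [mul_assoc]
  ring_nf

end NormalForm

end

section

open Asymptotics Polynomial

/-! ### Contact orders in the Morin normal form. -/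

section NormalMap

/-- The range of the parameters of the Morin normal forms. -/
structure Admissible (m n k l : ℕ) : Prop where
  one_le_k : 1 ≤ k
  k_le : k ≤ n
  one_le_l : 1 ≤ l
  l_le : n + l ≤ m + 1

variable {m n k l : ℕ}

/-- The Morin normal form as a map `ℝ^m → ℝ^n`. -/
def morinMap (n k l : ℕ) (x : Euc m) : Euc n :=
  ofCrd n fun i => if i = n then morinForm n k l x else crd x i

theorem crd_morinMap_of_lt {i : ℕ} (h1 : 1 ≤ i) (h2 : i < n) (x : Euc m) :
    crd (morinMap n k l x) i = crd x i := by
  rw [morinMap, crd_ofCrd _ h1 h2.le, if_neg h2.ne]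

theorem crd_morinMap_last (h : 1 ≤ n) (x : Euc m) :
    crd (morinMap n k l x) n = morinForm n k l x := by
  rw [morinMap, crd_ofCrd _ h le_rfl, if_pos rfl]

theorem contDiff_morinForm : ContDiff ℝ ∞ (morinForm n k l : Euc m → ℝ) := by
  unfold morinForm
  refine ContDiff.sub (ContDiff.add (ContDiff.add ((contDiff_crd n).pow _) ?_) ?_) ?_
  · exact ContDiff.sum fun i _ => (contDiff_crd i).mul ((contDiff_crd n).pow _)
  · exact ContDiff.sum fun i _ => (contDiff_crd i).pow _
  · exact ContDiff.sum fun i _ => (contDiff_crd i).pow _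

theorem contDiff_morinMap (hn : 1 ≤ n) : ContDiff ℝ ∞ (morinMap n k l : Euc m → Euc n) := by
  rw [contDiff_iff_contDiffAt]
  intro x
  refine contDiffAt_euc fun i h1 h2 => ?_
  rcases h2.lt_or_eq with h | rfl
  · simp only [crd_morinMap_of_lt h1 h]
    exact (contDiff_crd i).contDiffAt
  · simp only [crd_morinMap_last hn]
    exact contDiff_morinForm.contDiffAt

theorem crd_fderiv {d : ℕ} {E : Type*} [NormedAddCommGroup E] [NormedSpace ℝ E] {F : E → Euc d}
    {x : E} (hF : DifferentiableAt ℝ F x) (v : E) (i : ℕ) :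
    crd (fderiv ℝ F x v) i = fderiv ℝ (fun y => crd (F y) i) x v := by
  have := ((hasFDerivAt_crd i (F x)).comp x hF.hasFDerivAt).fderiv
  simp only [Function.comp_def] at this
  rw [this, ContinuousLinearMap.comp_apply, crdL_apply]

theorem crd_fderiv_morinMap_of_lt (hn : 1 ≤ n) {i : ℕ} (h1 : 1 ≤ i) (h2 : i < n) (x v : Euc m) :
    crd (fderiv ℝ (morinMap n k l : Euc m → Euc n) x v) i = crd v i := by
  rw [crd_fderiv ((contDiff_morinMap hn).contDiffAt.differentiableAt (by simp))]
  simp only [crd_morinMap_of_lt h1 h2]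
  rw [(hasFDerivAt_crd i x).fderiv, crdL_apply]

theorem crd_fderiv_morinMap_last (h : Admissible m n k l) (x v : Euc m) :
    crd (fderiv ℝ (morinMap n k l : Euc m → Euc n) x v) n = morinFormDeriv n k l x v := by
  have hn : 1 ≤ n := h.one_le_k.trans h.k_le
  rw [crd_fderiv ((contDiff_morinMap hn).contDiffAt.differentiableAt (by simp))]
  simp only [crd_morinMap_last hn]
  rw [(hasFDerivAt_morinForm h.one_le_l h.l_le x).fderiv]

theorem morinFormDeriv_apply (x v : Euc m) : morinFormDeriv n k l x v =
    (derivative (morinPoly k x)).eval (crd x n) * crd v n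
    + ∑ i ∈ Finset.Icc 1 (k - 1), crd x n ^ (k - i) * crd v i
    + ∑ j ∈ Finset.Icc (n + 1) m, 2 * morinSign n l j * crd x j * crd v j := by
  simp [morinFormDeriv, crdL_apply]

theorem morinFormDeriv_bvec (h : Admissible m n k l) (x : Euc m) :
    morinFormDeriv n k l x (bvec m n) = (derivative (morinPoly k x)).eval (crd x n) := by
  obtain ⟨h1, h2, h3, h4⟩ := h
  rw [morinFormDeriv_apply, crd_bvec (by omega) (by omega), if_pos rfl, Finset.sum_eq_zero,
    Finset.sum_eq_zero]
  · ring
  · intro j hj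
    rw [Finset.mem_Icc] at hj
    rw [crd_bvec (by omega) (by omega), if_neg (by omega), mul_zero]
  · intro j hj
    rw [Finset.mem_Icc] at hj
    rw [crd_bvec (by omega) (by omega), if_neg (by omega), mul_zero]

theorem morinFormDeriv_bvec_of_gt (h : Admissible m n k l) (x : Euc m) {j : ℕ} (hj : n < j)
    (hj' : j ≤ m) :
    morinFormDeriv n k l x (bvec m j) = 2 * morinSign n l j * crd x j := by
  obtain ⟨h1, h2, h3, h4⟩ := h
  rw [morinFormDeriv_apply, crd_bvec (by omega) (by omega), if_neg (by omega), Finset.sum_eq_zero,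
    Finset.sum_eq_single j]
  · rw [crd_bvec (by omega) (by omega), if_pos rfl]
    ring
  · intro i hi hne
    rw [Finset.mem_Icc] at hi
    rw [crd_bvec (by omega) (by omega), if_neg (by omega), mul_zero]
  · intro hne
    exact absurd (Finset.mem_Icc.2 ⟨hj, hj'⟩) hne
  · intro i hi
    rw [Finset.mem_Icc] at hi
    rw [crd_bvec (by omega) (by omega), if_neg (by omega), mul_zero]

theorem fderiv_morinMap_apply (h : Admissible m n k l) (x v : Euc m)
    (hv : ∀ i, 1 ≤ i → i < n → crd v i = 0) :
    fderiv ℝ (morinMap n k l : Euc m → Euc n) x v = morinFormDeriv n k l x v • bvec n n := by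
  have hn : 1 ≤ n := h.one_le_k.trans h.k_le
  refine euc_ext fun i h1 h2 => ?_
  rw [crd_smul, crd_bvec h1 h2]
  rcases h2.lt_or_eq with h3 | rfl
  · rw [crd_fderiv_morinMap_of_lt hn h1 h3, hv i h1 h3, if_neg h3.ne, mul_zero]
  · rw [crd_fderiv_morinMap_last h, if_pos rfl, mul_one]

theorem sum_crd_bvec {d : ℕ} (y : Euc d) : y = ∑ i ∈ Finset.Icc 1 d, crd y i • bvec d i := by
  refine euc_ext fun j h1 h2 => ?_
  rw [← crdL_apply, ← crdL_apply, map_sum, Finset.sum_eq_single j]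
  · rw [map_smul, crdL_apply, crdL_apply, crd_bvec h1 h2, if_pos rfl, smul_eq_mul, mul_one]
  · intro i _ hi
    rw [map_smul, crdL_apply, crd_bvec h1 h2, if_neg hi.symm, smul_zero]
  · intro hj
    exact absurd (Finset.mem_Icc.2 ⟨h1, h2⟩) hj

theorem clm_ext_bvec {d : ℕ} {L L' : Euc d →L[ℝ] ℝ}
    (h : ∀ i, 1 ≤ i → i ≤ d → L (bvec d i) = L' (bvec d i)) : L = L' := by
  ext y
  rw [sum_crd_bvec y, map_sum, map_sum]
  refine Finset.sum_congr rfl fun i hi => ?_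
  rw [Finset.mem_Icc] at hi
  rw [map_smul, map_smul, h i hi.1 hi.2]

/-- For i < n the image of the derivative contains e_i plus a multiple of e_n. A covector that kills
the image and e_n therefore kills every e_i. -/
theorem apply_bvec_last_ne_zero (h : Admissible m n k l) {x : Euc m} {L : Euc n →L[ℝ] ℝ}
    (hL : L.comp (fderiv ℝ (morinMap n k l : Euc m → Euc n) x) = 0) (hne : L ≠ 0) :
    L (bvec n n) ≠ 0 := by
  intro h0
  have hn : 1 ≤ n := h.one_le_k.trans h.k_le
  have hnm : n ≤ m := by have := h.l_le; have := h.one_le_l; omega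
  apply hne
  refine clm_ext_bvec fun i h1 h2 => ?_
  rcases h2.lt_or_eq with h3 | rfl
  · have e : fderiv ℝ (morinMap n k l : Euc m → Euc n) x (bvec m i) =
        bvec n i + morinFormDeriv n k l x (bvec m i) • bvec n n := by
      refine euc_ext fun j hj1 hj2 => ?_
      rw [crd_add, crd_smul, crd_bvec hj1 hj2, crd_bvec hj1 hj2]
      rcases hj2.lt_or_eq with hj3 | rfl
      · rw [crd_fderiv_morinMap_of_lt hn hj1 hj3, crd_bvec hj1 (by omega), if_neg hj3.ne]
        ring
      · rw [crd_fderiv_morinMap_last h, if_neg h3.ne', if_pos rfl]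
        ring
    have h4 := congrArg (fun A : Euc m →L[ℝ] ℝ => A (bvec m i)) hL
    simpa [e, h0] using h4
  · rw [h0]
    rfl

variable {x : Euc m} {γ : ℝ → Euc m} {η : ℝ → Euc n →L[ℝ] ℝ} {N : ℕ}

theorem IsContact.isBigO_crd_sub (hc : IsContact (morinMap n k l) x γ η N) {i : ℕ} (h1 : 1 ≤ i)
    (h2 : i < n) : (fun s => crd (γ s) i - crd x i) =O[𝓝 0] fun s : ℝ => s ^ N := by
  have h3 := ((crdL n i).isBigO_comp (fun s => morinMap n k l (γ s) - morinMap n k l x)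
    (𝓝 0)).trans hc.contact
  simpa only [crdL_apply, crd_sub, crd_morinMap_of_lt h1 h2] using h3

/-- A direction without components x_1, …, x_(n-1) is mapped to a multiple of e_n. As η(e_n) stays
away from 0, it can be divided out of the conormal condition. -/
theorem IsContact.isBigO_form (hA : Admissible m n k l) (hN : N ≠ 0)
    (hc : IsContact (morinMap n k l) x γ η N) {v : Euc m}
    (hv : ∀ i, 1 ≤ i → i < n → crd v i = 0) :
    (fun s => morinFormDeriv n k l (γ s) v) =O[𝓝 0] fun s : ℝ => s ^ N := by
  -- The bound by s^N with N ≠ 0 holds at s = 0 itself, where it says that the value is 0.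
  have h0 : (η 0).comp (fderiv ℝ (morinMap n k l) x) = 0 := by
    obtain ⟨c, hb⟩ := hc.conormal.bound
    have := hb.self_of_nhds
    simp only [hc.map_zero, norm_zero, zero_pow hN, mul_zero] at this
    exact norm_le_zero_iff.1 this
  have hne := apply_bvec_last_ne_zero hA h0 hc.ne
  have h1 : (fun s => η s (fderiv ℝ (morinMap n k l) (γ s) v)) =O[𝓝 0] fun s : ℝ => s ^ N := by
    refine IsBigO.trans (IsBigO.of_bound ‖v‖ (Filter.Eventually.of_forall fun s => ?_)) hc.conormal
    rw [mul_comm]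
    exact ((η s).comp (fderiv ℝ (morinMap n k l) (γ s))).le_opNorm v
  have hcont : ContinuousAt (fun s => η s (bvec n n)) 0 := hc.cont.clm_apply continuousAt_const
  have h2 : (fun s => (η s (bvec n n))⁻¹) =O[𝓝 0] fun _ => (1 : ℝ) :=
    (hcont.inv₀ hne).tendsto.isBigO_one ℝ
  refine (h1.mul h2).congr' ?_ (by simp)
  filter_upwards [hcont.eventually_ne hne] with s hs
  rw [fderiv_morinMap_apply hA _ _ hv, map_smul, smul_eq_mul]
  field_simp

theorem IsContact.isBigO_crd (hA : Admissible m n k l) (hN : N ≠ 0)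
    (hc : IsContact (morinMap n k l) x γ η N) {j : ℕ} (h1 : n < j) (h2 : j ≤ m) :
    (fun s => crd (γ s) j) =O[𝓝 0] fun s : ℝ => s ^ N := by
  have h3 := hc.isBigO_form hA hN (v := bvec m j) fun i hi1 hi2 => by
    rw [crd_bvec hi1 (by omega), if_neg (by omega)]
  simp only [morinFormDeriv_bvec_of_gt hA _ h1 h2] at h3
  exact (isBigO_const_mul_left_iff (mul_ne_zero two_ne_zero (morinSign_ne_zero n l j))).1 h3

theorem IsContact.crd_eq_zero (hA : Admissible m n k l) (hN : N ≠ 0)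
    (hc : IsContact (morinMap n k l) x γ η N) {j : ℕ} (h1 : n < j) (h2 : j ≤ m) :
    crd x j = 0 := by
  obtain ⟨c, hb⟩ := (hc.isBigO_crd hA hN h1 h2).bound
  have := hb.self_of_nhds
  simp only [hc.map_zero, norm_zero, zero_pow hN, mul_zero] at this
  exact norm_le_zero_iff.1 this

theorem IsContact.hasDerivAt_crd (hc : IsContact (morinMap n k l) x γ η N) :
    ∃ v : Euc m, v ≠ 0 ∧ ∀ i, HasDerivAt (fun s => crd (γ s) i) (crd v i) 0 := by
  obtain ⟨v, hv, hd⟩ := hc.deriv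
  refine ⟨v, hv, fun i => ?_⟩
  have := (hasFDerivAt_crd i (γ 0)).comp_hasDerivAt 0 hd
  rwa [crdL_apply] at this

theorem hasDerivAt_zero_of_isBigO {φ : ℝ → ℝ} {c : ℝ} (hN : 2 ≤ N)
    (h : (fun s => φ s - c) =O[𝓝 0] fun s : ℝ => s ^ N) : HasDerivAt φ 0 0 := by
  have h0 : φ 0 = c := by
    obtain ⟨C, hb⟩ := h.bound
    have := hb.self_of_nhds
    simp only [norm_zero, zero_pow (show N ≠ 0 by omega), mul_zero] at this
    linarith [norm_le_zero_iff.1 this]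
  rw [hasDerivAt_iff_isLittleO_nhds_zero]
  simp only [zero_add, smul_zero, sub_zero, h0]
  have h1 : (fun s : ℝ => s ^ N) =o[𝓝 0] fun s : ℝ => s ^ 1 := isLittleO_pow_pow (by omega)
  simpa using h.trans_isLittleO h1

/-- Along a curve with contact of order at least `2`, the coordinate `x_n` is a parameter. -/
theorem IsContact.exists_hasDerivAt_last (hA : Admissible m n k l) (hN : 2 ≤ N)
    (hc : IsContact (morinMap n k l) x γ η N) :
    ∃ u, u ≠ 0 ∧ HasDerivAt (fun s => crd (γ s) n) u 0 := by
  obtain ⟨v, hv, hd⟩ := hc.hasDerivAt_crd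
  refine ⟨crd v n, fun h0 => hv (euc_ext fun i h1 h2 => ?_), hd n⟩
  rw [crd_zero]
  rcases lt_trichotomy i n with h3 | rfl | h3
  · exact (hd i).unique (hasDerivAt_zero_of_isBigO hN (hc.isBigO_crd_sub h1 h3))
  · exact h0
  · refine (hd i).unique (hasDerivAt_zero_of_isBigO (c := 0) hN ?_)
    simpa using hc.isBigO_crd hA (by omega) h3 h2

/-- The derivative of the unfolding at γ(s), evaluated at x_n(s), is O(s^N). Its variable
coefficients involve only x_i with i < n, which move by O(s^N), so the polynomial may be frozen at
x; x_n(s) then serves as the parameter of the curve. -/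
theorem IsContact.dvd (hA : Admissible m n k l) (hN : N ≠ 0)
    (hc : IsContact (morinMap n k l) x γ η N) :
    (X - C (crd x n)) ^ N ∣ derivative (morinPoly k x) := by
  have hcont : ∀ i, ContinuousAt (fun s => crd (γ s) i) 0 := fun i => by
    obtain ⟨v, hv, hd⟩ := hc.hasDerivAt_crd
    exact (hd i).continuousAt
  have hnm : n ≤ m := by have := hA.l_le; have := hA.one_le_l; omega
  have h1 := hc.isBigO_form hA hN (v := bvec m n) fun i hi1 hi2 => by
    rw [crd_bvec hi1 (by omega), if_neg (by omega)]
  simp only [morinFormDeriv_bvec hA] at h1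
  have h2 : (fun s => (derivative (morinPoly k (γ s))).eval (crd (γ s) n) -
      (derivative (morinPoly k x)).eval (crd (γ s) n)) =O[𝓝 0] fun s : ℝ => s ^ N := by
    have h3 : ∀ s, (derivative (morinPoly k (γ s))).eval (crd (γ s) n) -
        (derivative (morinPoly k x)).eval (crd (γ s) n) = ∑ i ∈ Finset.Icc 1 (k - 1),
        (crd (γ s) i - crd x i) * (((k - i : ℕ) : ℝ) * crd (γ s) n ^ (k - i - 1)) := by
      intro s
      rw [eval_derivative_morinPoly, eval_derivative_morinPoly, add_sub_add_left_eq_sub,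
        ← Finset.sum_sub_distrib]
      exact Finset.sum_congr rfl fun i _ => by ring
    simp only [h3]
    refine IsBigO.fun_sum fun i hi => ?_
    rw [Finset.mem_Icc] at hi
    have h4 : (fun s => ((k - i : ℕ) : ℝ) * crd (γ s) n ^ (k - i - 1)) =O[𝓝 0]
        fun _ => (1 : ℝ) :=
      (continuousAt_const.mul ((hcont n).pow _)).tendsto.isBigO_one ℝ
    have := (hc.isBigO_crd_sub (i := i) hi.1 (by have := hA.k_le; omega)).mul h4
    simpa using this
  have h5 : (fun s => (derivative (morinPoly k x)).eval (crd (γ s) n)) =O[𝓝 0]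
      fun s : ℝ => s ^ N := by
    refine (h1.sub h2).congr_left fun s => ?_
    ring
  have h6 : crd (γ 0) n = crd x n := by rw [hc.map_zero]
  -- For N = 1 the coordinate x_n need not be a parameter of the curve, but a simple root is already
  -- visible at s = 0.
  rcases Nat.lt_or_ge N 2 with h7 | h7
  · obtain rfl : N = 1 := by omega
    rw [pow_one, dvd_iff_isRoot]
    obtain ⟨C, hb⟩ := h5.bound
    have := hb.self_of_nhds
    simp only [h6, norm_zero, zero_pow hN, mul_zero] at this
    exact norm_le_zero_iff.1 this
  · obtain ⟨u, hu, hd⟩ := hc.exists_hasDerivAt_last hA h7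
    have := X_sub_C_pow_dvd_of_isBigO (derivative_morinPoly_ne_zero x) hd hu h5
    rwa [h6] at this

theorem isBigO_eval_of_dvd {R : ℝ[X]} {t : ℝ} (h : (X - C t) ^ N ∣ R) :
    (fun s => R.eval (t + s)) =O[𝓝 0] fun s : ℝ => s ^ N := by
  obtain ⟨Q, rfl⟩ := h
  have h1 : (fun s => Q.eval (t + s)) =O[𝓝 0] fun _ => (1 : ℝ) := by
    have : Continuous fun s => Q.eval (t + s) := Q.continuous.comp (by fun_prop)
    exact this.continuousAt.tendsto.isBigO_one ℝ
  have h2 := (isBigO_refl (fun s : ℝ => s ^ N) (𝓝 0)).mul h1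
  simpa using h2

/-- In characteristic zero, the multiplicity of a root exceeds its multiplicity in the derivative by
one. -/
theorem X_sub_C_pow_succ_dvd_sub {P : ℝ[X]} {t : ℝ} (hP : derivative P ≠ 0)
    (h : (X - C t) ^ N ∣ derivative P) : (X - C t) ^ (N + 1) ∣ P - C (P.eval t) := by
  set Q := P - C (P.eval t) with hQ
  have hd : derivative Q = derivative P := by simp [hQ]
  have hroot : Q.IsRoot t := by simp [hQ]
  have hQ0 : Q ≠ 0 := by
    intro h0
    rw [← hd, h0, derivative_zero] at hP
    exact hP rfl
  have h1 := derivative_rootMultiplicity_of_root hroot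
  rw [← hd] at h hP
  have h2 := (le_rootMultiplicity_iff hP).2 h
  have h3 := (rootMultiplicity_pos hQ0).2 hroot
  exact (le_rootMultiplicity_iff hQ0).1 (by omega)

theorem morinPoly_add_smul (x : Euc m) (hA : Admissible m n k l) (s : ℝ) :
    morinPoly k (x + s • bvec m n) = morinPoly k x := by
  unfold morinPoly
  congr 1
  refine Finset.sum_congr rfl fun i hi => ?_
  rw [Finset.mem_Icc] at hi
  obtain ⟨h1, h2, h3, h4⟩ := hA
  rw [crd_add, crd_smul, crd_bvec (by omega) (by omega), if_neg (by omega)]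
  simp

theorem crd_add_smul_bvec (x : Euc m) (s : ℝ) {i j : ℕ} (h1 : 1 ≤ j) (h2 : j ≤ m) :
    crd (x + s • bvec m i) j = crd x j + if j = i then s else 0 := by
  rw [crd_add, crd_smul, crd_bvec h1 h2]
  split_ifs <;> simp

/-- The values of the normal form along the `x_n`-axis. -/
theorem morinMap_add_smul (hA : Admissible m n k l) (x : Euc m) (s : ℝ) :
    morinMap n k l (x + s • bvec m n) - morinMap n k l x =
      ((morinPoly k x).eval (crd x n + s) - (morinPoly k x).eval (crd x n)) • bvec n n := by
  have hn : 1 ≤ n := hA.one_le_k.trans hA.k_le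
  have hnm : n ≤ m := by have := hA.l_le; have := hA.one_le_l; omega
  refine euc_ext fun i h1 h2 => ?_
  rw [crd_smul, crd_sub, crd_bvec h1 h2]
  rcases h2.lt_or_eq with h3 | rfl
  · rw [crd_morinMap_of_lt h1 h3, crd_morinMap_of_lt h1 h3, crd_add_smul_bvec _ _ h1 (by omega),
      if_neg h3.ne, if_neg h3.ne]
    simp
  · rw [crd_morinMap_last hn, crd_morinMap_last hn, morinForm_eq hA.one_le_l hA.l_le,
      morinForm_eq hA.one_le_l hA.l_le, morinPoly_add_smul x hA, crd_add_smul_bvec _ _ h1 hnm,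
      if_pos rfl]
    have : ∀ j ∈ Finset.Icc (i + 1) m, morinSign i l j * crd (x + s • bvec m i) j ^ 2 =
        morinSign i l j * crd x j ^ 2 := by
      intro j hj
      rw [Finset.mem_Icc] at hj
      rw [crd_add_smul_bvec _ _ (by omega) (by omega), if_neg (by omega), add_zero]
    rw [Finset.sum_congr rfl this]
    simp

/-- The covectors that annihilate the image of the derivative along the singular set. -/
def conormal (n k l : ℕ) (x : Euc m) : Euc n →L[ℝ] ℝ :=
  crdL n n - ∑ i ∈ Finset.Icc 1 (n - 1), morinFormDeriv n k l x (bvec m i) • crdL n i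

/-- The line in the x_n-direction is a witness: along it the unfolding polynomial is constant, the
map moves by P(x_n + s) - P(x_n) in the last component, and `conormal` composed with the derivative
is P'(x_n + s) dx_n. -/
theorem isContact_axis (hA : Admissible m n k l) {x : Euc m}
    (hz : ∀ j, n < j → j ≤ m → crd x j = 0)
    (hd : (X - C (crd x n)) ^ N ∣ derivative (morinPoly k x)) :
    IsContact (morinMap n k l) x (fun s => x + s • bvec m n)
      (fun s => conormal n k l (x + s • bvec m n)) N := by
  have hn : 1 ≤ n := hA.one_le_k.trans hA.k_le
  have hnm : n ≤ m := by have := hA.l_le; have := hA.one_le_l; omega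
  have hzs : ∀ s : ℝ, ∀ j, n < j → j ≤ m → crd (x + s • bvec m n) j = 0 := by
    intro s j h1 h2
    rw [crd_add_smul_bvec _ _ (by omega) h2, if_neg (by omega), hz j h1 h2, add_zero]
  have hbig := isBigO_eval_of_dvd hd
  refine ⟨by simp, ⟨bvec m n, ?_, ?_⟩, ?_, ?_, ?_, ?_⟩
  · intro h0
    have := crd_bvec (i := n) hn hnm
    rw [h0, crd_zero, if_pos rfl] at this
    exact zero_ne_one this
  · simpa using ((hasDerivAt_id (0 : ℝ)).smul_const (bvec m n)).const_add x
  · unfold conormal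
    refine continuousAt_const.sub (tendsto_finsetSum _ fun i _ => ?_)
    refine Filter.Tendsto.smul_const ?_ _
    change ContinuousAt (fun s : ℝ => morinFormDeriv n k l (x + s • bvec m n) (bvec m i)) 0
    simp only [morinFormDeriv_apply, morinPoly_add_smul x hA]
    have hcr : ∀ j, Continuous fun s : ℝ => crd (x + s • bvec m n) j := fun j =>
      (continuous_crd j).comp (by fun_prop)
    refine Continuous.continuousAt ?_
    refine Continuous.add (Continuous.add ?_ ?_) ?_
    · exact ((Polynomial.continuous _).comp (hcr n)).mul continuous_const
    · exact continuous_finsetSum _ fun j _ => ((hcr n).pow _).mul continuous_const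
    · exact continuous_finsetSum _ fun j _ => (continuous_const.mul (hcr j)).mul continuous_const
  · intro h0
    have h1 := congrArg (fun L : Euc n →L[ℝ] ℝ => L (bvec n n)) h0
    simp only [conormal, _root_.sub_apply, sum_apply, smul_apply, crdL_apply] at h1
    rw [crd_bvec hn le_rfl, if_pos rfl, Finset.sum_eq_zero] at h1
    · simp at h1
    · intro i hi
      rw [Finset.mem_Icc] at hi
      rw [crd_bvec (by omega) (by omega), if_neg (by omega), smul_zero]
  · simp only [morinMap_add_smul hA]
    have h1 := X_sub_C_pow_succ_dvd_sub (derivative_morinPoly_ne_zero x) hd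
    have h2 := isBigO_eval_of_dvd ((pow_dvd_pow _ N.le_succ).trans h1)
    simp only [eval_sub, eval_C] at h2
    have h3 := h2.smul (isBigO_refl (fun _ : ℝ => bvec n n) (𝓝 0))
    refine h3.trans (IsBigO.of_bound ‖bvec n n‖ (Filter.Eventually.of_forall fun s => ?_))
    rw [norm_smul, mul_comm]
  · have h1 : ∀ s : ℝ, (conormal n k l (x + s • bvec m n)).comp
        (fderiv ℝ (morinMap n k l) (x + s • bvec m n)) =
        (derivative (morinPoly k x)).eval (crd x n + s) • crdL m n := by
      intro s
      refine clm_ext_bvec fun j h1 h2 => ?_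
      have h3 : ∀ i ∈ Finset.Icc 1 (n - 1), morinFormDeriv n k l (x + s • bvec m n) (bvec m i) *
          crd (fderiv ℝ (morinMap n k l : Euc m → Euc n) (x + s • bvec m n) (bvec m j)) i =
          if i = j then morinFormDeriv n k l (x + s • bvec m n) (bvec m j) else 0 := by
        intro i hi
        rw [Finset.mem_Icc] at hi
        rw [crd_fderiv_morinMap_of_lt hn hi.1 (by omega), crd_bvec hi.1 (by omega)]
        split_ifs with h <;> simp [h]
      simp only [conormal, ContinuousLinearMap.comp_apply, _root_.sub_apply, sum_apply, smul_apply,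
        crdL_apply, smul_eq_mul]
      rw [Finset.sum_congr rfl h3, crd_fderiv_morinMap_last hA, Finset.sum_ite_eq', crd_bvec hn hnm]
      rcases lt_trichotomy j n with h4 | rfl | h4
      · rw [if_pos (Finset.mem_Icc.2 ⟨h1, by omega⟩), if_neg h4.ne']
        ring
      · rw [if_neg (by rw [Finset.mem_Icc]; omega), if_pos rfl, morinFormDeriv_bvec hA,
          morinPoly_add_smul x hA, crd_add_smul_bvec _ _ hn hnm, if_pos rfl]
        ring
      · rw [if_neg (by rw [Finset.mem_Icc]; omega), if_neg h4.ne,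
          morinFormDeriv_bvec_of_gt hA _ h4 h2, hzs s j h4 h2]
        ring
    simp only [h1]
    refine (hbig.smul (isBigO_refl (fun _ : ℝ => crdL m n) (𝓝 0))).trans
      (IsBigO.of_bound ‖crdL m n‖ (Filter.Eventually.of_forall fun s => ?_))
    rw [norm_smul, mul_comm]

/-- The points of a Morin normal form at which curves of contact `N` exist. -/
theorem exists_isContact_iff (hA : Admissible m n k l) (hN : N ≠ 0) (x : Euc m) :
    (∃ γ η, IsContact (morinMap n k l) x γ η N) ↔
      (∀ j, n < j → j ≤ m → crd x j = 0) ∧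
        (X - C (crd x n)) ^ N ∣ derivative (morinPoly k x) :=
  ⟨fun ⟨_, _, hc⟩ => ⟨fun _ h1 h2 => hc.crd_eq_zero hA hN h1 h2, hc.dvd hA hN⟩,
    fun ⟨hz, hd⟩ => ⟨_, _, isContact_axis hA hz hd⟩⟩

end NormalMap

end

section

open Asymptotics Polynomial

/-! ### The closure of A_k inside the unfolding of A_(k+1). -/

section Locus

variable {m : ℕ}

/-- The derivative of `(T - t)^(k+1) (T + (k+1) t)`. -/
def locusPoly (k : ℕ) (t : ℝ) : ℝ[X] := C (k + 2 : ℝ) * ((X - C t) ^ k * (X + C (k * t)))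

/-- The value of `x_i` on the closure of the stratum `A_k` in the normal form of `A_(k+1)`, as a
function of `t = x_n`. -/
def shear (k i : ℕ) (t : ℝ) : ℝ := (locusPoly k t).coeff (k - i) / ((k + 1 - i : ℕ) : ℝ)

theorem coeff_locusPoly_succ (k j : ℕ) (t : ℝ) : (locusPoly k t).coeff (j + 1) =
    (k + 2) * ((-t) ^ (k - j) * (k.choose j) + (-t) ^ (k - (j + 1)) * k.choose (j + 1) * (k * t)) := by
  rw [locusPoly, coeff_C_mul, mul_add, coeff_add, coeff_mul_X, coeff_mul_C, sub_eq_add_neg,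
    ← C_neg, coeff_X_add_C_pow, coeff_X_add_C_pow]

theorem coeff_locusPoly_zero (k : ℕ) (t : ℝ) : (locusPoly k t).coeff 0 =
    (k + 2) * ((-t) ^ k * (k * t)) := by
  rw [locusPoly, coeff_C_mul, mul_add, coeff_add, coeff_mul_X_zero, coeff_mul_C, sub_eq_add_neg,
    ← C_neg, coeff_X_add_C_pow]
  simp

theorem contDiff_shear (k i : ℕ) : ContDiff ℝ ∞ (shear k i) := by
  unfold shear
  refine ContDiff.div_const ?_ _
  rcases k - i with _ | j
  · simp only [coeff_locusPoly_zero]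
    fun_prop
  · simp only [coeff_locusPoly_succ]
    fun_prop

theorem shear_zero {k i : ℕ} (hi : 1 ≤ i) (hik : i ≤ k) : shear k i 0 = 0 := by
  have h1 : (locusPoly k 0).coeff (k - i) = 0 := by
    rcases h : k - i with _ | j
    · rw [coeff_locusPoly_zero]
      simp
    · rw [coeff_locusPoly_succ, neg_zero, zero_pow (by omega)]
      simp
  rw [shear, h1, zero_div]

theorem coeff_locusPoly_top (k : ℕ) (t : ℝ) : (locusPoly k t).coeff (k + 1) = k + 2 := by
  rw [coeff_locusPoly_succ]
  simp

/-- The roots, k times t and once -kt, have sum zero. This matches the missing term of degree k+1 in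
the unfolding. -/
theorem coeff_locusPoly_self {k : ℕ} (hk : 1 ≤ k) (t : ℝ) : (locusPoly k t).coeff k = 0 := by
  obtain ⟨j, rfl⟩ := Nat.exists_eq_add_of_le' hk
  rw [coeff_locusPoly_succ, show j + 1 - j = 1 by omega, Nat.choose_symm_add, Nat.choose_self]
  simp
  right
  ring

theorem coeff_locusPoly_of_gt {k j : ℕ} (hj : k + 1 < j) (t : ℝ) :
    (locusPoly k t).coeff j = 0 := by
  obtain ⟨i, rfl⟩ := Nat.exists_eq_add_of_le' (show 1 ≤ j by omega)
  rw [coeff_locusPoly_succ, Nat.choose_eq_zero_of_lt (by omega), Nat.choose_eq_zero_of_lt (by omega)]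
  simp

theorem coeff_morinPoly_sub {k i : ℕ} (hi : 1 ≤ i) (hik : i ≤ k) (x : Euc m) :
    (morinPoly (k + 1) x).coeff (k + 1 - i) = crd x i := by
  rw [morinPoly, coeff_add, coeff_X_pow, if_neg (by omega), finsetSum_coeff,
    Finset.sum_eq_single i]
  · simp
  · intro j hj hne
    rw [Finset.mem_Icc] at hj
    rw [coeff_C_mul, coeff_X_pow, if_neg (by omega), mul_zero]
  · intro h
    exact absurd (Finset.mem_Icc.2 ⟨hi, by omega⟩) h

theorem coeff_morinPoly_of_gt {k j : ℕ} (hj : k < j) (x : Euc m) :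
    (morinPoly k x).coeff j = if j = k + 1 then 1 else 0 := by
  rw [morinPoly, coeff_add, coeff_X_pow, finsetSum_coeff, Finset.sum_eq_zero, add_zero]
  intro i hi
  rw [Finset.mem_Icc] at hi
  rw [coeff_C_mul, coeff_X_pow, if_neg (by omega), mul_zero]

theorem coeff_morinPoly_self {k : ℕ} (x : Euc m) : (morinPoly k x).coeff k = 0 := by
  rw [morinPoly, coeff_add, coeff_X_pow, if_neg (by omega), finsetSum_coeff, Finset.sum_eq_zero,
    add_zero]
  intro i hi
  rw [Finset.mem_Icc] at hi
  rw [coeff_C_mul, coeff_X_pow, if_neg (by omega), mul_zero]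

/-- The coefficients in degrees k+1 and k agree automatically. The remaining k coefficients of the
derivative are the x_i times k+1-i, whence the division in `shear`. -/
theorem derivative_morinPoly_eq_iff {k : ℕ} (hk : 1 ≤ k) (x : Euc m) (t : ℝ) :
    derivative (morinPoly (k + 1) x) = locusPoly k t ↔
      ∀ i, 1 ≤ i → i ≤ k → crd x i = shear k i t := by
  have key : ∀ i, 1 ≤ i → i ≤ k → (derivative (morinPoly (k + 1) x)).coeff (k - i) =
      crd x i * ((k + 1 - i : ℕ) : ℝ) := by
    intro i h1 h2
    have e : k - i + 1 = k + 1 - i := by omega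
    rw [coeff_derivative, e, coeff_morinPoly_sub h1 h2, ← e]
    push_cast
    rfl
  have hne : ∀ i, i ≤ k → ((k + 1 - i : ℕ) : ℝ) ≠ 0 := fun i hi => by
    rw [Nat.cast_ne_zero]
    omega
  constructor
  · intro h i h1 h2
    rw [shear, ← h, key i h1 h2, mul_div_cancel_right₀ _ (hne i h2)]
  · intro h
    ext j
    rcases lt_trichotomy j k with h1 | rfl | h1
    · have h2 := key (k - j) (by omega) (by omega)
      rw [show k - (k - j) = j by omega] at h2
      rw [h2, h _ (by omega) (by omega), shear, show k - (k - j) = j by omega,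
        div_mul_cancel₀ _ (hne _ (by omega))]
    · rw [coeff_locusPoly_self hk, coeff_derivative, coeff_morinPoly_self, zero_mul]
    · rw [coeff_derivative, coeff_morinPoly_of_gt (by omega)]
      by_cases h2 : j = k + 1
      · subst h2
        rw [coeff_locusPoly_top, if_pos rfl]
        push_cast
        ring
      · rw [coeff_locusPoly_of_gt (by omega), if_neg (by omega), zero_mul]

theorem natDegree_derivative_morinPoly (k : ℕ) (x : Euc m) :
    (derivative (morinPoly k x)).natDegree = k := by
  apply natDegree_eq_of_le_of_coeff_ne_zero
  · rw [natDegree_le_iff_coeff_eq_zero]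
    intro j hj
    rw [coeff_derivative, coeff_morinPoly_of_gt (by omega), if_neg (by omega), zero_mul]
  · rw [coeff_derivative_morinPoly_top]
    positivity

/-- The cofactor of (T-t)^k is linear by degree. The leading coefficient fixes its slope, and the
vanishing coefficient of T^k fixes its root. -/
theorem derivative_morinPoly_eq_of_dvd {k : ℕ} (hk : 1 ≤ k) {x : Euc m} {t : ℝ}
    (h : (X - C t) ^ k ∣ derivative (morinPoly (k + 1) x)) :
    derivative (morinPoly (k + 1) x) = locusPoly k t := by
  obtain ⟨Q, hQ⟩ := h
  have hQ0 : Q ≠ 0 := by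
    rintro rfl
    exact derivative_morinPoly_ne_zero x (by rw [hQ, mul_zero])
  have hdeg : Q.natDegree = 1 := by
    have h1 := natDegree_derivative_morinPoly (k + 1) x
    rw [hQ, natDegree_mul (pow_ne_zero _ (X_sub_C_ne_zero t)) hQ0, natDegree_pow,
      natDegree_X_sub_C] at h1
    omega
  obtain ⟨a, b, rfl⟩ : ∃ a b : ℝ, Q = C a * X + C b :=
    ⟨_, _, eq_X_add_C_of_natDegree_le_one hdeg.le⟩
  have hco : ∀ j, (derivative (morinPoly (k + 1) x)).coeff (j + 1) =
      (-t) ^ (k - j) * (k.choose j) * a + (-t) ^ (k - (j + 1)) * k.choose (j + 1) * b := by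
    intro j
    rw [hQ, mul_add, coeff_add, ← mul_assoc, coeff_mul_X, coeff_mul_C, coeff_mul_C, sub_eq_add_neg,
      ← C_neg, coeff_X_add_C_pow, coeff_X_add_C_pow]
  have ha : a = k + 2 := by
    have h1 := hco k
    rw [coeff_derivative_morinPoly_top] at h1
    simp at h1
    linarith
  have hb : b = a * (k * t) := by
    obtain ⟨j, rfl⟩ := Nat.exists_eq_add_of_le' hk
    have h1 := hco j
    rw [coeff_derivative, coeff_morinPoly_self, show j + 1 - j = 1 by omega, Nat.choose_symm_add,
      Nat.choose_self] at h1
    simp at h1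
    push_cast
    linarith
  rw [hQ, locusPoly, hb, ha]
  simp only [C_mul]
  ring

/-- With t = x_n this exhibits the closure of A_k as a graph over (x_(k+1), …, x_n), the form which
`straighten` flattens. -/
theorem pow_dvd_derivative_iff {k : ℕ} (hk : 1 ≤ k) (x : Euc m) (t : ℝ) :
    (X - C t) ^ k ∣ derivative (morinPoly (k + 1) x) ↔
      ∀ i, 1 ≤ i → i ≤ k → crd x i = shear k i t := by
  rw [← derivative_morinPoly_eq_iff hk]
  refine ⟨derivative_morinPoly_eq_of_dvd hk, fun h => ?_⟩
  rw [h, locusPoly]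
  exact (dvd_mul_right _ _).mul_left _

/-- The cofactor T + kt vanishes at t only if (k+1)t = 0. -/
theorem pow_succ_dvd_derivative_iff {k : ℕ} (hk : 1 ≤ k) (x : Euc m) (t : ℝ) :
    (X - C t) ^ (k + 1) ∣ derivative (morinPoly (k + 1) x) ↔
      (∀ i, 1 ≤ i → i ≤ k → crd x i = shear k i t) ∧ t = 0 := by
  have key : (X - C t) ^ (k + 1) ∣ locusPoly k t ↔ t = 0 := by
    have hu : IsUnit (C (k + 2 : ℝ)) := isUnit_C.2 (isUnit_iff_ne_zero.2 (by positivity))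
    rw [locusPoly, hu.dvd_mul_left, pow_succ,
      mul_dvd_mul_iff_left (pow_ne_zero _ (X_sub_C_ne_zero t)), dvd_iff_isRoot]
    simp only [IsRoot, eval_add, eval_X, eval_C]
    constructor
    · intro h
      have h1 : ((k : ℝ) + 1) * t = 0 := by linarith
      exact (mul_eq_zero.1 h1).resolve_left (by positivity)
    · rintro rfl
      simp
  constructor
  · intro h
    have h1 := derivative_morinPoly_eq_of_dvd hk ((pow_dvd_pow _ k.le_succ).trans h)
    exact ⟨(derivative_morinPoly_eq_iff hk x t).1 h1, key.1 (h1 ▸ h)⟩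
  · rintro ⟨h1, h2⟩
    rw [(derivative_morinPoly_eq_iff hk x t).2 h1]
    exact key.2 h2

theorem not_pow_succ_succ_dvd {k : ℕ} (x : Euc m) (t : ℝ) :
    ¬ (X - C t) ^ (k + 1) ∣ derivative (morinPoly k x) := by
  intro h
  have h1 := natDegree_le_of_dvd h (derivative_morinPoly_ne_zero x)
  rw [natDegree_derivative_morinPoly, natDegree_pow, natDegree_X_sub_C] at h1
  omega

/-- Both sides come from polynomials with the same derivative, so these differ by a constant. The
coefficient (k+2)t of s^(k+1) is what later tells the two sides of t = 0 apart. -/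
theorem eval_morinPoly_add {k : ℕ} {x : Euc m} {t : ℝ}
    (h : derivative (morinPoly (k + 1) x) = locusPoly k t) (s : ℝ) :
    (morinPoly (k + 1) x).eval (t + s) - (morinPoly (k + 1) x).eval t =
      s ^ (k + 1) * (s + (k + 2) * t) := by
  set Q := morinPoly (k + 1) x - (X - C t) ^ (k + 1) * (X + C ((k + 1) * t)) with hQ
  have hd : derivative Q = 0 := by
    rw [hQ, derivative_sub, h, locusPoly]
    rw [derivative_mul, derivative_X_sub_C_pow, derivative_add, derivative_X, derivative_C,
      Nat.add_sub_cancel]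
    simp only [C_mul, C_add, map_natCast, C_1, map_ofNat]
    push_cast
    ring
  have h1 := eq_C_of_natDegree_eq_zero (derivative_eq_zero.1 hd)
  have h2 : morinPoly (k + 1) x = C (Q.coeff 0) + (X - C t) ^ (k + 1) * (X + C ((k + 1) * t)) := by
    rw [← h1, hQ]
    ring
  rw [h2]
  simp only [eval_add, eval_mul, eval_pow, eval_sub, eval_X, eval_C, sub_self, add_sub_cancel_left]
  ring

end Locus

/-! ### The strata in a Morin chart. -/

section Strata

variable {m n : ℕ} {M : Type*} [TopologicalSpace M] [ChartedSpace (Euc m) M]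
  [IsManifold (𝓡 m) ∞ M]

/-- In the charts `Φ` and `Ψ`, the map `f` is the normal form of type `A_k`. -/
structure IsMorinChart (f : M → Euc n) (k l : ℕ) (Φ : OpenPartialHomeomorph M (Euc m))
    (Ψ : OpenPartialHomeomorph (Euc n) (Euc n)) : Prop where
  adm : Admissible m n k l
  mem_atlas : Φ ∈ IsManifold.maximalAtlas (𝓡 m) ∞ M
  mem_atlas' : Ψ ∈ IsManifold.maximalAtlas (𝓡 n) ∞ (Euc n)
  map_mem : ∀ q ∈ Φ.source, f q ∈ Ψ.source
  map_eq : ∀ q ∈ Φ.source, Ψ (f q) = morinMap n k l (Φ q)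

variable {f : M → Euc n} {k l : ℕ} {Φ : OpenPartialHomeomorph M (Euc m)}
  {Ψ : OpenPartialHomeomorph (Euc n) (Euc n)} {q : M}

theorem HasMorinForm.exists_isMorinChart (h : HasMorinForm m f k l q) :
    ∃ (Φ : OpenPartialHomeomorph M (Euc m)) (Ψ : OpenPartialHomeomorph (Euc n) (Euc n)),
      IsMorinChart f k l Φ Ψ ∧ q ∈ Φ.source ∧ Φ q = 0 := by
  obtain ⟨h1, h2, h3, h4, Φ, hΦ, Ψ, hΨ, hq, h0, hf⟩ := h
  refine ⟨Φ, Ψ, ⟨⟨h1, h2, h3, h4⟩, hΦ, hΨ, fun x hx => (hf x hx).1, fun x hx => ?_⟩, hq, h0⟩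
  refine euc_ext fun i hi1 hi2 => ?_
  rcases hi2.lt_or_eq with h | rfl
  · rw [crd_morinMap_of_lt hi1 h]
    exact (hf x hx).2.1 i hi1 (by omega)
  · rw [crd_morinMap_last hi1]
    exact (hf x hx).2.2

theorem IsMorinChart.isLocEquiv {k' l' : ℕ} {Φ' : OpenPartialHomeomorph M (Euc m)}
    {Ψ' : OpenPartialHomeomorph (Euc n) (Euc n)} (h : IsMorinChart f k l Φ Ψ)
    (h' : IsMorinChart f k' l' Φ' Ψ') (hq : q ∈ Φ.source) (hq' : q ∈ Φ'.source) :
    IsLocEquiv (morinMap n k l) (Φ q) (morinMap n k' l') (Φ' q) (Φ.symm.trans Φ')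
      (Ψ.symm.trans Ψ') := by
  have key : ∀ y ∈ (Φ.symm.trans Φ').source, Φ.symm y ∈ Φ.source ∧ Φ.symm y ∈ Φ'.source ∧
      morinMap n k l y = Ψ (f (Φ.symm y)) := by
    intro y hy
    simp only [OpenPartialHomeomorph.trans_source, OpenPartialHomeomorph.symm_source,
      Set.mem_inter_iff, Set.mem_preimage] at hy
    exact ⟨Φ.map_target hy.1, hy.2, by rw [h.map_eq _ (Φ.map_target hy.1), Φ.right_inv hy.1]⟩
  refine ⟨by simp [hq, hq'], by simp [hq], StructureGroupoid.compatible_of_mem_maximalAtlas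
    h.mem_atlas h'.mem_atlas, StructureGroupoid.compatible_of_mem_maximalAtlas h.mem_atlas'
    h'.mem_atlas', ?_, ?_⟩
  · intro y hy
    obtain ⟨h1, h2, h3⟩ := key y hy
    rw [h3]
    simp only [OpenPartialHomeomorph.trans_source, OpenPartialHomeomorph.symm_source,
      Set.mem_inter_iff, Set.mem_preimage]
    rw [Ψ.left_inv (h.map_mem _ h1)]
    exact ⟨Ψ.map_source (h.map_mem _ h1), h'.map_mem _ h2⟩
  · intro y hy
    obtain ⟨h1, h2, h3⟩ := key y hy
    rw [h3]
    simp only [OpenPartialHomeomorph.coe_trans, Function.comp_apply]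
    rw [Ψ.left_inv (h.map_mem _ h1), h'.map_eq _ h2]

theorem derivative_morinPoly_zero (k : ℕ) :
    derivative (morinPoly k (0 : Euc m)) = C (k + 1 : ℝ) * X ^ k := by
  simp [morinPoly, crd_zero]

/-- The type of a Morin singular point is determined by the contact of curves. -/
theorem HasMorinForm.contact_iff {k' l' : ℕ} (h : IsMorinChart f k l Φ Ψ) (hq : q ∈ Φ.source)
    (hform : HasMorinForm m f k' l' q) {N : ℕ} (hN : N ≠ 0) :
    ((∀ j, n < j → j ≤ m → crd (Φ q) j = 0) ∧
      (X - C (crd (Φ q) n)) ^ N ∣ derivative (morinPoly k (Φ q))) ↔ N ≤ k' := by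
  obtain ⟨Φ', Ψ', h', hq', h0⟩ := hform.exists_isMorinChart
  have he := h.isLocEquiv h' hq hq'
  have hn : 1 ≤ n := h.adm.one_le_k.trans h.adm.k_le
  rw [← exists_isContact_iff h.adm hN]
  have h1 : (∃ γ η, IsContact (morinMap n k l) (Φ q) γ η N) ↔
      ∃ γ η, IsContact (morinMap n k' l') (Φ' q) γ η N := by
    constructor
    · rintro ⟨γ, η, hc⟩
      exact ⟨_, hc.comp he (contDiff_morinMap hn)⟩
    · rintro ⟨γ, η, hc⟩
      exact ⟨_, hc.comp he.symm (contDiff_morinMap hn)⟩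
  -- In the chart centred at q the derivative of the unfolding is (k'+1) T^k', so contact of order N
  -- means that T^N divides T^k'.
  rw [h1, exists_isContact_iff h'.adm hN, h0, crd_zero, derivative_morinPoly_zero]
  have hu : IsUnit (C (k' + 1 : ℝ)) := isUnit_C.2 (isUnit_iff_ne_zero.2 (by positivity))
  rw [hu.dvd_mul_left, C_0, sub_zero, pow_dvd_pow_iff X_ne_zero not_isUnit_X]
  simp [crd_zero]

theorem mem_contDiffGroupoid_of_maximalAtlas
    (h : Ψ ∈ IsManifold.maximalAtlas (𝓡 n) ∞ (Euc n)) : Ψ ∈ contDiffGroupoid ∞ (𝓡 n) := by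
  have h1 := StructureGroupoid.compatible_of_mem_maximalAtlas
    (StructureGroupoid.id_mem_maximalAtlas (contDiffGroupoid ∞ (𝓡 n))) h
  simpa using h1

/-- A covector that kills the image of the normal form obstructs surjectivity of df. So q is
singular and the hypothesis on singular points gives it some type. -/
theorem IsMorinChart.not_surjective (h : IsMorinChart f k l Φ Ψ) (hf : ContMDiff (𝓡 m) (𝓡 n) ∞ f)
    (hq : q ∈ Φ.source) {L : Euc n →L[ℝ] ℝ} (hL : L ≠ 0)
    (hL0 : L.comp (fderiv ℝ (morinMap n k l : Euc m → Euc n) (Φ q)) = 0) :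
    ¬ Function.Surjective (mfderiv (𝓡 m) (𝓡 n) f q) := by
  intro hs
  have hn : 1 ≤ n := h.adm.one_le_k.trans h.adm.k_le
  have hΨ := mem_contDiffGroupoid_of_maximalAtlas h.mem_atlas'
  have d1 : MDifferentiableAt (𝓡 m) (𝓡 n) f q := (hf q).mdifferentiableAt (by simp)
  have d2 : DifferentiableAt ℝ Ψ (f q) :=
    (contDiffAt_of_mem_groupoid hΨ (h.map_mem q hq)).differentiableAt (by simp)
  have d3 : MDifferentiableAt (𝓡 m) (𝓡 m) Φ q :=
    ((contMDiffOn_of_mem_maximalAtlas h.mem_atlas).contMDiffAt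
      (Φ.open_source.mem_nhds hq)).mdifferentiableAt (by simp)
  have d4 : DifferentiableAt ℝ (morinMap n k l : Euc m → Euc n) (Φ q) :=
    (contDiff_morinMap hn).contDiffAt.differentiableAt (by simp)
  have e : Ψ ∘ f =ᶠ[𝓝 q] morinMap n k l ∘ Φ := by
    filter_upwards [Φ.open_source.mem_nhds hq] with y hy using h.map_eq y hy
  have e1 := e.mfderiv_eq (I := 𝓡 m) (I' := 𝓡 n)
  rw [mfderiv_comp q d2.mdifferentiableAt d1, mfderiv_comp q d4.mdifferentiableAt d3,
    mfderiv_eq_fderiv, mfderiv_eq_fderiv] at e1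
  apply hL
  ext y
  have h2 := congrArg (fun A : Euc n →L[ℝ] Euc n => A y)
    (fderiv_comp_fderiv_symm hΨ (h.map_mem q hq))
  simp only [ContinuousLinearMap.comp_apply, ContinuousLinearMap.id_apply] at h2
  obtain ⟨v, hv⟩ := hs (fderiv ℝ Ψ.symm (Ψ (f q)) y)
  have h3 : y = fderiv ℝ (morinMap n k l) (Φ q) (mfderiv (𝓡 m) (𝓡 m) Φ q v) := by
    have h4 := congrArg (fun A : Euc m →L[ℝ] Euc n => A v) e1
    have h5 : fderiv ℝ Ψ (f q) (mfderiv (𝓡 m) (𝓡 n) f q v) =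
      fderiv ℝ (morinMap n k l) (Φ q) (mfderiv (𝓡 m) (𝓡 m) Φ q v) := h4
    rw [← h5, hv, h2]
  rw [h3]
  exact congrArg (fun A : Euc m →L[ℝ] ℝ => A (mfderiv (𝓡 m) (𝓡 m) Φ q v)) hL0

/-- For the converse, divisibility provides a conormal covector, so q is singular and hence of some
type j'; the contact orders j and j+1 bound j' from both sides. -/
theorem mem_morinSet_iff (hf : IsMorinMap m f) (h : IsMorinChart f k l Φ Ψ) (hq : q ∈ Φ.source)
    {j : ℕ} (hj : 1 ≤ j) : q ∈ morinSet m f j ↔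
      (∀ i, n < i → i ≤ m → crd (Φ q) i = 0) ∧
      (X - C (crd (Φ q) n)) ^ j ∣ derivative (morinPoly k (Φ q)) ∧
      ¬ (X - C (crd (Φ q) n)) ^ (j + 1) ∣ derivative (morinPoly k (Φ q)) := by
  constructor
  · rintro ⟨l', hl'⟩
    have h1 := (hl'.contact_iff h hq (N := j) (by omega)).2 le_rfl
    refine ⟨h1.1, h1.2, fun h2 => ?_⟩
    have := (hl'.contact_iff h hq (N := j + 1) (by omega)).1 ⟨h1.1, h2⟩
    omega
  · rintro ⟨h1, h2, h3⟩
    have hc := isContact_axis h.adm h1 ((pow_dvd_pow _ hj).trans h2)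
    have hL : (conormal n k l (Φ q)).comp (fderiv ℝ (morinMap n k l : Euc m → Euc n) (Φ q)) = 0 := by
      obtain ⟨c, hb⟩ := hc.conormal.bound
      have := hb.self_of_nhds
      simp only [zero_smul, add_zero, pow_one, norm_zero, mul_zero] at this
      exact norm_le_zero_iff.1 this
    have hne : conormal n k l (Φ q) ≠ 0 := by
      have := hc.ne
      simpa using this
    obtain ⟨j', l', hl'⟩ := hf.2 q (h.not_surjective hf.1 hq hne hL)
    have h4 := (hl'.contact_iff h hq (N := j) (by omega)).1 ⟨h1, h2⟩
    have h5 : ¬ j + 1 ≤ j' := fun h6 =>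
      h3 ((hl'.contact_iff h hq (N := j + 1) (by omega)).2 h6).2
    obtain rfl : j' = j := by omega
    exact ⟨l', hl'⟩

/-- The closure of `A_k` in the coordinates of the normal form of `A_(k+1)`. -/
def InLocus (n k : ℕ) (x : Euc m) : Prop :=
  (∀ i, n < i → i ≤ m → crd x i = 0) ∧ ∀ i, 1 ≤ i → i ≤ k → crd x i = shear k i (crd x n)

theorem mem_morinSet_iff_inLocus (hf : IsMorinMap m f) (hk : 1 ≤ k)
    (h : IsMorinChart f (k + 1) l Φ Ψ) (hq : q ∈ Φ.source) :
    q ∈ morinSet m f k ↔ InLocus n k (Φ q) ∧ crd (Φ q) n ≠ 0 := by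
  rw [mem_morinSet_iff hf h hq hk, pow_dvd_derivative_iff hk, pow_succ_dvd_derivative_iff hk,
    InLocus]
  tauto

theorem mem_morinSet_succ_iff_inLocus (hf : IsMorinMap m f) (hk : 1 ≤ k)
    (h : IsMorinChart f (k + 1) l Φ Ψ) (hq : q ∈ Φ.source) :
    q ∈ morinSet m f (k + 1) ↔ InLocus n k (Φ q) ∧ crd (Φ q) n = 0 := by
  rw [mem_morinSet_iff hf h hq (by omega), pow_succ_dvd_derivative_iff hk, InLocus]
  have := not_pow_succ_succ_dvd (k := k + 1) (Φ q) (crd (Φ q) n)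
  tauto

end Strata

end

section

open Asymptotics Polynomial Filter

/-! ### Leading terms along lines under changes of coordinates. -/

section Limits

variable {m n : ℕ}

/-- To first order e' is its derivative at g x, and the remainder is o(s^N) because g moves by
O(s^N) along the line. So leading coefficients are simply transformed by De'. -/
theorem IsLocEquiv.tendsto_crd_div {g g' : Euc m → Euc n} {x x' : Euc m}
    {e : OpenPartialHomeomorph (Euc m) (Euc m)} {e' : OpenPartialHomeomorph (Euc n) (Euc n)}
    (h : IsLocEquiv g x g' x' e e') (hg : Continuous g) {v : Euc m} {w : Euc n} {φ : ℝ → ℝ}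
    {N : ℕ} {b : ℝ} (hφ : ∀ s : ℝ, g (x + s • v) - g x = φ s • w)
    (hlead : Tendsto (fun s => φ s / s ^ N) (𝓝[≠] 0) (𝓝 b)) (i : ℕ) :
    Tendsto (fun s : ℝ => (crd (g' (e (x + s • v))) i - crd (g' x') i) / s ^ N) (𝓝[≠] 0)
      (𝓝 (b * crd (fderiv ℝ e' (g x) w) i)) := by
  have hgx := h.map_mem x h.mem_source
  have hd : HasFDerivAt (fun y => crd (e' y) i) ((crdL n i).comp (fderiv ℝ e' (g x))) (g x) :=
    (hasFDerivAt_crd i _).comp (g x) ((contDiffAt_of_mem_groupoid h.mem_groupoid'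
      hgx).differentiableAt (by simp)).hasFDerivAt
  have hline : Continuous fun s : ℝ => x + s • v := by fun_prop
  have hline0 : Tendsto (fun s : ℝ => x + s • v) (𝓝[≠] 0) (𝓝 x) := by
    have := hline.tendsto 0
    simp only [zero_smul, add_zero] at this
    exact this.mono_left nhdsWithin_le_nhds
  have ht : Tendsto (fun s : ℝ => g (x + s • v)) (𝓝[≠] 0) (𝓝 (g x)) :=
    (hg.tendsto x).comp hline0
  have h0 : ∀ᶠ s : ℝ in 𝓝[≠] 0, s ≠ 0 := self_mem_nhdsWithin
  have h1 := hd.isLittleO.comp_tendsto ht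
  have hO : (fun s : ℝ => g (x + s • v) - g x) =O[𝓝[≠] 0] fun s : ℝ => s ^ N := by
    have h2 : (fun s => φ s / s ^ N * s ^ N) =O[𝓝[≠] 0] fun s : ℝ => s ^ N := by
      have := (hlead.isBigO_one ℝ).mul (isBigO_refl (fun s : ℝ => s ^ N) (𝓝[≠] 0))
      simpa using this
    have h3 : (fun s => φ s) =O[𝓝[≠] 0] fun s : ℝ => s ^ N := by
      refine h2.congr' ?_ EventuallyEq.rfl
      filter_upwards [h0] with s hs
      rw [div_mul_cancel₀ _ (pow_ne_zero _ hs)]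
    simp only [hφ]
    refine (h3.smul (isBigO_refl (fun _ : ℝ => w) _)).trans
      (IsBigO.of_bound ‖w‖ (Eventually.of_forall fun s => ?_))
    rw [norm_smul, mul_comm]
  have h2 := (h1.trans_isBigO hO).tendsto_div_nhds_zero
  have h3 := h2.add (hlead.mul_const (crd (fderiv ℝ e' (g x) w) i))
  rw [zero_add] at h3
  refine h3.congr' ?_
  have hsrc : ∀ᶠ s : ℝ in 𝓝[≠] 0, x + s • v ∈ e.source :=
    hline0.eventually (e.open_source.mem_nhds h.mem_source)
  filter_upwards [hsrc] with s hs
  simp only [Function.comp_def, ContinuousLinearMap.comp_apply, hφ, map_smul, crdL_apply,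
    crd_smul]
  rw [h.comm _ hs, h.comm _ h.mem_source, h.map_eq]
  ring

/-- The leading term of the normal form along a curve. -/
theorem tendsto_morinForm_div {k l : ℕ} (hA : Admissible m n k l) {y : ℝ → Euc m} {N : ℕ}
    {c B : ℕ → ℝ} {A : ℝ}
    (h1 : ∀ i, 1 ≤ i → i < n → Tendsto (fun s => crd (y s) i / s ^ N) (𝓝[≠] 0) (𝓝 (c i)))
    (h2 : Tendsto (fun s => crd (y s) n) (𝓝[≠] 0) (𝓝 0))
    (h3 : Tendsto (fun s => crd (y s) n ^ (k + 1) / s ^ N) (𝓝[≠] 0) (𝓝 A))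
    (h4 : ∀ j, n < j → j ≤ m → Tendsto (fun s => crd (y s) j ^ 2 / s ^ N) (𝓝[≠] 0) (𝓝 (B j))) :
    Tendsto (fun s => morinForm n k l (y s) / s ^ N) (𝓝[≠] 0)
      (𝓝 (A + ∑ j ∈ Finset.Icc (n + 1) m, morinSign n l j * B j)) := by
  have h5 : Tendsto (fun s => ∑ i ∈ Finset.Icc 1 (k - 1),
      crd (y s) i / s ^ N * crd (y s) n ^ (k - i)) (𝓝[≠] 0)
      (𝓝 (∑ i ∈ Finset.Icc 1 (k - 1), 0)) := by
    refine tendsto_finsetSum _ fun i hi => ?_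
    rw [Finset.mem_Icc] at hi
    have h6 := (h1 i hi.1 (by have := hA.k_le; omega)).mul (h2.pow (k - i))
    rwa [zero_pow (by omega), mul_zero] at h6
  have h6 : Tendsto (fun s => ∑ j ∈ Finset.Icc (n + 1) m,
      morinSign n l j * (crd (y s) j ^ 2 / s ^ N)) (𝓝[≠] 0)
      (𝓝 (∑ j ∈ Finset.Icc (n + 1) m, morinSign n l j * B j)) := by
    refine tendsto_finsetSum _ fun j hj => ?_
    rw [Finset.mem_Icc] at hj
    exact (h4 j (by omega) hj.2).const_mul _
  have h7 := (h3.add h5).add h6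
  rw [Finset.sum_const_zero, add_zero] at h7
  refine h7.congr fun s => ?_
  rw [morinForm_eq hA.one_le_l hA.l_le, morinPoly]
  simp only [eval_add, eval_pow, eval_X, eval_finsetSum, eval_mul, eval_C, add_div, Finset.sum_div]
  congr 1
  · congr 1
    exact Finset.sum_congr rfl fun i _ => by ring
  · exact Finset.sum_congr rfl fun i _ => by ring

/-- The direction v does not touch the coefficients of the unfolding, so only the last component
moves; on the locus the linear terms in x_(n+1), …, x_m vanish as well. -/
theorem morinMap_add_smul_of_inLocus {k l : ℕ} (hA : Admissible m n (k + 1) l) (hk : 1 ≤ k)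
    {x : Euc m} (hx : InLocus n k x) {v : Euc m} (hv : ∀ i, 1 ≤ i → i < n → crd v i = 0) (s : ℝ) :
    morinMap n (k + 1) l (x + s • v) - morinMap n (k + 1) l x =
      ((s * crd v n) ^ (k + 1) * (s * crd v n + (k + 2) * crd x n) +
        s ^ 2 * ∑ j ∈ Finset.Icc (n + 1) m, morinSign n l j * crd v j ^ 2) • bvec n n := by
  have hn : 1 ≤ n := hA.one_le_k.trans hA.k_le
  have hP : morinPoly (k + 1) (x + s • v) = morinPoly (k + 1) x := by
    unfold morinPoly
    congr 1
    refine Finset.sum_congr rfl fun i hi => ?_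
    rw [Finset.mem_Icc] at hi
    rw [crd_add, crd_smul, hv i hi.1 (by have := hA.k_le; omega), mul_zero, add_zero]
  refine euc_ext fun i h1 h2 => ?_
  rw [crd_smul, crd_sub, crd_bvec h1 h2]
  rcases h2.lt_or_eq with h3 | rfl
  · rw [crd_morinMap_of_lt h1 h3, crd_morinMap_of_lt h1 h3, crd_add, crd_smul, hv i h1 h3,
      if_neg h3.ne]
    ring
  · rw [crd_morinMap_last hn, crd_morinMap_last hn, morinForm_eq hA.one_le_l hA.l_le,
      morinForm_eq hA.one_le_l hA.l_le, hP, crd_add, crd_smul, if_pos rfl]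
    have h4 := eval_morinPoly_add ((derivative_morinPoly_eq_iff hk x (crd x i)).2 hx.2)
      (s * crd v i)
    have h5 : ∑ j ∈ Finset.Icc (i + 1) m, morinSign i l j * crd (x + s • v) j ^ 2 =
        s ^ 2 * ∑ j ∈ Finset.Icc (i + 1) m, morinSign i l j * crd v j ^ 2 := by
      rw [Finset.mul_sum]
      refine Finset.sum_congr rfl fun j hj => ?_
      rw [Finset.mem_Icc] at hj
      rw [crd_add, crd_smul, hx.1 j (by omega) hj.2]
      ring
    have h6 : ∑ j ∈ Finset.Icc (i + 1) m, morinSign i l j * crd x j ^ 2 = 0 := by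
      refine Finset.sum_eq_zero fun j hj => ?_
      rw [Finset.mem_Icc] at hj
      rw [hx.1 j (by omega) hj.2]
      ring
    rw [h5, h6]
    linarith

end Limits

/-! ### Comparing the normal forms of A_(k+1) and A_k at one point. -/

section Parity

variable {m n k l l' : ℕ} {x : Euc m} {e : OpenPartialHomeomorph (Euc m) (Euc m)}
  {e' : OpenPartialHomeomorph (Euc n) (Euc n)}

theorem morinForm_zero (hA : Admissible m n k l) : morinForm n k l (0 : Euc m) = 0 := by
  rw [morinForm_eq hA.one_le_l hA.l_le]
  simp [crd_zero, morinPoly]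

theorem morinMap_zero (hA : Admissible m n k l) : morinMap n k l (0 : Euc m) = 0 :=
  euc_ext fun i h1 h2 => by
    rcases h2.lt_or_eq with h | rfl
    · rw [crd_morinMap_of_lt h1 h, crd_zero, crd_zero]
    · rw [crd_morinMap_last h1, morinForm_zero hA, crd_zero]

theorem hasDerivAt_crd_line (he : e ∈ contDiffGroupoid ∞ (𝓡 m)) (hx : x ∈ e.source) (v : Euc m)
    (j : ℕ) : HasDerivAt (fun s : ℝ => crd (e (x + s • v)) j) (crd (fderiv ℝ e x v) j) 0 := by
  have h1 : HasDerivAt (fun s : ℝ => x + s • v) v 0 := by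
    simpa using ((hasDerivAt_id (0 : ℝ)).smul_const v).const_add x
  have h2 : HasFDerivAt e (fderiv ℝ e x) (x + (0 : ℝ) • v) := by
    rw [zero_smul, add_zero]
    exact ((contDiffAt_of_mem_groupoid he hx).differentiableAt (by simp)).hasFDerivAt
  have h3 := (hasFDerivAt_crd j _).comp_hasDerivAt 0 (h2.comp_hasDerivAt 0 h1)
  rwa [crdL_apply] at h3

theorem tendsto_div_of_hasDerivAt {φ : ℝ → ℝ} {u : ℝ} (h : HasDerivAt φ u 0) (h0 : φ 0 = 0) :
    Tendsto (fun s => φ s / s) (𝓝[≠] 0) (𝓝 u) := by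
  have := h.tendsto_slope
  refine this.congr fun s => ?_
  rw [slope_def_field, h0, sub_zero, sub_zero]

theorem tendsto_zero_of_hasDerivAt {φ : ℝ → ℝ} {u : ℝ} (h : HasDerivAt φ u 0) (h0 : φ 0 = 0) :
    Tendsto φ (𝓝[≠] 0) (𝓝 0) := by
  have := h.continuousAt.tendsto
  rw [h0] at this
  exact this.mono_left nhdsWithin_le_nhds

/-- The intrinsic second derivatives of the two normal forms on the kernel agree up to a factor. -/
theorem quadratic_relation (hA : Admissible m n (k + 1) l) (hA' : Admissible m n k l')
    (he : IsLocEquiv (morinMap n (k + 1) l) x (morinMap n k l') 0 e e')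
    (hx : InLocus n k x) {v : Euc m} (hv : ∀ i, 1 ≤ i → i < n → crd v i = 0) :
    (∀ i, 1 ≤ i → i < n → crd (fderiv ℝ e x v) i = 0) ∧
    crd (fderiv ℝ e' (morinMap n (k + 1) l x) (bvec n n)) n *
      (0 ^ (k - 1) * crd v n ^ 2 * ((k + 2) * crd x n) +
        ∑ j ∈ Finset.Icc (n + 1) m, morinSign n l j * crd v j ^ 2) =
      0 ^ (k - 1) * crd (fderiv ℝ e x v) n ^ 2 +
        ∑ j ∈ Finset.Icc (n + 1) m, morinSign n l' j * crd (fderiv ℝ e x v) j ^ 2 := by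
  -- The factor `0 ^ (k - 1)` is 1 for k = 1 and 0 otherwise: only for k = 1 does x_n contribute to
  -- the second-order part.
  obtain ⟨k, rfl⟩ := Nat.exists_eq_add_of_le' hA'.one_le_k
  have hn : 1 ≤ n := hA.one_le_k.trans hA.k_le
  have h0 : ∀ᶠ s : ℝ in 𝓝[≠] 0, s ≠ 0 := self_mem_nhdsWithin
  have hy0 : ∀ j, crd (e (x + (0 : ℝ) • v)) j = 0 := fun j => by
    rw [zero_smul, add_zero, he.map_eq, crd_zero]
  have hder := hasDerivAt_crd_line he.mem_groupoid he.mem_source v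
  have hlead : Tendsto (fun s => ((s * crd v n) ^ (k + 1 + 1) *
      (s * crd v n + ((k + 1 : ℕ) + 2) * crd x n) +
      s ^ 2 * ∑ j ∈ Finset.Icc (n + 1) m, morinSign n l j * crd v j ^ 2) / s ^ 2) (𝓝[≠] 0)
      (𝓝 (0 ^ (k + 1 - 1) * crd v n ^ 2 * (((k + 1 : ℕ) + 2) * crd x n) +
        ∑ j ∈ Finset.Icc (n + 1) m, morinSign n l j * crd v j ^ 2)) := by
    have hc : Continuous fun s : ℝ => (s * crd v n) ^ k * crd v n ^ 2 *
        (s * crd v n + ((k + 1 : ℕ) + 2) * crd x n) +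
        ∑ j ∈ Finset.Icc (n + 1) m, morinSign n l j * crd v j ^ 2 := by fun_prop
    have h1 := (hc.tendsto 0).mono_left (nhdsWithin_le_nhds (s := {0}ᶜ))
    simp only [zero_mul, zero_add] at h1
    refine h1.congr' ?_
    filter_upwards [h0] with s hs
    field_simp
    ring
  have hlim := he.tendsto_crd_div (contDiff_morinMap hn).continuous
    (morinMap_add_smul_of_inLocus hA hA'.one_le_k hx hv) hlead
  simp only [morinMap_zero hA', crd_zero, sub_zero] at hlim
  have hlim1 : ∀ i, 1 ≤ i → i < n → Tendsto (fun s : ℝ => crd (e (x + s • v)) i / s ^ 2) (𝓝[≠] 0)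
      (𝓝 _) := fun i h1 h2 => by
    have := hlim i
    simp only [crd_morinMap_of_lt h1 h2] at this
    exact this
  have hlast := hlim n
  simp only [crd_morinMap_last hn] at hlast
  refine ⟨fun i h1 h2 => ?_, ?_⟩
  -- These components are O(s²), so their first derivatives at 0 vanish.
  · have h3 := tendsto_div_of_hasDerivAt (hder i) (hy0 i)
    refine tendsto_nhds_unique h3 ?_
    have h4 := (hlim1 i h1 h2).mul (tendsto_id.mono_left (nhdsWithin_le_nhds (s := {(0 : ℝ)}ᶜ)))
    rw [mul_zero] at h4
    refine h4.congr' ?_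
    filter_upwards [h0] with s hs
    simp only [id]
    field_simp
  · have h5 := tendsto_morinForm_div hA' hlim1 (tendsto_zero_of_hasDerivAt (hder n) (hy0 n))
      (A := 0 ^ (k + 1 - 1) * crd (fderiv ℝ e x v) n ^ 2)
      (B := fun j => crd (fderiv ℝ e x v) j ^ 2) ?_ ?_
    · rw [mul_comm]
      exact tendsto_nhds_unique hlast h5
    · have h6 := ((tendsto_zero_of_hasDerivAt (hder n) (hy0 n)).pow k).mul
        ((tendsto_div_of_hasDerivAt (hder n) (hy0 n)).pow 2)
      refine h6.congr fun s => ?_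
      rw [div_pow]
      ring
    · intro j h1 h2
      refine ((tendsto_div_of_hasDerivAt (hder j) (hy0 j)).pow 2).congr fun s => ?_
      rw [div_pow]

/-- At 0 the last component of the normal form of A_k has zero derivative, so dx_n ∘ De' kills the
image of the derivative at x. It is non-zero because De' is invertible, and
`apply_bvec_last_ne_zero` applies. -/
theorem factor_ne_zero (hA : Admissible m n (k + 1) l) (hA' : Admissible m n k l')
    (he : IsLocEquiv (morinMap n (k + 1) l) x (morinMap n k l') 0 e e') :
    crd (fderiv ℝ e' (morinMap n (k + 1) l x) (bvec n n)) n ≠ 0 := by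
  have hn : 1 ≤ n := hA.one_le_k.trans hA.k_le
  have hgx := he.map_mem x he.mem_source
  have h1 := apply_bvec_last_ne_zero hA (x := x)
    (L := (crdL n n).comp (fderiv ℝ e' (morinMap n (k + 1) l x))) ?_ ?_
  · simpa [crdL_apply] using h1
  · have h2 := he.fderiv_eq (contDiff_morinMap hn) he.mem_source
    ext v
    have h3 := congrArg (fun A : Euc m →L[ℝ] Euc n => crd (A (fderiv ℝ e x v)) n) h2
    have h4 := congrArg (fun A : Euc m →L[ℝ] Euc m => A v)
      (fderiv_symm_comp_fderiv he.mem_groupoid he.mem_source)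
    simp only [ContinuousLinearMap.comp_apply, ContinuousLinearMap.id_apply] at h3 h4
    rw [h4, he.map_eq, crd_fderiv_morinMap_last hA', morinFormDeriv_apply] at h3
    simp only [ContinuousLinearMap.comp_apply, crdL_apply, _root_.zero_apply]
    rw [← h3, derivative_morinPoly_zero]
    have hk := hA'.one_le_k
    simp only [crd_zero, eval_mul, eval_C, eval_pow, eval_X, mul_zero, zero_mul,
      Finset.sum_const_zero, add_zero, zero_pow (show k ≠ 0 by omega), zero_add]
    refine Finset.sum_eq_zero fun i hi => ?_
    rw [Finset.mem_Icc] at hi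
    rw [zero_pow (by omega), zero_mul]
  · intro h0
    have h5 := congrArg (fun A : Euc n →L[ℝ] Euc n => crd (A (bvec n n)) n)
      (fderiv_comp_fderiv_symm he.mem_groupoid' hgx)
    have h6 := congrArg (fun A : Euc n →L[ℝ] ℝ =>
      A (fderiv ℝ e'.symm (e' (morinMap n (k + 1) l x)) (bvec n n))) h0
    simp only [ContinuousLinearMap.comp_apply, ContinuousLinearMap.id_apply, crdL_apply,
      _root_.zero_apply] at h5 h6
    rw [h6, crd_bvec hn le_rfl, if_pos rfl] at h5
    exact zero_ne_one h5

/-- Compare the coefficients of s^(k+1) along the x_n-axis. One side is c (k+2) x_n; the other is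
u^(k+1) > 0, as k+1 is even and the image curve has x_n-velocity u ≠ 0. The other squares are
O(s^(2k)), which is negligible because k ≥ 2. -/
theorem factor_mul_pos (hA : Admissible m n (k + 1) l) (hA' : Admissible m n k l')
    (he : IsLocEquiv (morinMap n (k + 1) l) x (morinMap n k l') 0 e e')
    (hx : InLocus n k x) (hk : Odd k) (hk3 : 2 ≤ k) :
    0 < crd (fderiv ℝ e' (morinMap n (k + 1) l x) (bvec n n)) n * crd x n := by
  have hn : 1 ≤ n := hA.one_le_k.trans hA.k_le
  have hnm : n ≤ m := by have := hA.l_le; have := hA.one_le_l; omega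
  have h0 : ∀ᶠ s : ℝ in 𝓝[≠] 0, s ≠ 0 := self_mem_nhdsWithin
  have hy0 : ∀ j, crd (e (x + (0 : ℝ) • bvec m n)) j = 0 := fun j => by
    rw [zero_smul, add_zero, he.map_eq, crd_zero]
  have hder := hasDerivAt_crd_line he.mem_groupoid he.mem_source (bvec m n)
  have hdvd : (X - C (crd x n)) ^ k ∣ derivative (morinPoly (k + 1) x) :=
    (pow_dvd_derivative_iff (by omega) x _).2 hx.2
  obtain ⟨η', hc⟩ := (isContact_axis hA hx.1 hdvd).comp he (contDiff_morinMap hn)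
  obtain ⟨u, hu, hdu⟩ := hc.exists_hasDerivAt_last hA' hk3
  have hlead : Tendsto (fun s => ((morinPoly (k + 1) x).eval (crd x n + s) -
      (morinPoly (k + 1) x).eval (crd x n)) / s ^ (k + 1)) (𝓝[≠] 0)
      (𝓝 ((k + 2) * crd x n)) := by
    have hcont : Continuous fun s : ℝ => s + (k + 2) * crd x n := by fun_prop
    have h1 := (hcont.tendsto 0).mono_left (nhdsWithin_le_nhds (s := {0}ᶜ))
    rw [zero_add] at h1
    refine h1.congr' ?_
    filter_upwards [h0] with s hs
    rw [eval_morinPoly_add ((derivative_morinPoly_eq_iff (by omega) x (crd x n)).2 hx.2)]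
    field_simp
  have hlim := he.tendsto_crd_div (contDiff_morinMap hn).continuous (morinMap_add_smul hA x) hlead
  simp only [morinMap_zero hA', crd_zero, sub_zero] at hlim
  have hlim1 : ∀ i, 1 ≤ i → i < n → Tendsto (fun s : ℝ => crd (e (x + s • bvec m n)) i /
      s ^ (k + 1)) (𝓝[≠] 0) (𝓝 _) := fun i h1 h2 => by
    have := hlim i
    simp only [crd_morinMap_of_lt h1 h2] at this
    exact this
  have hlast := hlim n
  simp only [crd_morinMap_last hn] at hlast
  have h5 := tendsto_morinForm_div hA' hlim1 (tendsto_zero_of_hasDerivAt (hder n) (hy0 n))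
      (A := u ^ (k + 1)) (B := fun _ => 0) ?_ ?_
  · have h6 := tendsto_nhds_unique hlast h5
    simp only [mul_zero, Finset.sum_const_zero, add_zero] at h6
    have h7 : 0 < u ^ (k + 1) := (Odd.add_one hk).pow_pos hu
    rw [← h6, mul_assoc] at h7
    have h8 := (mul_pos_iff_of_pos_left (by positivity : (0 : ℝ) < k + 2)).1 h7
    rwa [mul_comm]
  · refine ((tendsto_div_of_hasDerivAt hdu (hy0 n)).pow (k + 1)).congr fun s => ?_
    rw [div_pow]
    rfl
  · intro j h1 h2
    have h6 := (hc.isBigO_crd hA' (by omega) h1 h2).pow 2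
    have h7 : (fun s : ℝ => (s ^ k) ^ 2) =o[𝓝 0] fun s : ℝ => s ^ (k + 1) := by
      simp only [← pow_mul]
      exact isLittleO_pow_pow (by omega)
    exact (h6.trans_isLittleO h7).tendsto_div_nhds_zero.mono_left nhdsWithin_le_nhds

end Parity

end

/-! ### Counting negative weights. -/

section Inertia

/-- Inclusion of the last `m - n + 1` coordinates. -/
def lastIncl (m n : ℕ) : Euc (m - n + 1) →ₗ[ℝ] Euc m where
  toFun w := ofCrd m fun i => crd w (i + 1 - n)
  map_add' x y := euc_ext fun i h1 h2 => by
    rw [crd_add, crd_ofCrd _ h1 h2, crd_ofCrd _ h1 h2, crd_ofCrd _ h1 h2, crd_add]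
  map_smul' c x := euc_ext fun i h1 h2 => by
    rw [RingHom.id_apply, crd_smul, crd_ofCrd _ h1 h2, crd_ofCrd _ h1 h2, crd_smul]

/-- Projection to the last `m - n + 1` coordinates. -/
def lastProj (m n : ℕ) : Euc m →ₗ[ℝ] Euc (m - n + 1) where
  toFun y := ofCrd (m - n + 1) fun i => crd y (i + n - 1)
  map_add' x y := euc_ext fun i h1 h2 => by
    rw [crd_add, crd_ofCrd _ h1 h2, crd_ofCrd _ h1 h2, crd_ofCrd _ h1 h2, crd_add]
  map_smul' c x := euc_ext fun i h1 h2 => by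
    rw [RingHom.id_apply, crd_smul, crd_ofCrd _ h1 h2, crd_ofCrd _ h1 h2, crd_smul]

theorem crd_lastIncl {m n : ℕ} (w : Euc (m - n + 1)) {i : ℕ} (h1 : 1 ≤ i) (h2 : i ≤ m) :
    crd (lastIncl m n w) i = crd w (i + 1 - n) :=
  crd_ofCrd (fun i => crd w (i + 1 - n)) h1 h2

theorem crd_lastProj {m n : ℕ} (y : Euc m) {i : ℕ} (h1 : 1 ≤ i) (h2 : i ≤ m - n + 1) :
    crd (lastProj m n y) i = crd y (i + n - 1) :=
  crd_ofCrd (fun i => crd y (i + n - 1)) h1 h2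

/-- The weights of the quadratic form `κ x_n² + σ ∑ ± x_j²`. -/
def weights (m n l : ℕ) (κ σ : ℝ) : Fin (m - n + 1) → ℝ :=
  Fin.cons κ fun i => σ * morinSign n l (n + 1 + i)

theorem sum_weights {m n l : ℕ} (hnm : n ≤ m) (κ σ : ℝ) (w : Euc (m - n + 1)) :
    ∑ i, weights m n l κ σ i * w i ^ 2 = κ * crd w 1 ^ 2 +
      σ * ∑ j ∈ Finset.Icc (n + 1) m, morinSign n l j * crd w (j + 1 - n) ^ 2 := by
  rw [Fin.sum_univ_succ]
  congr 1
  have h1 : Finset.Icc (n + 1) m = Finset.Ico (n + 1) (m + 1) := by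
    ext j
    simp only [Finset.mem_Icc, Finset.mem_Ico]
    omega
  rw [h1, Finset.sum_Ico_eq_sum_range, show m + 1 - (n + 1) = m - n by omega, Finset.sum_range,
    Finset.mul_sum]
  refine Finset.sum_congr rfl fun i _ => ?_
  rw [weights, Fin.cons_succ, ← crd_succ, show n + 1 + (i : ℕ) + 1 - n = i + 1 + 1 by omega]
  simp only [Fin.val_succ]
  ring

theorem card_fin_lt {R a : ℕ} (h : a ≤ R) :
    Nat.card {i : Fin R // (i : ℕ) < a} = a := by
  rw [Nat.card_eq_fintype_card, Fintype.card_subtype, Finset.card_filter,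
    Fin.sum_univ_eq_sum_range (fun i => if i < a then 1 else 0), ← Finset.card_filter]
  have : (Finset.range R).filter (fun i => i < a) = Finset.range a := by
    ext i
    simp only [Finset.mem_filter, Finset.mem_range]
    omega
  rw [this, Finset.card_range]

theorem card_fin_not_lt {R a : ℕ} (h : a ≤ R) :
    Nat.card {i : Fin R // ¬ (i : ℕ) < a} = R - a := by
  classical
  have h1 := card_fin_lt h
  rw [Nat.card_eq_fintype_card] at h1 ⊢
  rw [Fintype.card_subtype_compl, h1, Fintype.card_fin]

/-- Of the m-n signs the first l-1 are positive and the other m-n+1-l negative; a negative σ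
exchanges the two kinds. -/
theorem card_weights {m n l : ℕ} (hl : 1 ≤ l) (hlm : n + l ≤ m + 1) (κ : ℝ) {σ : ℝ} (hσ : σ ≠ 0) :
    Nat.card {i // weights m n l κ σ i < 0} =
      (if κ < 0 then 1 else 0) + if 0 < σ then m - n + 1 - l else l - 1 := by
  classical
  have h1 : Nat.card {i : Fin (m - n) // σ * morinSign n l (n + 1 + i) < 0} =
      if 0 < σ then m - n + 1 - l else l - 1 := by
    by_cases h : 0 < σ
    · rw [if_pos h, show m - n + 1 - l = m - n - (l - 1) by omega,
        ← card_fin_not_lt (R := m - n) (a := l - 1) (by omega)]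
      refine Nat.card_congr (Equiv.subtypeEquivRight fun i => ?_)
      rw [mul_neg_iff, morinSign]
      split_ifs with h2
      · simp only [h, true_and]
        constructor
        · rintro (h3 | h3) <;> linarith
        · intro h3
          omega
      · simp only [h, true_and]
        constructor
        · intro _
          omega
        · intro _
          left
          norm_num
    · rw [if_neg h, ← card_fin_lt (R := m - n) (a := l - 1) (by omega)]
      have h' : σ < 0 := lt_of_le_of_ne (not_lt.1 h) hσ
      refine Nat.card_congr (Equiv.subtypeEquivRight fun i => ?_)
      rw [mul_neg_iff, morinSign]
      split_ifs with h2
      · simp only [h', true_and]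
        constructor
        · intro _
          omega
        · intro _
          right
          norm_num
      · simp only [h', true_and]
        constructor
        · rintro (h3 | h3) <;> linarith
        · intro h3
          omega
  rw [← h1, Nat.card_eq_fintype_card, Fintype.card_subtype, Fin.card_filter_univ_succ,
    Nat.card_eq_fintype_card, Fintype.card_subtype]
  simp only [weights, Fin.cons_zero, Fin.cons_succ]
  split_ifs <;> omega

end Inertia

/-! ### The parity of the parameter on the two sides of A_(k+1). -/

section Parity

variable {m n k l l' : ℕ} {x : Euc m} {e : OpenPartialHomeomorph (Euc m) (Euc m)}
  {e' : OpenPartialHomeomorph (Euc n) (Euc n)}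

/-- By `quadratic_relation`, De maps the space of the last m-n+1 coordinates injectively into itself
and carries one diagonal form into the other; Sylvester's law applies in both directions. -/
theorem card_weights_eq (hA : Admissible m n (k + 1) l) (hA' : Admissible m n k l')
    (he : IsLocEquiv (morinMap n (k + 1) l) x (morinMap n k l') 0 e e') (hx : InLocus n k x)
    {c : ℝ} (hc : c = crd (fderiv ℝ e' (morinMap n (k + 1) l x) (bvec n n)) n) :
    Nat.card {i // weights m n l (c * (0 ^ (k - 1) * ((k + 2) * crd x n))) c i < 0} =
      Nat.card {i // weights m n l' (0 ^ (k - 1)) 1 i < 0} := by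
  have hn : 1 ≤ n := hA.one_le_k.trans hA.k_le
  have hnm : n ≤ m := by have := hA.l_le; have := hA.one_le_l; omega
  have hincl : ∀ (w : Euc (m - n + 1)) i, 1 ≤ i → i < n → crd (lastIncl m n w) i = 0 := by
    intro w i h1 h2
    -- For i < n the truncated difference i + 1 - n is 0, an index at which `crd` is 0.
    rw [crd_lastIncl w h1 (by omega), crd_of_not (by omega)]
  have hrel := fun w => quadratic_relation hA hA' he hx (hincl w)
  let A : Euc (m - n + 1) →ₗ[ℝ] Euc (m - n + 1) :=
    (lastProj m n).comp ((fderiv ℝ e x).toLinearMap.comp (lastIncl m n))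
  have hA1 : ∀ w i, 1 ≤ i → i ≤ m - n + 1 →
      crd (A w) i = crd (fderiv ℝ e x (lastIncl m n w)) (i + n - 1) := fun w i h1 h2 =>
    crd_lastProj _ h1 h2
  have hinj : Function.Injective A := by
    rw [injective_iff_map_eq_zero]
    intro w hw
    have h1 : fderiv ℝ e x (lastIncl m n w) = 0 := by
      refine euc_ext fun i h1 h2 => ?_
      rw [crd_zero]
      by_cases h3 : i < n
      · exact (hrel w).1 i h1 h3
      · have h4 := hA1 w (i + 1 - n) (by omega) (by omega)
        rw [hw, crd_zero, show i + 1 - n + n - 1 = i by omega] at h4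
        exact h4.symm
    have h2 := congrArg (fun L : Euc m →L[ℝ] Euc m => L (lastIncl m n w))
      (fderiv_symm_comp_fderiv he.mem_groupoid he.mem_source)
    simp only [ContinuousLinearMap.comp_apply, ContinuousLinearMap.id_apply, h1, map_zero] at h2
    refine euc_ext fun i hi1 hi2 => ?_
    have h3 := crd_lastIncl w (i := i + n - 1) (by omega) (by omega)
    rw [← h2, crd_zero, show i + n - 1 + 1 - n = i by omega] at h3
    rw [crd_zero, ← h3]
  let A' := LinearEquiv.ofInjectiveEndo A hinj
  let b := (EuclideanSpace.basisFun (Fin (m - n + 1)) ℝ).toBasis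
  have hb : ∀ (w : Euc (m - n + 1)) i, b.repr w i = w i := fun w i => by simp [b]
  have key : ∀ w, ∑ i, weights m n l (c * (0 ^ (k - 1) * ((k + 2) * crd x n))) c i * b.repr w i ^ 2
      = ∑ i, weights m n l' (0 ^ (k - 1)) 1 i * b.repr (A' w) i ^ 2 := by
    intro w
    simp only [hb]
    rw [sum_weights hnm, sum_weights hnm]
    have h1 := (hrel w).2
    rw [← hc] at h1
    have h2 : crd (A' w) 1 = crd (fderiv ℝ e x (lastIncl m n w)) n := by
      have := hA1 w 1 le_rfl (by omega)
      rwa [show 1 + n - 1 = n by omega] at this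
    have h3 : crd (lastIncl m n w) n = crd w 1 := by
      rw [crd_lastIncl w hn hnm, show n + 1 - n = 1 by omega]
    have h4 : ∑ j ∈ Finset.Icc (n + 1) m, morinSign n l j * crd (lastIncl m n w) j ^ 2 =
        ∑ j ∈ Finset.Icc (n + 1) m, morinSign n l j * crd w (j + 1 - n) ^ 2 := by
      refine Finset.sum_congr rfl fun j hj => ?_
      rw [Finset.mem_Icc] at hj
      rw [crd_lastIncl w (by omega) hj.2]
    have h5 : ∑ j ∈ Finset.Icc (n + 1) m, morinSign n l' j *
        crd (fderiv ℝ e x (lastIncl m n w)) j ^ 2 =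
        ∑ j ∈ Finset.Icc (n + 1) m, morinSign n l' j * crd (A' w) (j + 1 - n) ^ 2 := by
      refine Finset.sum_congr rfl fun j hj => ?_
      rw [Finset.mem_Icc] at hj
      have := hA1 w (j + 1 - n) (by omega) (by omega)
      rw [show j + 1 - n + n - 1 = j by omega] at this
      rw [← this]
      rfl
    rw [h3, h4, h5, ← h2] at h1
    linarith
  apply le_antisymm
  · exact card_neg_weights_eq b b _ _ A' key
  · refine card_neg_weights_eq b b _ _ A'.symm fun w => ?_
    rw [key, A'.apply_symm_apply]

/-- Near a point of type `A_(k+1)` with parameter `l`, the parity of the parameter of a point of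
type `A_k` is determined by the side on which it lies. -/
theorem even_param_iff (hodd : Odd (m - n)) (hk : Odd k) (hA : Admissible m n (k + 1) l)
    (hA' : Admissible m n k l')
    (he : IsLocEquiv (morinMap n (k + 1) l) x (morinMap n k l') 0 e e') (hx : InLocus n k x)
    (ht : crd x n ≠ 0) : Even l' ↔ (Even l ↔ 0 < crd x n) := by
  have hc := factor_ne_zero hA hA' he
  have hcard := card_weights_eq hA hA' he hx rfl
  set c := crd (fderiv ℝ e' (morinMap n (k + 1) l x) (bvec n n)) n with hcdef
  obtain ⟨h1, h2, h3, h4⟩ := hA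
  obtain ⟨h1', h2', h3', h4'⟩ := hA'
  rw [card_weights h3 h4 _ hc, card_weights h3' h4' _ one_ne_zero, if_pos one_pos] at hcard
  obtain ⟨r, hr⟩ := hodd
  obtain ⟨a, ha⟩ := hk
  rw [Nat.even_iff, Nat.even_iff]
  -- For k = 1 the sign of c is free, but the weight 3 c x_n joins the count and compensates it. For
  -- k ≥ 3 that weight is 0 and c has the sign of x_n. The rest is parity, with m-n+1 even.
  rcases Nat.eq_zero_or_pos a with rfl | hapos
  · obtain rfl : k = 1 := by omega
    have h5 : ¬ ((0 : ℝ) ^ (1 - 1) < 0) := by simp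
    rw [if_neg h5] at hcard
    have h6 : c * (0 ^ (1 - 1) * (((1 : ℕ) + 2) * crd x n)) < 0 ↔ c * crd x n < 0 := by
      have : c * (0 ^ (1 - 1) * (((1 : ℕ) + 2) * crd x n)) = 3 * (c * crd x n) := by
        push_cast
        norm_num
        ring
      rw [this]
      constructor <;> intro h <;> linarith
    simp only [h6] at hcard
    rcases lt_or_gt_of_ne hc with hc0 | hc0 <;> rcases lt_or_gt_of_ne ht with ht0 | ht0
    · rw [if_neg (by nlinarith), if_neg (by linarith)] at hcard
      have : ¬ 0 < crd x n := by linarith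
      simp only [this, iff_false]
      omega
    · rw [if_pos (by nlinarith), if_neg (by linarith)] at hcard
      simp only [ht0, iff_true]
      omega
    · rw [if_pos (by nlinarith), if_pos hc0] at hcard
      have : ¬ 0 < crd x n := by linarith
      simp only [this, iff_false]
      omega
    · rw [if_neg (by nlinarith), if_pos hc0] at hcard
      simp only [ht0, iff_true]
      omega
  · have hpos := factor_mul_pos ⟨h1, h2, h3, h4⟩ ⟨h1', h2', h3', h4'⟩ he hx ⟨a, ha⟩ (by omega)
    rw [← hcdef] at hpos
    rw [zero_pow (by omega), zero_mul, mul_zero, if_neg (lt_irrefl _)] at hcard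
    rcases lt_or_gt_of_ne ht with ht0 | ht0
    · rw [if_neg (by nlinarith)] at hcard
      have : ¬ 0 < crd x n := by linarith
      simp only [this, iff_false]
      omega
    · rw [if_pos (by nlinarith)] at hcard
      simp only [ht0, iff_true]
      omega

end Parity

/-! ### Flattening the graph. -/

section Straighten

variable {m n k : ℕ}

/-- The coordinates `(x_(k+1), …, x_n, x_1 - c_1(x_n), …, x_k - c_k(x_n), x_(n+1), …, x_m)` which
straighten the closure of `A_k` in the normal form of `A_(k+1)`. -/
def straighten (m n k : ℕ) (x : Euc m) : Euc m := ofCrd m fun i =>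
  if i ≤ n - k then crd x (k + i)
  else if i ≤ n then crd x (i - (n - k)) - shear k (i - (n - k)) (crd x n) else crd x i

/-- The inverse of `straighten`. -/
def unstraighten (m n k : ℕ) (y : Euc m) : Euc m := ofCrd m fun i =>
  if i ≤ k then crd y (n - k + i) + shear k i (crd y (n - k))
  else if i ≤ n then crd y (i - k) else crd y i

theorem crd_straighten_low (hkn : k < n) (hnm : n ≤ m) (x : Euc m) {i : ℕ} (h1 : 1 ≤ i)
    (h2 : i ≤ n - k) : crd (straighten m n k x) i = crd x (k + i) := by
  rw [straighten, crd_ofCrd _ h1 (by omega), if_pos h2]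

theorem crd_straighten_mid (hkn : k < n) (hnm : n ≤ m) (x : Euc m) {i : ℕ} (h1 : 1 ≤ i)
    (h2 : i ≤ k) : crd (straighten m n k x) (n - k + i) = crd x i - shear k i (crd x n) := by
  rw [straighten, crd_ofCrd _ (by omega) (by omega), if_neg (by omega), if_pos (by omega),
    show n - k + i - (n - k) = i by omega]

theorem crd_straighten_high (hkn : k < n) (x : Euc m) {i : ℕ} (h1 : n < i)
    (h2 : i ≤ m) : crd (straighten m n k x) i = crd x i := by
  rw [straighten, crd_ofCrd _ (by omega) (by omega), if_neg (by omega), if_neg (by omega)]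

theorem crd_unstraighten_low (hkn : k < n) (hnm : n ≤ m) (y : Euc m) {i : ℕ} (h1 : 1 ≤ i)
    (h2 : i ≤ k) : crd (unstraighten m n k y) i = crd y (n - k + i) + shear k i (crd y (n - k)) := by
  rw [unstraighten, crd_ofCrd _ h1 (by omega), if_pos h2]

theorem crd_unstraighten_mid (hnm : n ≤ m) (y : Euc m) {i : ℕ} (h1 : k < i)
    (h2 : i ≤ n) : crd (unstraighten m n k y) i = crd y (i - k) := by
  rw [unstraighten, crd_ofCrd _ (by omega) (by omega), if_neg (by omega), if_pos h2]

theorem crd_unstraighten_high (hkn : k < n) (y : Euc m) {i : ℕ} (h1 : n < i)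
    (h2 : i ≤ m) : crd (unstraighten m n k y) i = crd y i := by
  rw [unstraighten, crd_ofCrd _ (by omega) (by omega), if_neg (by omega), if_neg (by omega)]

theorem unstraighten_straighten (hkn : k < n) (hnm : n ≤ m) (x : Euc m) :
    unstraighten m n k (straighten m n k x) = x := by
  refine euc_ext fun i h1 h2 => ?_
  rcases le_or_gt i k with h3 | h3
  · rw [crd_unstraighten_low hkn hnm _ h1 h3, crd_straighten_mid hkn hnm _ h1 h3,
      crd_straighten_low hkn hnm _ (by omega) le_rfl, show k + (n - k) = n by omega]
    ring
  rcases le_or_gt i n with h4 | h4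
  · rw [crd_unstraighten_mid hnm _ h3 h4, crd_straighten_low hkn hnm _ (by omega) (by omega),
      show k + (i - k) = i by omega]
  · rw [crd_unstraighten_high hkn _ h4 h2, crd_straighten_high hkn _ h4 h2]

theorem straighten_unstraighten (hkn : k < n) (hnm : n ≤ m) (y : Euc m) :
    straighten m n k (unstraighten m n k y) = y := by
  refine euc_ext fun i h1 h2 => ?_
  rcases le_or_gt i (n - k) with h3 | h3
  · rw [crd_straighten_low hkn hnm _ h1 h3, crd_unstraighten_mid hnm _ (by omega) (by omega),
      show k + i - k = i by omega]
  rcases le_or_gt i n with h4 | h4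
  · obtain ⟨j, rfl⟩ := Nat.exists_eq_add_of_le h3.le
    rw [crd_straighten_mid hkn hnm _ (by omega) (by omega),
      crd_unstraighten_low hkn hnm _ (by omega) (by omega),
      crd_unstraighten_mid hnm _ hkn le_rfl]
    ring
  · rw [crd_straighten_high hkn _ h4 h2, crd_unstraighten_high hkn _ h4 h2]

theorem contDiff_straighten (hkn : k < n) (hnm : n ≤ m) : ContDiff ℝ ∞ (straighten m n k) := by
  rw [contDiff_iff_contDiffAt]
  refine fun x => contDiffAt_euc fun i h1 h2 => ContDiff.contDiffAt ?_
  rcases le_or_gt i (n - k) with h3 | h3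
  · simp only [crd_straighten_low hkn hnm _ h1 h3]
    exact contDiff_crd _
  rcases le_or_gt i n with h4 | h4
  · obtain ⟨j, rfl⟩ := Nat.exists_eq_add_of_le h3.le
    simp only [fun x => crd_straighten_mid hkn hnm x (i := j) (by omega) (by omega)]
    exact (contDiff_crd _).sub ((contDiff_shear k j).comp (contDiff_crd n))
  · simp only [crd_straighten_high hkn _ h4 h2]
    exact contDiff_crd _

theorem contDiff_unstraighten (hkn : k < n) (hnm : n ≤ m) : ContDiff ℝ ∞ (unstraighten m n k) := by
  rw [contDiff_iff_contDiffAt]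
  refine fun x => contDiffAt_euc fun i h1 h2 => ContDiff.contDiffAt ?_
  rcases le_or_gt i k with h3 | h3
  · simp only [fun x => crd_unstraighten_low hkn hnm x h1 h3]
    exact (contDiff_crd _).add ((contDiff_shear k i).comp (contDiff_crd _))
  rcases le_or_gt i n with h4 | h4
  · simp only [crd_unstraighten_mid hnm _ h3 h4]
    exact contDiff_crd _
  · simp only [crd_unstraighten_high hkn _ h4 h2]
    exact contDiff_crd _

/-- A diffeomorphism of `ℝ^d` as a chart. -/
def diffeoChart {d : ℕ} (F G : Euc d → Euc d) (h1 : ∀ x, G (F x) = x) (h2 : ∀ y, F (G y) = y)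
    (hF : ContDiff ℝ ∞ F) (hG : ContDiff ℝ ∞ G) : OpenPartialHomeomorph (Euc d) (Euc d) :=
  Homeomorph.toOpenPartialHomeomorph
    { toFun := F
      invFun := G
      left_inv := h1
      right_inv := h2
      continuous_toFun := hF.continuous
      continuous_invFun := hG.continuous }

theorem diffeoChart_mem {d : ℕ} {F G : Euc d → Euc d} (h1 : ∀ x, G (F x) = x)
    (h2 : ∀ y, F (G y) = y) (hF : ContDiff ℝ ∞ F) (hG : ContDiff ℝ ∞ G) :
    diffeoChart F G h1 h2 hF hG ∈ contDiffGroupoid ∞ (𝓡 d) :=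
  (mem_contDiffGroupoid_iff _).2 ⟨hF.contDiffOn, hG.contDiffOn⟩

theorem inLocus_iff_straighten (hkn : k < n) (hnm : n ≤ m) (x : Euc m) :
    InLocus n k x ↔ ∀ i, n - k < i → i ≤ m → crd (straighten m n k x) i = 0 := by
  constructor
  · intro h i h1 h2
    rcases le_or_gt i n with h4 | h4
    · obtain ⟨j, rfl⟩ := Nat.exists_eq_add_of_le h1.le
      rw [crd_straighten_mid hkn hnm _ (by omega) (by omega), h.2 j (by omega) (by omega), sub_self]
    · rw [crd_straighten_high hkn _ h4 h2, h.1 i h4 h2]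
  · intro h
    refine ⟨fun i h1 h2 => ?_, fun i h1 h2 => ?_⟩
    · rw [← crd_straighten_high hkn x h1 h2, h i (by omega) h2]
    · have := h (n - k + i) (by omega) (by omega)
      rw [crd_straighten_mid hkn hnm _ h1 h2] at this
      linarith

end Straighten

/-! ### Closures of pieces of slices. -/

section Closure

variable {m : ℕ} {M : Type*} [TopologicalSpace M]

/-- The slice `x_(d+1) = ⋯ = x_m = 0`. -/
def InSlice (d : ℕ) (x : Euc m) : Prop := ∀ i, d < i → i ≤ m → crd x i = 0

theorem isClosed_inSlice (d : ℕ) : IsClosed {x : Euc m | InSlice d x} := by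
  simp only [InSlice, Set.ofPred_forall]
  exact isClosed_iInter fun i => isClosed_iInter fun _ => isClosed_iInter fun _ =>
    isClosed_eq (continuous_crd i) continuous_const

/-- The closure of a set which, in a chart, is the part `x_d ∈ R` of a slice. -/
theorem mem_closure_slice_iff {P : Set M} {d : ℕ} (hd : 1 ≤ d) (hdm : d ≤ m) {R : Set ℝ}
    {Φ : OpenPartialHomeomorph M (Euc m)}
    (hP : ∀ q ∈ Φ.source, q ∈ P ↔ InSlice d (Φ q) ∧ crd (Φ q) d ∈ R) {q : M} (hq : q ∈ Φ.source) :
    q ∈ closure P ↔ InSlice d (Φ q) ∧ crd (Φ q) d ∈ closure R := by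
  constructor
  · intro h
    have h1 : q ∈ closure (P ∩ Φ.source) :=
      Φ.open_source.closure_inter ⟨h, hq⟩
    have h2 := mem_closure_image (Φ.continuousAt hq) h1
    have hC : IsClosed {x : Euc m | InSlice d x ∧ crd x d ∈ closure R} :=
      (isClosed_inSlice d).inter (isClosed_closure.preimage (continuous_crd d))
    have h3 : Φ '' (P ∩ Φ.source) ⊆ {x : Euc m | InSlice d x ∧ crd x d ∈ closure R} := by
      rintro _ ⟨y, ⟨hy1, hy2⟩, rfl⟩
      have := (hP y hy2).1 hy1
      exact ⟨this.1, subset_closure this.2⟩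
    exact closure_minimal h3 hC h2
  · rintro ⟨h1, h2⟩
    let E : Set (Euc m) := {x | InSlice d x ∧ crd x d ∈ R}
    have h3 : Φ q ∈ closure E := by
      -- Approximate by moving only x_d, which keeps the point in the slice.
      let c : ℝ → Euc m := fun s => Φ q + (s - crd (Φ q) d) • bvec m d
      have hc : Continuous c := by fun_prop
      have h4 := mem_closure_image hc.continuousAt h2
      have h5 : c (crd (Φ q) d) = Φ q := by simp [c]
      rw [h5] at h4
      refine closure_mono ?_ h4
      rintro _ ⟨s, hs, rfl⟩
      refine ⟨fun i hi1 hi2 => ?_, ?_⟩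
      · simp only [c]
        rw [crd_add_smul_bvec _ _ (by omega) hi2, h1 i hi1 hi2, if_neg (by omega), add_zero]
      · simp only [c]
        rw [crd_add_smul_bvec _ _ hd hdm, if_pos rfl]
        simpa using hs
    have h6 : Φ q ∈ closure (E ∩ Φ.target) :=
      Φ.open_target.closure_inter ⟨h3, Φ.map_source hq⟩
    have h7 := mem_closure_image (Φ.continuousAt_symm (Φ.map_source hq)) h6
    rw [Φ.left_inv hq] at h7
    refine closure_mono ?_ h7
    rintro _ ⟨y, ⟨hy1, hy2⟩, rfl⟩
    rw [hP _ (Φ.map_target hy2), Φ.right_inv hy2]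
    exact hy1

end Closure

/-! ### A_k^+ and A_k^- as the two halves of a slice. -/

section Sides

variable {m n : ℕ} {M : Type*} [TopologicalSpace M] [ChartedSpace (Euc m) M]
  [IsManifold (𝓡 m) ∞ M] {f : M → Euc n} {k : ℕ} {p : M}

/-- In the chart `Φ`, the sets `P` and `Q` are the two open halves of a slice. -/
def AreSides (P Q : Set M) (d : ℕ) (Φ : OpenPartialHomeomorph M (Euc m)) : Prop :=
  ∀ q ∈ Φ.source, (q ∈ P ↔ InSlice d (Φ q) ∧ 0 < crd (Φ q) d) ∧
    (q ∈ Q ↔ InSlice d (Φ q) ∧ crd (Φ q) d < 0)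

theorem mem_morinSet_iff_pos_or_neg {q : M} :
    q ∈ morinSet m f k ↔ q ∈ morinSetPos m f k ∨ q ∈ morinSetNeg m f k := by
  constructor
  · rintro ⟨l, hl⟩
    rcases Nat.even_or_odd l with h | h
    · exact Or.inl ⟨l, h, hl⟩
    · exact Or.inr ⟨l, h, hl⟩
  · rintro (⟨l, -, hl⟩ | ⟨l, -, hl⟩) <;> exact ⟨l, hl⟩

/-- Near a point of type `A_(k+1)`, the closure of `A_k` is a slice, which is cut by `A_(k+1)` into
the two halves `A_k^+` and `A_k^-`. -/
theorem exists_chart_of_mem_morinSet (hodd : Odd (m - n)) (hf : IsMorinMap m f) (hk : Odd k)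
    (hp : p ∈ morinSet m f (k + 1)) :
    ∃ Φ : OpenPartialHomeomorph M (Euc m), p ∈ Φ.source ∧ Φ p = 0 ∧
      Φ ∈ IsManifold.maximalAtlas (𝓡 m) ∞ M ∧
      (∀ q ∈ Φ.source, q ∈ morinSet m f (k + 1) ↔ InSlice (n - k) (Φ q) ∧ crd (Φ q) (n - k) = 0) ∧
      (AreSides (morinSetPos m f k) (morinSetNeg m f k) (n - k) Φ ∨
        AreSides (morinSetNeg m f k) (morinSetPos m f k) (n - k) Φ) := by
  obtain ⟨l, hl⟩ := hp
  obtain ⟨Φ₀, Ψ, hM, hp₀, h0⟩ := hl.exists_isMorinChart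
  have hk1 : 1 ≤ k := hk.pos
  have hkn : k < n := hM.adm.k_le
  have hnm : n ≤ m := by have := hM.adm.l_le; have := hM.adm.one_le_l; omega
  let e := diffeoChart (straighten m n k) (unstraighten m n k) (unstraighten_straighten hkn hnm)
    (straighten_unstraighten hkn hnm) (contDiff_straighten hkn hnm) (contDiff_unstraighten hkn hnm)
  have hsrc : (Φ₀.trans e).source = Φ₀.source := by
    simp [e, diffeoChart]
  have hval : ∀ q, (Φ₀.trans e) q = straighten m n k (Φ₀ q) := fun q => rfl
  have hslice : ∀ q, InSlice (n - k) ((Φ₀.trans e) q) ↔ InLocus n k (Φ₀ q) := fun q => by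
    rw [hval, inLocus_iff_straighten hkn hnm]
    rfl
  have hlast : ∀ q, crd ((Φ₀.trans e) q) (n - k) = crd (Φ₀ q) n := fun q => by
    rw [hval, crd_straighten_low hkn hnm _ (by omega) le_rfl, show k + (n - k) = n by omega]
  -- The parity of l' depends on the side alone, so every normal form at q has the same parity; a
  -- point of A_k thus lies in exactly one of A_k^+ and A_k^-.
  have hpar : ∀ q ∈ Φ₀.source, ∀ l', HasMorinForm m f k l' q →
      (Even l' ↔ (Even l ↔ 0 < crd (Φ₀ q) n)) := by
    intro q hq l' hl'
    obtain ⟨Φ', Ψ', hM', hq', h0'⟩ := hl'.exists_isMorinChart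
    have he := hM.isLocEquiv hM' hq hq'
    rw [h0'] at he
    have h1 := (mem_morinSet_iff_inLocus hf hk1 hM hq).1 ⟨l', hl'⟩
    exact even_param_iff hodd hk hM.adm hM'.adm he h1.1 h1.2
  have hpos : ∀ q ∈ Φ₀.source, q ∈ morinSetPos m f k ↔ InLocus n k (Φ₀ q) ∧
      crd (Φ₀ q) n ≠ 0 ∧ (Even l ↔ 0 < crd (Φ₀ q) n) := by
    intro q hq
    have h1 := mem_morinSet_iff_inLocus hf hk1 hM hq
    constructor
    · rintro ⟨l', he, hl'⟩
      exact ⟨(h1.1 ⟨l', hl'⟩).1, (h1.1 ⟨l', hl'⟩).2, (hpar q hq l' hl').1 he⟩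
    · rintro ⟨h2, h3, h4⟩
      obtain ⟨l', hl'⟩ := h1.2 ⟨h2, h3⟩
      exact ⟨l', (hpar q hq l' hl').2 h4, hl'⟩
  have hneg : ∀ q ∈ Φ₀.source, q ∈ morinSetNeg m f k ↔ InLocus n k (Φ₀ q) ∧
      crd (Φ₀ q) n ≠ 0 ∧ ¬ (Even l ↔ 0 < crd (Φ₀ q) n) := by
    intro q hq
    have h1 := mem_morinSet_iff_inLocus hf hk1 hM hq
    constructor
    · rintro ⟨l', he, hl'⟩
      refine ⟨(h1.1 ⟨l', hl'⟩).1, (h1.1 ⟨l', hl'⟩).2, ?_⟩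
      rw [← hpar q hq l' hl', Nat.not_even_iff_odd]
      exact he
    · rintro ⟨h2, h3, h4⟩
      obtain ⟨l', hl'⟩ := h1.2 ⟨h2, h3⟩
      rw [← hpar q hq l' hl', Nat.not_even_iff_odd] at h4
      exact ⟨l', h4, hl'⟩
  refine ⟨Φ₀.trans e, by rwa [hsrc], ?_, trans_mem_maximalAtlas hM.mem_atlas
    (diffeoChart_mem _ _ _ _), ?_, ?_⟩
  · rw [hval, h0]
    refine euc_ext fun i h1 h2 => ?_
    rw [crd_zero]
    rcases le_or_gt i (n - k) with h3 | h3
    · rw [crd_straighten_low hkn hnm _ h1 h3, crd_zero]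
    · refine (inLocus_iff_straighten hkn hnm 0).1 ⟨fun _ _ _ => crd_zero _, fun j hj1 hj2 => ?_⟩
        i h3 h2
      rw [crd_zero, crd_zero, shear_zero hj1 hj2]
  · intro q hq
    rw [hsrc] at hq
    rw [hslice, hlast, mem_morinSet_succ_iff_inLocus hf hk1 hM hq]
  · by_cases hl : Even l
    · left
      intro q hq
      rw [hsrc] at hq
      rw [hslice, hlast, hpos q hq, hneg q hq]
      simp only [hl, true_iff, not_lt]
      exact ⟨⟨fun h => ⟨h.1, h.2.2⟩, fun h => ⟨h.1, h.2.ne', h.2⟩⟩,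
        ⟨fun h => ⟨h.1, lt_of_le_of_ne h.2.2 h.2.1⟩, fun h => ⟨h.1, h.2.ne, h.2.le⟩⟩⟩
    · right
      intro q hq
      rw [hsrc] at hq
      rw [hslice, hlast, hpos q hq, hneg q hq]
      simp only [hl, false_iff, not_lt, not_le]
      exact ⟨⟨fun h => ⟨h.1, h.2.2⟩, fun h => ⟨h.1, h.2.ne', h.2⟩⟩,
        ⟨fun h => ⟨h.1, lt_of_le_of_ne h.2.2 h.2.1⟩, fun h => ⟨h.1, h.2.ne, h.2.le⟩⟩⟩

theorem AreSides.mem_closure_union {P Q : Set M} {d : ℕ} (hd : 1 ≤ d) (hdm : d ≤ m)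
    {Φ : OpenPartialHomeomorph M (Euc m)} (h : AreSides P Q d Φ) {q : M} (hq : q ∈ Φ.source) :
    q ∈ closure (P ∪ Q) ↔ InSlice d (Φ q) := by
  have := mem_closure_slice_iff (P := P ∪ Q) (R := {0}ᶜ) hd hdm (fun x hx => by
    rw [Set.mem_union, (h x hx).1, (h x hx).2, ← and_or_left, Set.mem_compl_singleton_iff,
      ne_comm, ← lt_or_lt_iff_ne]) hq
  rw [this, closure_compl_singleton]
  simp

theorem AreSides.mem_closure_left {P Q : Set M} {d : ℕ} (hd : 1 ≤ d) (hdm : d ≤ m)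
    {Φ : OpenPartialHomeomorph M (Euc m)} (h : AreSides P Q d Φ) {q : M} (hq : q ∈ Φ.source) :
    q ∈ closure P ↔ InSlice d (Φ q) ∧ 0 ≤ crd (Φ q) d := by
  have := mem_closure_slice_iff (P := P) (R := Set.Ioi 0) hd hdm (fun x hx => (h x hx).1) hq
  rwa [closure_Ioi] at this

theorem AreSides.mem_closure_right {P Q : Set M} {d : ℕ} (hd : 1 ≤ d) (hdm : d ≤ m)
    {Φ : OpenPartialHomeomorph M (Euc m)} (h : AreSides P Q d Φ) {q : M} (hq : q ∈ Φ.source) :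
    q ∈ closure Q ↔ InSlice d (Φ q) ∧ crd (Φ q) d ≤ 0 := by
  have := mem_closure_slice_iff (P := Q) (R := Set.Iio 0) hd hdm (fun x hx => (h x hx).2) hq
  rwa [closure_Iio] at this

theorem morinSet_eq_union : morinSet m f k = morinSetPos m f k ∪ morinSetNeg m f k :=
  Set.ext fun _ => mem_morinSet_iff_pos_or_neg

theorem inSlice_pred_iff {d : ℕ} (hd : 1 ≤ d) (hdm : d ≤ m) (x : Euc m) :
    InSlice (d - 1) x ↔ InSlice d x ∧ crd x d = 0 := by
  constructor
  · intro h
    exact ⟨fun i h1 h2 => h i (by omega) h2, h d (by omega) hdm⟩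
  · rintro ⟨h1, h2⟩ i h3 h4
    rcases eq_or_ne i d with rfl | h5
    · exact h2
    · exact h1 i (by omega) h4

/-- The two open halves are dense in the slice, and A_(k+1) is already closed within the chart
domain, so both closures are coordinate slices. -/
theorem isAdaptedChart_of_sides (hkn : k + 1 ≤ n) (hnm : n ≤ m)
    {Φ : OpenPartialHomeomorph M (Euc m)} (hpΦ : p ∈ Φ.source)
    (h0 : Φ p = 0) (hΦ : Φ ∈ IsManifold.maximalAtlas (𝓡 m) ∞ M)
    (hB : ∀ q ∈ Φ.source, q ∈ morinSet m f (k + 1) ↔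
      InSlice (n - k) (Φ q) ∧ crd (Φ q) (n - k) = 0)
    (hs : AreSides (morinSetPos m f k) (morinSetNeg m f k) (n - k) Φ ∨
        AreSides (morinSetNeg m f k) (morinSetPos m f k) (n - k) Φ) :
    IsAdaptedChart f k p Φ := by
  refine ⟨hpΦ, h0, ⟨by omega, hΦ, fun q hq => ?_⟩, ⟨by omega, hΦ, fun q hq => ?_⟩⟩
  · rw [morinSet_eq_union]
    rcases hs with h | h
    · exact h.mem_closure_union (by omega) (by omega) hq
    · rw [Set.union_comm]
      exact h.mem_closure_union (by omega) (by omega) hq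
  · have h1 := mem_closure_slice_iff (R := {0}) (by omega) (by omega) hB hq
    rw [closure_singleton] at h1
    rw [h1]
    exact (inSlice_pred_iff (by omega) (by omega) _).symm

/-- If a slice is cut into the halves `P` and `Q` in one chart, it is so in every chart in which the
slice and its boundary are given by coordinates. -/
theorem AreSides.transfer {P Q S B : Set M} {d : ℕ} (hd : 1 ≤ d) (hdm : d ≤ m)
    {Φ₁ Φ : OpenPartialHomeomorph M (Euc m)} (h : AreSides P Q d Φ₁)
    (hp₁ : p ∈ Φ₁.source) (h0₁ : Φ₁ p = 0) (hp : p ∈ Φ.source) (h0 : Φ p = 0)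
    (hS₁ : ∀ q ∈ Φ₁.source, q ∈ S ↔ InSlice d (Φ₁ q))
    (hB₁ : ∀ q ∈ Φ₁.source, q ∈ B ↔ InSlice d (Φ₁ q) ∧ crd (Φ₁ q) d = 0)
    (hS : ∀ q ∈ Φ.source, q ∈ S ↔ InSlice d (Φ q))
    (hB : ∀ q ∈ Φ.source, q ∈ B ↔ InSlice d (Φ q) ∧ crd (Φ q) d = 0) :
    ∃ W : Set M, IsOpen W ∧ p ∈ W ∧
      (AreSides P Q d (Φ.restr W) ∨ AreSides Q P d (Φ.restr W)) := by
  have hnhds : (Φ.symm.trans Φ₁).source ∈ 𝓝 (0 : Euc m) := by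
    refine (Φ.symm.trans Φ₁).open_source.mem_nhds ?_
    rw [← h0]
    simp [hp, hp₁]
  obtain ⟨r, hr, hball⟩ := Metric.mem_nhds_iff.1 hnhds
  have hball' : ∀ x ∈ Metric.ball (0 : Euc m) r, x ∈ Φ.target ∧ Φ.symm x ∈ Φ₁.source :=
    fun x hx => by simpa using hball hx
  let T : Euc m → ℝ := fun x => crd (Φ₁ (Φ.symm x)) d
  have hT : ContinuousOn T (Metric.ball 0 r) := by
    refine (continuous_crd d).comp_continuousOn ?_
    exact (Φ.symm.trans Φ₁).continuousOn.mono hball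
  -- Each half of the slice in a ball is convex, hence connected. As T, the old last coordinate,
  -- vanishes on the slice only where the new one does, it has constant sign on each half.
  let D : ℝ → Set (Euc m) := fun σ => {x | x ∈ Metric.ball 0 r ∧ InSlice d x ∧ 0 < σ * crd x d}
  have hDconv : ∀ σ, IsPreconnected (D σ) := by
    intro σ
    refine Convex.isPreconnected ?_
    intro x hx y hy a b ha hb hab
    refine ⟨convex_ball 0 r hx.1 hy.1 ha hb hab, fun i h1 h2 => ?_, ?_⟩
    · rw [crd_add, crd_smul, crd_smul, hx.2.1 i h1 h2, hy.2.1 i h1 h2]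
      ring
    · rw [crd_add, crd_smul, crd_smul]
      have e : σ * (a * crd x d + b * crd y d) = a * (σ * crd x d) + b * (σ * crd y d) := by ring
      rw [e]
      rcases ha.lt_or_eq with h1 | h1
      · exact add_pos_of_pos_of_nonneg (mul_pos h1 hx.2.2) (mul_nonneg hb hy.2.2.le)
      · have : b = 1 := by linarith
        rw [← h1, this]
        linarith [hy.2.2]
  have hTslice : ∀ x ∈ Metric.ball (0 : Euc m) r, InSlice d x ↔ InSlice d (Φ₁ (Φ.symm x)) := by
    intro x hx
    obtain ⟨h1, h2⟩ := hball' x hx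
    rw [← hS₁ _ h2, hS _ (Φ.map_target h1), Φ.right_inv h1]
  have hTzero : ∀ x ∈ Metric.ball (0 : Euc m) r, InSlice d x → (T x = 0 ↔ crd x d = 0) := by
    intro x hx hs
    obtain ⟨h1, h2⟩ := hball' x hx
    have h3 := hB₁ _ h2
    rw [hB _ (Φ.map_target h1), Φ.right_inv h1, ← hTslice x hx] at h3
    simp only [hs, true_and] at h3
    exact h3.symm
  have hsign : ∀ σ, σ ≠ 0 → ∀ x ∈ D σ, ∀ y ∈ D σ, 0 < T x → 0 < T y := by
    intro σ hσ x hx y hy hTx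
    by_contra hTy
    have h1 := (hDconv σ).intermediate_value hy hx (hT.mono fun z hz => hz.1)
    obtain ⟨z, hz, hz0⟩ := h1 ⟨not_lt.1 hTy, hTx.le⟩
    have h2 := (hTzero z hz.1 hz.2.1).1 hz0
    have h3 := hz.2.2
    rw [h2, mul_zero] at h3
    exact lt_irrefl _ h3
  have hne : ∀ σ, ∀ x ∈ D σ, T x ≠ 0 := by
    intro σ x hx h1
    have h3 := hx.2.2
    rw [(hTzero x hx.1 hx.2.1).1 h1, mul_zero] at h3
    exact lt_irrefl _ h3
  -- Both signs of T occur: follow the points sδe_d of the first chart, with s > 0 small, into the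
  -- second.
  have hpts : ∀ δ : ℝ, δ ≠ 0 → ∃ x ∈ Metric.ball (0 : Euc m) r, InSlice d x ∧ crd x d ≠ 0 ∧
      0 < δ * T x := by
    intro δ hδ
    let c : ℝ → Euc m := fun s => (s * δ) • bvec m d
    have hc0 : c 0 = 0 := by simp [c]
    have hcc : ContinuousAt c 0 := by fun_prop
    have h1 : (Φ₁.symm.trans Φ).source ∈ 𝓝 (c 0) := by
      rw [hc0]
      refine (Φ₁.symm.trans Φ).open_source.mem_nhds ?_
      rw [← h0₁]
      simp [hp, hp₁]
    have h2 : ContinuousAt (fun s => Φ (Φ₁.symm (c s))) 0 := by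
      refine ContinuousAt.comp (g := fun x => Φ (Φ₁.symm x)) ?_ hcc
      exact (Φ₁.symm.trans Φ).continuousAt (mem_of_mem_nhds h1)
    have h3 : Φ (Φ₁.symm (c 0)) = 0 := by
      rw [hc0, show Φ₁.symm 0 = p by rw [← h0₁, Φ₁.left_inv hp₁], h0]
    have h4 : ∀ᶠ s in 𝓝 (0 : ℝ), Φ (Φ₁.symm (c s)) ∈ Metric.ball (0 : Euc m) r := by
      have h5 := h2.tendsto
      simp only [h3] at h5
      exact h5.eventually (Metric.ball_mem_nhds 0 hr)
    obtain ⟨s, ⟨hs1, hs2⟩, hs3⟩ := (((h4.and (hcc.eventually h1)).filter_mono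
      (nhdsWithin_le_nhds (s := Set.Ioi 0))).and (self_mem_nhdsWithin)).exists
    have hs3' : 0 < s := hs3
    have hs2' : c s ∈ Φ₁.target ∧ Φ₁.symm (c s) ∈ Φ.source := by
      have h5 : c s ∈ (Φ₁.symm.trans Φ).source := hs2
      simpa using h5
    have hcs : ∀ i, 1 ≤ i → i ≤ m → crd (c s) i = if i = d then s * δ else 0 := by
      intro i h5 h6
      simp only [c]
      rw [crd_smul, crd_bvec h5 h6]
      split_ifs <;> ring
    have hsl : InSlice d (c s) := fun i h5 h6 => by
      rw [hcs i (by omega) h6, if_neg (by omega)]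
    have hTs : T (Φ (Φ₁.symm (c s))) = s * δ := by
      simp only [T]
      rw [Φ.left_inv hs2'.2, Φ₁.right_inv hs2'.1, hcs d hd hdm, if_pos rfl]
    have hsl' : InSlice d (Φ (Φ₁.symm (c s))) := by
      rw [hTslice _ hs1, Φ.left_inv hs2'.2, Φ₁.right_inv hs2'.1]
      exact hsl
    refine ⟨_, hs1, hsl', ?_, ?_⟩
    · rw [Ne, ← hTzero _ hs1 hsl', hTs]
      exact mul_ne_zero hs3'.ne' hδ
    · rw [hTs]
      have : 0 < δ * δ := mul_self_pos.2 hδ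
      nlinarith
  obtain ⟨xp, hx1, hx2, hx3, hx4⟩ := hpts 1 one_ne_zero
  obtain ⟨xn, hy1, hy2, hy3, hy4⟩ := hpts (-1) (by norm_num)
  -- Here σ is the sign of x_d at a point with T > 0. The point with T < 0 must then lie in the
  -- opposite half.
  obtain ⟨σ, hσ, hσx⟩ : ∃ σ : ℝ, (σ = 1 ∨ σ = -1) ∧ xp ∈ D σ := by
    rcases lt_or_gt_of_ne hx3 with h1 | h1
    · exact ⟨-1, Or.inr rfl, hx1, hx2, by linarith⟩
    · exact ⟨1, Or.inl rfl, hx1, hx2, by linarith⟩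
  have hσ0 : σ ≠ 0 := by rcases hσ with rfl | rfl <;> norm_num
  have hplus : ∀ x ∈ D σ, 0 < T x := fun x hx => hsign σ hσ0 _ hσx x hx (by linarith)
  have hcase : ∀ x ∈ Metric.ball (0 : Euc m) r, InSlice d x → crd x d ≠ 0 →
      x ∈ D σ ∨ x ∈ D (-σ) := by
    intro x h1 h2 h3
    rcases lt_or_gt_of_ne (mul_ne_zero hσ0 h3) with h4 | h4
    · exact Or.inr ⟨h1, h2, by linarith⟩
    · exact Or.inl ⟨h1, h2, h4⟩
  have hyD : xn ∈ D (-σ) := by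
    refine (hcase xn hy1 hy2 hy3).resolve_left fun h1 => ?_
    linarith [hplus _ h1]
  have hminus : ∀ x ∈ D (-σ), T x < 0 := by
    intro x hx
    by_contra h1
    have h2 : 0 < T x := lt_of_le_of_ne (not_lt.1 h1) (hne _ x hx).symm
    linarith [hsign (-σ) (neg_ne_zero.2 hσ0) x hx _ hyD h2]
  have hTσ : ∀ x ∈ Metric.ball (0 : Euc m) r, InSlice d x → (0 < T x ↔ 0 < σ * crd x d) ∧
      (T x < 0 ↔ σ * crd x d < 0) := by
    intro x h1 h2
    by_cases h3 : crd x d = 0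
    · rw [(hTzero x h1 h2).2 h3, h3]
      simp
    · rcases hcase x h1 h2 h3 with h4 | h4
      · have h5 := hplus x h4
        have h6 := h4.2.2
        constructor <;> constructor <;> intro <;> linarith
      · have h5 := hminus x h4
        have h6 := h4.2.2
        constructor <;> constructor <;> intro <;> linarith
  have hW : IsOpen (Φ.source ∩ Φ ⁻¹' Metric.ball 0 r) :=
    Φ.isOpen_inter_preimage Metric.isOpen_ball
  refine ⟨Φ.source ∩ Φ ⁻¹' Metric.ball 0 r, hW, ⟨hp, by simp [h0, hr]⟩, ?_⟩
  have hmain : ∀ q ∈ (Φ.restr (Φ.source ∩ Φ ⁻¹' Metric.ball 0 r)).source,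
      (q ∈ P ↔ InSlice d (Φ q) ∧ 0 < σ * crd (Φ q) d) ∧
      (q ∈ Q ↔ InSlice d (Φ q) ∧ σ * crd (Φ q) d < 0) := by
    intro q hq
    rw [OpenPartialHomeomorph.restr_source' _ _ hW] at hq
    obtain ⟨hq1, -, hq2⟩ := hq
    obtain ⟨h1, h2⟩ := hball' _ hq2
    rw [Φ.left_inv hq1] at h2
    have h3 := hTslice _ hq2
    have h4 := hTσ _ hq2
    simp only [T] at h4
    rw [Φ.left_inv hq1] at h3 h4
    rw [(h q h2).1, (h q h2).2, ← h3]
    exact ⟨and_congr_right fun h5 => (h4 h5).1, and_congr_right fun h5 => (h4 h5).2⟩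
  rcases hσ with rfl | rfl
  · left
    intro q hq
    simpa using hmain q hq
  · right
    intro q hq
    have := hmain q hq
    simp only [neg_mul, one_mul, Left.neg_pos_iff, Left.neg_neg_iff] at this
    exact ⟨this.2, this.1⟩

end Sides

/-! ### Linear perturbation of a non-degenerate critical point. -/

section Analysis

variable {d : ℕ}

/-- The second derivative of `h` at `0` is non-degenerate. -/
def NondegAt (h : Euc d → ℝ) : Prop :=
  ∀ v, (∀ w, fderiv ℝ (fderiv ℝ h) 0 v w = 0) → v = 0

theorem hasStrictFDerivAt_fderiv {h : Euc d → ℝ} (hh : ContDiffAt ℝ ∞ h 0) :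
    HasStrictFDerivAt (fderiv ℝ h) (fderiv ℝ (fderiv ℝ h) 0) 0 :=
  (hh.fderiv_right (m := 1) (by rw [one_add_one_eq_two]; exact two_le_infty)).hasStrictFDerivAt (by simp)

theorem NondegAt.injective {h : Euc d → ℝ} (hn : NondegAt h) :
    Function.Injective (fderiv ℝ (fderiv ℝ h) 0) := by
  rw [injective_iff_map_eq_zero]
  intro v hv
  exact hn v fun w => by rw [hv]; rfl

theorem NondegAt.surjective {h : Euc d → ℝ} (hn : NondegAt h) :
    Function.Surjective (fderiv ℝ (fderiv ℝ h) 0) := by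
  have hfin : Module.finrank ℝ (Euc d) = Module.finrank ℝ (Euc d →L[ℝ] ℝ) := by
    rw [← (LinearMap.toContinuousLinearMap (𝕜 := ℝ) (E := Euc d) (F' := ℝ)).finrank_eq]
    exact (Subspace.dual_finrank_eq (K := ℝ) (V := Euc d)).symm
  exact (LinearMap.injective_iff_surjective_of_finrank_eq_finrank
    (f := (fderiv ℝ (fderiv ℝ h) 0).toLinearMap) hfin).1 hn.injective

theorem NondegAt.exists_lower_bound {h : Euc d → ℝ} (hn : NondegAt h) :
    ∃ c : ℝ, 0 < c ∧ ∀ v, c * ‖v‖ ≤ ‖fderiv ℝ (fderiv ℝ h) 0 v‖ := by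
  obtain ⟨K, hK, hA⟩ := LinearMap.exists_antilipschitzWith
    (fderiv ℝ (fderiv ℝ h) 0).toLinearMap (LinearMap.ker_eq_bot.2 hn.injective)
  refine ⟨(K : ℝ)⁻¹, by positivity, fun v => ?_⟩
  have h1 := hA.le_mul_dist v 0
  simp only [dist_zero_right, map_zero, ContinuousLinearMap.coe_coe] at h1
  rw [inv_mul_le_iff₀ (by positivity)]
  exact h1

/-- The difference of `Dh` from its linearisation. -/
theorem exists_ball_approx {h : Euc d → ℝ} (hh : ContDiffAt ℝ ∞ h 0) {η : ℝ} (hη : 0 < η) :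
    ∃ r > 0, ∀ v ∈ Metric.ball (0 : Euc d) r, ∀ w ∈ Metric.ball (0 : Euc d) r,
      ‖fderiv ℝ h v - fderiv ℝ h w - fderiv ℝ (fderiv ℝ h) 0 (v - w)‖ ≤ η * ‖v - w‖ := by
  have h1 := (hasStrictFDerivAt_fderiv hh).isLittleO.def hη
  obtain ⟨r, hr, hb⟩ := Metric.eventually_nhds_iff_ball.1 h1
  refine ⟨r, hr, fun v hv w hw => ?_⟩
  have h2 : ((v, w) : Euc d × Euc d) ∈ Metric.ball ((0 : Euc d), (0 : Euc d)) r := by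
    rw [← ball_prod_same]
    exact ⟨hv, hw⟩
  simpa only using hb (v, w) h2

/-- The lower bound for the Hessian survives an approximation error of half its constant. This
isolates critical points and makes perturbed ones unique. -/
theorem exists_ball_antilipschitz {h : Euc d → ℝ} (hh : ContDiffAt ℝ ∞ h 0) (hn : NondegAt h) :
    ∃ c > 0, ∃ r > 0, ∀ v ∈ Metric.ball (0 : Euc d) r, ∀ w ∈ Metric.ball (0 : Euc d) r,
      c * ‖v - w‖ ≤ ‖fderiv ℝ h v - fderiv ℝ h w‖ := by
  obtain ⟨c, hc, hlow⟩ := hn.exists_lower_bound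
  obtain ⟨r, hr, hb⟩ := exists_ball_approx hh (half_pos hc)
  refine ⟨c / 2, half_pos hc, r, hr, fun v hv w hw => ?_⟩
  have h1 := hb v hv w hw
  have h2 := hlow (v - w)
  have h3 := norm_sub_norm_le (fderiv ℝ (fderiv ℝ h) 0 (v - w)) (fderiv ℝ h v - fderiv ℝ h w)
  rw [norm_sub_rev (fderiv ℝ (fderiv ℝ h) 0 (v - w))] at h3
  linarith

/-- The sign of the last coordinate of a point where `Dh = -ε dx_d`. -/
theorem exists_ball_sign {h : Euc d → ℝ} (hh : ContDiffAt ℝ ∞ h 0) (hn : NondegAt h)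
    (hc0 : fderiv ℝ h 0 = 0) {u : Euc d} (hu : fderiv ℝ (fderiv ℝ h) 0 u = crdL d d)
    (hu0 : crd u d ≠ 0) :
    ∃ r > 0, ∀ v ∈ Metric.ball (0 : Euc d) r, ∀ ε : ℝ, 0 < ε →
      fderiv ℝ h v = -ε • crdL d d → crd v d * crd u d < 0 := by
  obtain ⟨c, hc, hlow⟩ := hn.exists_lower_bound
  -- The solution is compared with -εu. The bound η ≤ c/2 gives ‖v‖ ≤ 2ε‖u‖; then η ≤ c|u_d|/(2A)
  -- gives |v_d + εu_d| ≤ ε|u_d|/2, so v_d has the sign of -u_d. The added ones keep A positive.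
  set A := 2 * ‖u‖ * (‖crdL d d‖ + 1) + 1 with hA
  have hA1 : 1 ≤ A := by
    have : 0 ≤ 2 * ‖u‖ * (‖crdL d d‖ + 1) := by positivity
    linarith
  have hup : 0 < |crd u d| := abs_pos.2 hu0
  set η := min (c / 2) (c * |crd u d| / A / 2) with hηdef
  have hη : 0 < η := by positivity
  obtain ⟨r, hr, hb⟩ := exists_ball_approx hh hη
  refine ⟨r, hr, fun v hv ε hε hd => ?_⟩
  have h1 := hb v hv 0 (Metric.mem_ball_self hr)
  rw [hd, hc0, sub_zero, sub_zero, ← hu, ← map_smul, ← map_sub] at h1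
  have h2 := (hlow _).trans h1
  have h3 : ‖-ε • u - v‖ = ‖v + ε • u‖ := by
    rw [← norm_neg]
    congr 1
    module
  rw [h3] at h2
  have hη1 : η ≤ c / 2 := min_le_left _ _
  have hη2 : η ≤ c * |crd u d| / A / 2 := min_le_right _ _
  have hnv : ‖v‖ ≤ 2 * ε * ‖u‖ := by
    have h4 : ‖v‖ ≤ ‖v + ε • u‖ + ‖ε • u‖ := by
      have := norm_sub_le (v + ε • u) (ε • u)
      rwa [add_sub_cancel_right] at this
    rw [norm_smul, Real.norm_of_nonneg hε.le] at h4
    have h5 : c * ‖v + ε • u‖ ≤ c / 2 * ‖v‖ :=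
      h2.trans (mul_le_mul_of_nonneg_right hη1 (norm_nonneg _))
    nlinarith
  have h6 : |crd v d + ε * crd u d| ≤ ‖crdL d d‖ * ‖v + ε • u‖ := by
    have := (crdL d d).le_opNorm (v + ε • u)
    rwa [crdL_apply, crd_add, crd_smul, Real.norm_eq_abs] at this
  have h7 : c * |crd v d + ε * crd u d| ≤ ‖crdL d d‖ * (η * (2 * ε * ‖u‖)) := by
    calc c * |crd v d + ε * crd u d| ≤ c * (‖crdL d d‖ * ‖v + ε • u‖) := by gcongr
      _ = ‖crdL d d‖ * (c * ‖v + ε • u‖) := by ring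
      _ ≤ ‖crdL d d‖ * (η * ‖v‖) := by gcongr
      _ ≤ ‖crdL d d‖ * (η * (2 * ε * ‖u‖)) := by gcongr
  have h8 : ‖crdL d d‖ * (η * (2 * ε * ‖u‖)) ≤ η * ε * A := by
    have : 0 ≤ η * ε := by positivity
    rw [hA]
    nlinarith [norm_nonneg u, mul_nonneg this (norm_nonneg u)]
  have h9 : η * ε * A ≤ c * |crd u d| / 2 * ε := by
    have hA0 : 0 < A := by linarith
    calc η * ε * A ≤ c * |crd u d| / A / 2 * ε * A := by gcongr
      _ = c * |crd u d| / 2 * ε := by field_simp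
  have h10 : |crd v d + ε * crd u d| ≤ |crd u d| / 2 * ε := by
    have : c * |crd v d + ε * crd u d| ≤ c * (|crd u d| / 2 * ε) := by linarith
    exact le_of_mul_le_mul_left this hc
  have h11 : (crd v d + ε * crd u d) * crd u d ≤ |crd u d| / 2 * ε * |crd u d| := by
    calc (crd v d + ε * crd u d) * crd u d ≤ |(crd v d + ε * crd u d) * crd u d| := le_abs_self _
      _ = |crd v d + ε * crd u d| * |crd u d| := abs_mul _ _
      _ ≤ _ := by gcongr
  have h12 : |crd u d| * |crd u d| = crd u d * crd u d := abs_mul_abs_self _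
  have h13 : 0 < crd u d * crd u d := mul_self_pos.2 hu0
  nlinarith

/-- Dh has an invertible strict derivative at its zero 0, so it maps each ball around 0 onto a
neighbourhood of the zero covector. -/
theorem exists_solution {h : Euc d → ℝ} (hh : ContDiffAt ℝ ∞ h 0) (hn : NondegAt h)
    (hc0 : fderiv ℝ h 0 = 0) {ρ : ℝ} (hρ : 0 < ρ) :
    ∃ ε₀ > 0, ∀ ε : ℝ, 0 < ε → ε < ε₀ → ∃ v ∈ Metric.ball (0 : Euc d) ρ,
      fderiv ℝ h v = -ε • crdL d d := by
  have h1 := (hasStrictFDerivAt_fderiv hh).map_nhds_eq_of_surj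
    (LinearMap.range_eq_top.2 hn.surjective)
  rw [hc0] at h1
  have h2 : fderiv ℝ h '' Metric.ball 0 ρ ∈ 𝓝 (0 : Euc d →L[ℝ] ℝ) := by
    rw [← h1]
    exact Filter.image_mem_map (Metric.ball_mem_nhds 0 hρ)
  have h3 : Filter.Tendsto (fun ε : ℝ => -ε • crdL d d) (𝓝 0) (𝓝 0) := by
    have : Continuous fun ε : ℝ => -ε • crdL d d := by fun_prop
    simpa using this.tendsto 0
  obtain ⟨ε₀, hε₀, hb⟩ := Metric.mem_nhds_iff.1 (h3 h2)
  refine ⟨ε₀, hε₀, fun ε h4 h5 => ?_⟩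
  have h6 : ε ∈ Metric.ball (0 : ℝ) ε₀ := by
    rw [mem_ball_zero_iff, Real.norm_of_nonneg h4.le]
    exact h5
  exact hb h6

theorem fderiv_fderiv_comp_resize {h : Euc d → ℝ} (hh : ContDiffAt ℝ ∞ h 0)
    (hc0 : fderiv ℝ h 0 = 0) (v w : Euc (d - 1)) :
    fderiv ℝ (fderiv ℝ (h ∘ (resize d : Euc (d - 1) → Euc d))) 0 v w =
      fderiv ℝ (fderiv ℝ h) 0 (resize d v) (resize d w) := by
  have h1 : fderiv ℝ (resize d : Euc (d - 1) → Euc d) 0 = resizeL (d - 1) d :=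
    (resizeL (d - 1) d).hasFDerivAt.fderiv
  rw [fderiv_fderiv_comp_of_crit, h1, resize_zero]
  · rfl
  · rw [resize_zero]
    exact hh.of_le two_le_infty
  · exact contDiff_resize.contDiffAt
  · rw [resize_zero]
    exact hc0

theorem crd_resize_pred (v : Euc (d - 1)) : crd (resize d v) d = 0 := by
  by_cases hd : 1 ≤ d
  · rw [crd_resize _ hd le_rfl, crd_of_not (by omega)]
  · exact crd_of_not (by omega) _

/-- The index of the second derivative of `h` in terms of the index of its restriction to the
hyperplane `x_d = 0`. -/
theorem exists_splitting {h : Euc d → ℝ} (hd : 1 ≤ d) (hh : ContDiffAt ℝ ∞ h 0)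
    (hn : NondegAt h) (hc0 : fderiv ℝ h 0 = 0)
    (hn' : NondegAt (h ∘ (resize d : Euc (d - 1) → Euc d))) :
    ∃ (u : Euc d) (W W' : Submodule ℝ (Euc d)) (W₀ W₀' : Submodule ℝ (Euc (d - 1))),
      fderiv ℝ (fderiv ℝ h) 0 u = crdL d d ∧ crd u d ≠ 0 ∧
      IsSplitting (fun v => fderiv ℝ (fderiv ℝ h) 0 v v) W W' ∧
      IsSplitting (fun v => fderiv ℝ (fderiv ℝ (h ∘ (resize d : Euc (d - 1) → Euc d))) 0 v v)
        W₀ W₀' ∧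
      Module.finrank ℝ W = Module.finrank ℝ W₀ + if crd u d < 0 then 1 else 0 := by
  have hsym : ∀ v w, fderiv ℝ (fderiv ℝ h) 0 v w = fderiv ℝ (fderiv ℝ h) 0 w v := fun v w =>
    (hh.isSymmSndFDerivAt
      (by simp only [minSmoothness_of_isRCLikeNormedField]; exact two_le_infty)).eq v w
  have hres := fderiv_fderiv_comp_resize hh hc0
  obtain ⟨u, hu⟩ := hn.surjective (crdL d d)
  have huu : ∀ w, fderiv ℝ (fderiv ℝ h) 0 u w = crd w d := fun w => by
    rw [hu, crdL_apply]
  -- If u_d were 0, then u would lie in the hyperplane and in the kernel of the restricted Hessian,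
  -- so u = 0, against H(u, e_d) = 1.
  have hu0 : crd u d ≠ 0 := by
    intro h0
    have h1 : resize d (resize (d - 1) u) = u := resize_resize_of_crd u fun i h2 h3 => by
      obtain rfl : i = d := by omega
      exact h0
    have h2 : resize (d - 1) u = 0 := hn' _ fun w => by
      rw [hres, h1, huu, crd_resize_pred]
    rw [h2, resize_zero] at h1
    have h3 := huu (bvec d d)
    rw [← h1, crd_bvec hd le_rfl, if_pos rfl] at h3
    simp at h3
  obtain ⟨W₀, W₀', hW₀⟩ := exists_isSplitting
    (toBilin (fderiv ℝ (fderiv ℝ (h ∘ (resize d : Euc (d - 1) → Euc d))) 0))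
    (fun v w => by rw [toBilin_apply, toBilin_apply, hres, hres, hsym])
    (fun v hv => hn' v hv)
  obtain ⟨W, W', hW, hdim⟩ := IsSplitting.of_hyperplane
    (B := toBilin (fderiv ℝ (fderiv ℝ h) 0)) hsym (resizeL (d - 1) d).toLinearMap
    (fun v w hvw => by
      have h1 : resize d v = resize d w := hvw
      rw [← resize_resize_of_le (Nat.sub_le d 1) v, h1, resize_resize_of_le (Nat.sub_le d 1)])
    (by rw [finrank_euclideanSpace_fin, finrank_euclideanSpace_fin]; omega)
    (u := u) (fun w => by
      rw [toBilin_apply, huu]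
      exact crd_resize_pred w)
    (by rwa [toBilin_apply, huu]) (W := W₀) (W' := W₀') (by
      have h1 : (fun v => toBilin (fderiv ℝ (fderiv ℝ h) 0) ((resizeL (d - 1) d).toLinearMap v)
          ((resizeL (d - 1) d).toLinearMap v)) =
          fun v => fderiv ℝ (fderiv ℝ (h ∘ (resize d : Euc (d - 1) → Euc d))) 0 v v := by
        ext v
        rw [hres]
        rfl
      rw [h1]
      exact hW₀)
  refine ⟨u, W, W', W₀, W₀', hu, hu0, hW, hW₀, ?_⟩
  rw [hdim, toBilin_apply, huu]

theorem exists_ball_splitting {h : Euc d → ℝ} (hh : ContDiffAt ℝ ∞ h 0)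
    {W W' : Submodule ℝ (Euc d)}
    (hW : IsSplitting (fun v => fderiv ℝ (fderiv ℝ h) 0 v v) W W') :
    ∃ r > 0, ∀ x ∈ Metric.ball (0 : Euc d) r,
      IsSplitting (fun v => fderiv ℝ (fderiv ℝ h) x v v) W W' := by
  have hc : ContinuousAt (fderiv ℝ (fderiv ℝ h)) 0 :=
    ((hh.fderiv_right (m := 1) (by rw [one_add_one_eq_two]; exact two_le_infty)).fderiv_right (m := 0)
      (by simp)).continuousAt
  exact Metric.mem_nhds_iff.1 (hc.eventually hW.eventually)

end Analysis

/-! ### Reflection of the last slice coordinate. -/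

section Flip

variable {m d : ℕ}

/-- The reflection `x_d ↦ -x_d`. -/
def flipL (m d : ℕ) : Euc m →L[ℝ] Euc m :=
  ContinuousLinearMap.id ℝ (Euc m) - (2 : ℝ) • (crdL m d).smulRight (bvec m d)

theorem crd_flipL (x : Euc m) {i : ℕ} (h1 : 1 ≤ i) (h2 : i ≤ m) :
    crd (flipL m d x) i = if i = d then -crd x i else crd x i := by
  have : flipL m d x = x - (2 * crd x d) • bvec m d := by
    simp [flipL, crdL_apply, smul_smul]
  rw [this, crd_sub, crd_smul, crd_bvec h1 h2]
  split_ifs with h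
  · rw [h]
    ring
  · ring

theorem flipL_flipL (x : Euc m) : flipL m d (flipL m d x) = x :=
  euc_ext fun i h1 h2 => by
    rw [crd_flipL _ h1 h2, crd_flipL _ h1 h2]
    split_ifs <;> simp

theorem flipL_resize (v : Euc d) : flipL m d (resize m v) = resize m (flipL d d v) :=
  euc_ext fun i h1 h2 => by
    rw [crd_flipL _ h1 h2, crd_resize _ h1 h2, crd_resize _ h1 h2]
    by_cases h3 : i ≤ d
    · rw [crd_flipL _ h1 h3]
    · rw [if_neg (by omega), crd_of_not (by omega), crd_of_not (by omega)]

theorem crd_flipL_self (x : Euc m) (hd : 1 ≤ d) (hdm : d ≤ m) :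
    crd (flipL m d x) d = -crd x d := by
  rw [crd_flipL _ hd hdm, if_pos rfl]

theorem inSlice_flipL (x : Euc m) : InSlice d (flipL m d x) ↔ InSlice d x := by
  refine forall_congr' fun i => forall_congr' fun h1 => forall_congr' fun h2 => ?_
  rw [crd_flipL _ (by omega) h2, if_neg (by omega)]

/-- The reflection `x_d ↦ -x_d` as a coordinate change. -/
def flipChart (m d : ℕ) : OpenPartialHomeomorph (Euc m) (Euc m) :=
  diffeoChart (flipL m d) (flipL m d) flipL_flipL flipL_flipL (flipL m d).contDiff
    (flipL m d).contDiff

variable {M : Type*} [TopologicalSpace M] [ChartedSpace (Euc m) M]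

theorem trans_flipChart_mem {Φ : OpenPartialHomeomorph M (Euc m)}
    (h : Φ ∈ IsManifold.maximalAtlas (𝓡 m) ∞ M) :
    Φ.trans (flipChart m d) ∈ IsManifold.maximalAtlas (𝓡 m) ∞ M :=
  trans_mem_maximalAtlas h (diffeoChart_mem _ _ _ _)

theorem trans_flipChart_source (Φ : OpenPartialHomeomorph M (Euc m)) :
    (Φ.trans (flipChart m d)).source = Φ.source := by
  simp [flipChart, diffeoChart]

theorem trans_flipChart_apply (Φ : OpenPartialHomeomorph M (Euc m)) (q : M) :
    (Φ.trans (flipChart m d)) q = flipL m d (Φ q) := rfl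

theorem localRep_flip (Φ : OpenPartialHomeomorph M (Euc m)) (g : M → ℝ) :
    localRep (Φ.trans (flipChart m d)) d g = localRep Φ d g ∘ flipL d d := by
  ext v
  change g (Φ.symm (flipL m d (resize m v))) = g (Φ.symm (resize m (flipL d d v)))
  rw [flipL_resize]

end Flip

/-! ### Boundary charts and correct Morse functions. -/

section Boundary

variable {m d : ℕ} {M : Type*} [TopologicalSpace M] [ChartedSpace (Euc m) M]
  {N B S : Set M} {Φ : OpenPartialHomeomorph M (Euc m)} {g : M → ℝ} {p : M}

theorem crdL_ne_zero (hd : 1 ≤ d) : crdL d d ≠ 0 := by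
  intro h
  have h1 := congrArg (fun L : Euc d →L[ℝ] ℝ => L (bvec d d)) h
  simp only [crdL_apply, _root_.zero_apply] at h1
  rw [crd_bvec hd le_rfl, if_pos rfl] at h1
  exact one_ne_zero h1

theorem deriv_nonpos_of_nonpos {φ : ℝ → ℝ} {y : ℝ} (h : HasDerivAt φ y 0) (h0 : φ 0 = 0)
    (hle : ∀ᶠ s in 𝓝[>] (0 : ℝ), φ s ≤ 0) : y ≤ 0 := by
  have h1 := (tendsto_div_of_hasDerivAt h h0).mono_left
    (nhdsWithin_mono (0 : ℝ) (fun s (hs : s ∈ Set.Ioi 0) => (ne_of_gt hs : s ≠ 0)))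
  refine le_of_tendsto h1 ?_
  filter_upwards [hle, self_mem_nhdsWithin] with s hs1 hs2
  exact div_nonpos_of_nonpos_of_nonneg hs1 (le_of_lt hs2)

/-- Whether the gradient points inwards can be read off from one boundary chart. -/
theorem pointsInward_iff (hg : ContMDiff (𝓡 m) 𝓘(ℝ, ℝ) ∞ g) (h : IsBoundaryChart N B d Φ)
    (hp : p ∈ Φ.source) (hB : p ∈ B) {δ : ℝ} (hδ : localDeriv Φ d g p = δ • crdL d d) :
    PointsInward m N B d g p ↔ δ < 0 := by
  have hd := h.one_le
  have hdm := h.dim_le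
  constructor
  · rintro ⟨-, Φ', h', hp', hin⟩
    have hneg := hin (bvec d d) (by rw [crd_bvec hd le_rfl, if_pos rfl]; exact one_pos)
    have hslice' := (h'.mem_bdry_iff p hp').1 hB
    have hslice := (h.mem_bdry_iff p hp).1 hB
    have hres' : resize m (resize d (Φ' p)) = Φ' p :=
      resize_resize_of_crd _ fun i h1 h2 => hslice' i h1.le h2
    have hres : resize m (resize d (Φ p)) = Φ p :=
      resize_resize_of_crd _ fun i h1 h2 => hslice i h1.le h2
    -- A curve that enters N in the chart `Φ'`; `y` is the same curve in `Φ`. Differentiating g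
    -- along it compares the two charts.
    let c : ℝ → Euc d := fun s => resize d (Φ' p) + s • -bvec d d
    have hc0 : c 0 = resize d (Φ' p) := by simp [c]
    have hc : HasDerivAt c (-bvec d d) 0 := by
      have h1 := ((hasDerivAt_id (0 : ℝ)).smul_const (-bvec d d)).const_add (resize d (Φ' p))
      rw [one_smul] at h1
      exact h1
    let y : ℝ → Euc m := fun s => Φ (Φ'.symm (resize m (c s)))
    have hsymm : Φ'.symm (resize m (c 0)) = p := by
      rw [hc0, hres', Φ'.left_inv hp']
    have hy0 : y 0 = Φ p := by simp only [y, hsymm]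
    obtain ⟨y', hy⟩ : ∃ y', HasDerivAt y y' 0 := by
      have h1 : DifferentiableAt ℝ (fun x => Φ (Φ'.symm x)) (resize m (c 0)) := by
        rw [hc0, hres']
        exact (contDiffAt_transition h'.mem_atlas h.mem_atlas (Φ'.map_source hp')
          (by rwa [Φ'.left_inv hp'])).differentiableAt (by simp)
      have h2 := h1.hasFDerivAt.comp_hasDerivAt 0
        ((resizeL d m).hasFDerivAt.comp_hasDerivAt 0 hc)
      exact ⟨_, h2⟩
    have hev : ∀ᶠ s in 𝓝 (0 : ℝ), resize m (c s) ∈ (Φ'.symm.trans Φ).source := by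
      have h1 : resize m (c 0) ∈ (Φ'.symm.trans Φ).source := by
        rw [hc0, hres']
        simp [hp, hp']
      exact ((contDiff_resize (n := 0)).continuous.continuousAt.comp hc.continuousAt).eventually
        ((Φ'.symm.trans Φ).open_source.mem_nhds h1)
    have hhalf : ∀ᶠ s in 𝓝[≥] (0 : ℝ), InSlice d (y s) ∧ crd (y s) d ≤ 0 ∧
        localRep Φ' d g (c s) = localRep Φ d g (resize d (y s)) := by
      filter_upwards [hev.filter_mono nhdsWithin_le_nhds, self_mem_nhdsWithin] with s hs1 hs2
      have hs2' : 0 ≤ s := hs2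
      have hs1' : resize m (c s) ∈ Φ'.target ∧ Φ'.symm (resize m (c s)) ∈ Φ.source := by
        have h5 : resize m (c s) ∈ (Φ'.symm.trans Φ).source := hs1
        simpa using h5
      have hN : Φ'.symm (resize m (c s)) ∈ N := by
        rw [h'.mem_iff _ (Φ'.map_target hs1'.1), Φ'.right_inv hs1'.1]
        refine ⟨fun i h1 h2 => ?_, ?_⟩
        · rw [crd_resize _ (by omega) h2, crd_of_not (by omega)]
        · rw [crd_resize _ hd hdm]
          simp only [c]
          rw [smul_neg, ← neg_smul, crd_add_smul_bvec _ _ hd le_rfl, if_pos rfl,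
            crd_resize _ hd le_rfl, hslice' d le_rfl hdm]
          linarith
      have hN' := (h.mem_iff _ hs1'.2).1 hN
      refine ⟨hN'.1, hN'.2, ?_⟩
      rw [localRep, localRep, resize_resize_of_crd _ hN'.1]
      rw [Φ.left_inv hs1'.2]
    have d1 : HasDerivAt (fun s => localRep Φ' d g (c s)) (localDeriv Φ' d g p (-bvec d d)) 0 := by
      have h1 : HasFDerivAt (localRep Φ' d g) (localDeriv Φ' d g p) (c 0) := by
        rw [hc0]
        exact ((contDiffAt_localRep h'.mem_atlas (by rw [hres']; exact Φ'.map_source hp')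
          hg.contMDiffAt).differentiableAt (by simp)).hasFDerivAt
      exact h1.comp_hasDerivAt 0 hc
    have d2 : HasDerivAt (fun s => localRep Φ d g (resize d (y s)))
        (localDeriv Φ d g p (resize d y')) 0 := by
      have h1 : HasFDerivAt (localRep Φ d g) (localDeriv Φ d g p) (resize d (y 0)) := by
        rw [hy0]
        exact ((contDiffAt_localRep h.mem_atlas (by rw [hres]; exact Φ.map_source hp)
          hg.contMDiffAt).differentiableAt (by simp)).hasFDerivAt
      exact h1.comp_hasDerivAt 0 ((resizeL m d).hasFDerivAt.comp_hasDerivAt 0 hy)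
    -- The charts are known to match only on N, that is for s ≥ 0, so the derivatives are identified
    -- as one-sided ones.
    have heq : localDeriv Φ' d g p (-bvec d d) = localDeriv Φ d g p (resize d y') := by
      have h1 := d1.hasDerivWithinAt (s := Set.Ici 0)
      have h2 := d2.hasDerivWithinAt (s := Set.Ici 0)
      have h3 := h1.congr_of_eventuallyEq (f₁ := fun s => localRep Φ d g (resize d (y s)))
        (by filter_upwards [hhalf] with s hs using hs.2.2.symm)
        (hhalf.self_of_nhdsWithin Set.self_mem_Ici).2.2.symm
      exact (uniqueDiffOn_Ici (0 : ℝ) 0 Set.self_mem_Ici).eq_deriv _ h3 h2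
    have hyd : crd y' d ≤ 0 := by
      have h1 := (hasFDerivAt_crd d (y 0)).comp_hasDerivAt 0 hy
      rw [crdL_apply] at h1
      refine deriv_nonpos_of_nonpos h1 ?_ ?_
      · simp only [Function.comp, hy0]
        exact hslice d le_rfl hdm
      · filter_upwards [hhalf.filter_mono (nhdsWithin_mono 0 Set.Ioi_subset_Ici_self)] with s hs
        exact hs.2.1
    rw [map_neg, hδ, smul_apply, crdL_apply, crd_resize _ hd le_rfl, smul_eq_mul] at heq
    by_contra hcon
    have : δ * crd y' d ≤ 0 := mul_nonpos_of_nonneg_of_nonpos (not_lt.1 hcon) hyd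
    linarith
  · intro hneg
    refine ⟨hB, Φ, h, hp, fun v hv => ?_⟩
    rw [hδ, smul_apply, crdL_apply, smul_eq_mul]
    exact mul_neg_of_neg_of_pos hneg hv

/-- On the open part x_d < 0 of the chart N coincides with the slice S, so critical points in the
interior of N are critical points on S and inherit their non-degeneracy. -/
theorem IsBoundaryChart.isCorrectMorseOn (hg : ContMDiff (𝓡 m) 𝓘(ℝ, ℝ) ∞ g)
    (h : IsBoundaryChart N B d Φ) (hS : IsSliceChart S d Φ) {U : Set M}
    (hUΦ : U ⊆ Φ.source) (hp : p ∈ Φ.source) (hcrit : ∀ q ∈ U, IsCritOn m S d g q →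
      IsNondegCritOn m S d g q) (hcritB : ∀ q ∈ U, IsCritOn m B (d - 1) g q → q = p)
    (hpB : IsNondegCritOn m B (d - 1) g p) (hne : localDeriv Φ d g p ≠ 0) :
    IsCorrectMorseOn m N B d U g ∧ IsCorrectCrit m N B d g p := by
  have hcorr : IsCorrectCrit m N B d g p := by
    obtain ⟨h1, Φ', h2, h3, h4, -⟩ := hpB
    exact ⟨⟨h1, Φ', h2, h3, h4⟩, Φ, h, hp, hne⟩
  have hopen : IsOpen (Φ.source ∩ Φ ⁻¹' {x | crd x d < 0}) :=
    Φ.isOpen_inter_preimage (isOpen_lt (continuous_crd d) continuous_const)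
  have hside : ∀ q ∈ Φ.source ∩ Φ ⁻¹' {x | crd x d < 0}, (q ∈ S ↔ q ∈ N) := by
    intro q hq
    rw [hS.mem_iff q hq.1, h.mem_iff q hq.1]
    exact ⟨fun h1 => ⟨h1, le_of_lt hq.2⟩, fun h1 => h1.1⟩
  have hmem : ∀ q ∈ U, q ∈ N → q ∉ B → q ∈ Φ.source ∩ Φ ⁻¹' {x | crd x d < 0} := by
    intro q hq hN hqB
    refine ⟨hUΦ hq, ?_⟩
    have h1 := (h.mem_iff q (hUΦ hq)).1 hN
    refine lt_of_le_of_ne h1.2 fun h0 => hqB ?_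
    rw [h.mem_bdry_iff q (hUΦ hq)]
    intro i h2 h3
    rcases h2.lt_or_eq with h4 | rfl
    · exact h1.1 i h4 h3
    · exact h0
  refine ⟨⟨hg.contMDiffOn, fun q hq _ => ⟨Φ, h, hUΦ hq⟩, fun q hq hN hqB => ?_,
    fun q hq hqB hc => ?_, fun q hq hc => ?_, fun q hq hc => ?_⟩, hcorr⟩
  · refine ⟨Φ.restr _, hS.restr hopen fun x hx _ => hside x hx, ?_⟩
    rw [OpenPartialHomeomorph.restr_source' _ _ hopen]
    exact ⟨hUΦ hq, hmem q hq hN hqB⟩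
  · have h1 := hmem q hq hc.1 hqB
    exact (hcrit q hq (hc.congr_set hopen h1 fun x hx => (hside x hx).symm)).congr_set hopen h1 hside
  · rw [hcritB q hq hc]
    exact hpB
  · rw [hcritB q hq hc]
    exact hcorr

end Boundary

/-! ### The Morse counts of the two halves. -/

section Contributions

variable {m d : ℕ} {M : Type*} [TopologicalSpace M] [ChartedSpace (Euc m) M]
  [IsManifold (𝓡 m) ∞ M] {P Q S B : Set M} {Φ : OpenPartialHomeomorph M (Euc m)} {g : M → ℝ} {p q : M}

theorem morseIndex_congr_set {S' U : Set M} (hU : IsOpen U) (hqU : q ∈ U)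
    (hS : ∀ x ∈ U, (x ∈ S ↔ x ∈ S')) : morseIndex m S d g q = morseIndex m S' d g q := by
  have key : ∀ {T T' : Set M}, (∀ x ∈ U, (x ∈ T ↔ x ∈ T')) → ∀ r,
      (∃ Φ : OpenPartialHomeomorph M (Euc m), IsSliceChart T d Φ ∧ q ∈ Φ.source ∧
        ∃ W : Submodule ℝ (Euc d), Module.finrank ℝ W = r ∧
          ∀ v ∈ W, v ≠ 0 → localHess Φ d g q v v < 0) →
      ∃ Φ : OpenPartialHomeomorph M (Euc m), IsSliceChart T' d Φ ∧ q ∈ Φ.source ∧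
        ∃ W : Submodule ℝ (Euc d), Module.finrank ℝ W = r ∧
          ∀ v ∈ W, v ≠ 0 → localHess Φ d g q v v < 0 := by
    rintro T T' hT r ⟨Φ, hΦ, hq, hW⟩
    refine ⟨Φ.restr U, hΦ.restr hU fun x hx _ => hT x hx, ?_, hW⟩
    rw [OpenPartialHomeomorph.restr_source' _ _ hU]
    exact ⟨hq, hqU⟩
  rw [morseIndex, morseIndex]
  congr 1
  ext r
  exact ⟨key hS r, key (fun x hx => (hS x hx).symm) r⟩

theorem AreSides.isBoundaryChart_right (hd : 1 ≤ d) (h : AreSides P Q d Φ)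
    (hB : IsSliceChart B (d - 1) Φ) (hdm : d ≤ m) : IsBoundaryChart (closure Q) B d Φ where
  one_le := hd
  dim_le := hdm
  mem_atlas := hB.mem_atlas
  mem_iff _ hq := h.mem_closure_right hd hdm hq
  mem_bdry_iff q hq := by
    rw [hB.mem_iff q hq]
    exact ⟨fun h i h1 h2 => h i (by omega) h2, fun h i h1 h2 => h i (by omega) h2⟩

theorem IsSliceChart.flip (h : IsSliceChart S d Φ) :
    IsSliceChart S d (Φ.trans (flipChart m d)) where
  dim_le := h.dim_le
  mem_atlas := trans_flipChart_mem h.mem_atlas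
  mem_iff q hq := by
    rw [trans_flipChart_source] at hq
    rw [trans_flipChart_apply]
    exact (h.mem_iff q hq).trans (inSlice_flipL (Φ q)).symm

/-- Boundary charts have N on the side x_d ≤ 0, so the half x_d ≥ 0 has to be reflected. -/
theorem AreSides.isBoundaryChart_left (hd : 1 ≤ d) (h : AreSides P Q d Φ)
    (hB : IsSliceChart B (d - 1) Φ) (hdm : d ≤ m) :
    IsBoundaryChart (closure P) B d (Φ.trans (flipChart m d)) where
  one_le := hd
  dim_le := hdm
  mem_atlas := trans_flipChart_mem hB.mem_atlas
  mem_iff q hq := by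
    rw [trans_flipChart_source] at hq
    rw [trans_flipChart_apply, h.mem_closure_left hd hdm hq, crd_flipL_self _ hd hdm,
      neg_nonpos]
    exact and_congr_left' (inSlice_flipL (Φ q)).symm
  mem_bdry_iff q hq := by
    rw [trans_flipChart_source] at hq
    rw [trans_flipChart_apply, hB.mem_iff q hq]
    refine ⟨fun h i h1 h2 => ?_, fun h i h1 h2 => ?_⟩
    · rw [crd_flipL _ (by omega) h2, h i (by omega) h2]
      simp
    · have h3 := h i (by omega) h2
      rw [crd_flipL _ (by omega) h2] at h3
      split_ifs at h3
      · exact neg_eq_zero.1 h3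
      · exact h3

theorem localDeriv_flip (h0 : Φ p = 0) {δ : ℝ} (hd : 1 ≤ d)
    (hg : DifferentiableAt ℝ (localRep Φ d g) 0)
    (hδ : localDeriv Φ d g p = δ • crdL d d) :
    localDeriv (Φ.trans (flipChart m d)) d g p = (-δ) • crdL d d := by
  rw [localDeriv, h0, resize_zero] at hδ
  rw [localDeriv, localRep_flip, trans_flipChart_apply, h0, map_zero, resize_zero, fderiv_comp,
    map_zero, hδ, (flipL d d).fderiv]
  · ext v
    change δ * crdL d d (flipL d d v) = -δ * crdL d d v
    rw [crdL_apply, crdL_apply, crd_flipL_self _ hd le_rfl]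
    ring
  · rwa [map_zero]
  · exact (flipL d d).differentiableAt

/-- If the derivative of `g` at the boundary point `p` is a positive multiple of `dx_d`, and `g` has
one further critical point `p'` on the slice whose index exceeds the one of `p` by one if `x_d > 0`
there and by zero if `x_d < 0`, then `p` and `p'` contribute equally on the two sides. -/
theorem AreSides.contributions_eq (hd : 1 ≤ d) (h : AreSides P Q d Φ)
    (hS : IsSliceChart S d Φ) (hB : IsSliceChart B (d - 1) Φ) (hg : ContMDiff (𝓡 m) 𝓘(ℝ, ℝ) ∞ g)
    (hp : p ∈ Φ.source) (h0 : Φ p = 0) {δ : ℝ} (hδ : 0 < δ)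
    (hgp : localDeriv Φ d g p = δ • crdL d d)
    (hcritB : ∀ x ∈ Φ.source, IsCritOn m B (d - 1) g x → x = p)
    (hpB : IsNondegCritOn m B (d - 1) g p) {p' : M} (hp' : p' ∈ Φ.source)
    (hcrit : IsNondegCritOn m S d g p') (huniq : ∀ x ∈ Φ.source, IsCritOn m S d g x → x = p')
    (hx : crd (Φ p') d ≠ 0)
    (hind : morseIndex m S d g p' =
      morseIndex m B (d - 1) g p + if 0 < crd (Φ p') d then 1 else 0) :
    IsCorrectMorseOn m (closure P) B d Φ.source g ∧
    IsCorrectMorseOn m (closure Q) B d Φ.source g ∧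
    IsCorrectCrit m (closure P) B d g p ∧ IsCorrectCrit m (closure Q) B d g p ∧ p' ∈ P ∪ Q ∧
    boundaryContribution m (closure P) B d g p + interiorContribution m P d g p' =
      boundaryContribution m (closure Q) B d g p + interiorContribution m Q d g p' := by
  have hdm := hS.dim_le
  have hR := h.isBoundaryChart_right hd hB hdm
  have hL := h.isBoundaryChart_left hd hB hdm
  have hpS : InSlice d (Φ p') := (hS.mem_iff p' hp').1 hcrit.1
  have hdiff : DifferentiableAt ℝ (localRep Φ d g) 0 :=
    (contDiffAt_localRep hS.mem_atlas (by rw [resize_zero, ← h0]; exact Φ.map_source hp)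
      hg.contMDiffAt).differentiableAt (by simp)
  have hgp' := localDeriv_flip h0 hd hdiff hgp
  have hsrc : (Φ.trans (flipChart m d)).source = Φ.source := trans_flipChart_source Φ
  have hnd : ∀ x ∈ Φ.source, IsCritOn m S d g x → IsNondegCritOn m S d g x := fun x hx hc => by
    rw [huniq x hx hc]
    exact hcrit
  have hne := crdL_ne_zero hd
  have hMR := hR.isCorrectMorseOn hg hS subset_rfl hp hnd hcritB hpB
    (by rw [hgp]; exact smul_ne_zero hδ.ne' hne)
  have hML := hL.isCorrectMorseOn (U := Φ.source) hg hS.flip hsrc.ge (by rwa [hsrc]) hnd hcritB hpB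
    (by rw [hgp']; exact smul_ne_zero (neg_ne_zero.2 hδ.ne') hne)
  have hiR : ¬ PointsInward m (closure Q) B d g p := by
    rw [pointsInward_iff hg hR hp hpB.1 hgp]
    exact hδ.not_gt
  have hiL : PointsInward m (closure P) B d g p := by
    rw [pointsInward_iff hg hL (by rwa [hsrc]) hpB.1 hgp']
    exact neg_lt_zero.2 hδ
  refine ⟨hML.1, hMR.1, hML.2, hMR.2, ?_, ?_⟩
  · rcases hx.lt_or_gt with h1 | h1
    · exact Or.inr ((h p' hp').2.2 ⟨hpS, h1⟩)
    · exact Or.inl ((h p' hp').1.2 ⟨hpS, h1⟩)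
  rw [boundaryContribution, boundaryContribution, if_pos hiL, if_neg hiR, interiorContribution,
    interiorContribution]
  -- If x_d < 0, the new point counts for Q with the sign that p has for P. If x_d > 0, it counts
  -- for P with the opposite sign and cancels p, and Q receives nothing.
  rcases hx.lt_or_gt with h1 | h1
  · have hPn : p' ∉ P := fun hP => h1.not_gt ((h p' hp').1.1 hP).2
    have hQ : p' ∈ Q := (h p' hp').2.2 ⟨hpS, h1⟩
    have hopen : IsOpen (Φ.source ∩ Φ ⁻¹' {x | crd x d < 0}) :=
      Φ.isOpen_inter_preimage (isOpen_lt (continuous_crd d) continuous_const)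
    have hidx : morseIndex m Q d g p' = morseIndex m S d g p' :=
      morseIndex_congr_set hopen ⟨hp', h1⟩ fun x hx => by
        rw [hS.mem_iff x hx.1, (h x hx.1).2]
        exact and_iff_left hx.2
    rw [if_neg hPn, if_pos hQ, hidx, hind, if_neg h1.not_gt, add_zero, add_zero, zero_add]
  · have hQn : p' ∉ Q := fun hQ => h1.not_gt ((h p' hp').2.1 hQ).2
    have hP : p' ∈ P := (h p' hp').1.2 ⟨hpS, h1⟩
    have hopen : IsOpen (Φ.source ∩ Φ ⁻¹' {x | 0 < crd x d}) :=
      Φ.isOpen_inter_preimage (isOpen_lt continuous_const (continuous_crd d))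
    have hidx : morseIndex m P d g p' = morseIndex m S d g p' :=
      morseIndex_congr_set hopen ⟨hp', h1⟩ fun x hx => by
        rw [hS.mem_iff x hx.1, (h x hx.1).1]
        exact and_iff_left hx.2
    rw [if_pos hP, if_neg hQn, hidx, hind, if_pos h1, pow_succ]
    ring

end Contributions

/-! ### Cut-off perturbations. -/

section Perturbation

variable {m d : ℕ} {M : Type*} [TopologicalSpace M] [ChartedSpace (Euc m) M]
  [IsManifold (𝓡 m) ∞ M] {P Q S B : Set M} {Φ : OpenPartialHomeomorph M (Euc m)} {g : M → ℝ}
  {p q : M}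

/-- For a small perturbation `h + ε κ` which is linear near `0`, there is only one critical
point. -/
theorem eq_of_fderiv_perturb_eq_zero {h κ : Euc d → ℝ} {R ρ c C ε : ℝ} (hc : 0 < c)
    (hanti : ∀ v ∈ Metric.ball (0 : Euc d) R, ∀ w ∈ Metric.ball (0 : Euc d) R,
      c * ‖v - w‖ ≤ ‖fderiv ℝ h v - fderiv ℝ h w‖)
    (hdh : ∀ v ∈ Metric.ball (0 : Euc d) R, DifferentiableAt ℝ h v)
    (hdκ : ∀ v ∈ Metric.ball (0 : Euc d) R, DifferentiableAt ℝ κ v)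
    (hC : ∀ v ∈ Metric.ball (0 : Euc d) R, ‖fderiv ℝ κ v‖ ≤ C)
    (hκ : ∀ v ∈ Metric.ball (0 : Euc d) ρ, fderiv ℝ κ v = crdL d d)
    (hc0 : fderiv ℝ h 0 = 0) (hρ : 0 < ρ) (hρR : ρ ≤ R) (hε : 0 < ε) (hε' : ε < c * ρ / (C + 1))
    {v w : Euc d} (hv : v ∈ Metric.ball (0 : Euc d) ρ) (hv' : fderiv ℝ h v = -ε • crdL d d)
    (hw : w ∈ Metric.ball (0 : Euc d) R) (hw' : fderiv ℝ (h + ε • κ) w = 0) : w = v := by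
  have hR : 0 < R := hρ.trans_le hρR
  rw [fderiv_add (hdh w hw) ((hdκ w hw).const_smul ε), fderiv_const_smul (hdκ w hw)] at hw'
  have hw2 : fderiv ℝ h w = -(ε • fderiv ℝ κ w) := eq_neg_of_add_eq_zero_left hw'
  have hC0 : 0 ≤ C := (norm_nonneg _).trans (hC w hw)
  -- Outside the ρ-ball the cut-off is not controlled exactly, but there ‖Dh‖ ≥ cρ, while ε‖Dκ‖ ≤ εC
  -- < cρ by the choice of ε.
  have hwρ : w ∈ Metric.ball (0 : Euc d) ρ := by
    by_contra hcon
    rw [mem_ball_zero_iff, not_lt] at hcon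
    have h1 := hanti w hw 0 (Metric.mem_ball_self hR)
    rw [hc0, sub_zero, sub_zero, hw2, norm_neg, norm_smul, Real.norm_of_nonneg hε.le] at h1
    have h2 : c * ρ ≤ c * ‖w‖ := by gcongr
    have h3 : ε * ‖fderiv ℝ κ w‖ ≤ ε * C := by gcongr; exact hC w hw
    have h4 : ε * (C + 1) < c * ρ := by rwa [lt_div_iff₀ (by linarith)] at hε'
    nlinarith
  rw [hκ w hwρ, ← neg_smul] at hw2
  have h1 := hanti w hw v (Metric.ball_subset_ball hρR hv)
  rw [hw2, hv', sub_self, norm_zero] at h1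
  have h2 : ‖w - v‖ ≤ 0 := by
    by_contra hcon
    exact h1.not_gt (mul_pos hc (not_le.1 hcon))
  exact sub_eq_zero.1 (norm_le_zero_iff.1 h2)

theorem localRep_pred (Φ : OpenPartialHomeomorph M (Euc m)) (g : M → ℝ) :
    localRep Φ (d - 1) g = localRep Φ d g ∘ (resize d : Euc (d - 1) → Euc d) := by
  ext v
  change g (Φ.symm (resize m v)) = g (Φ.symm (resize m (resize d v)))
  rw [resize_resize_trans (by omega)]

/-- The coordinate is smooth only on the chart domain; the support of χ lies inside it. -/
theorem contMDiff_mul_crd [T2Space M] (hΦ : Φ ∈ IsManifold.maximalAtlas (𝓡 m) ∞ M) {χ : M → ℝ}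
    (hχ : ContMDiff (𝓡 m) 𝓘(ℝ, ℝ) ∞ χ) (hsupp : tsupport χ ⊆ Φ.source) (i : ℕ) :
    ContMDiff (𝓡 m) 𝓘(ℝ, ℝ) ∞ (fun q => χ q * crd (Φ q) i) := by
  refine contMDiff_of_tsupport fun q hq => ?_
  have hq' : q ∈ Φ.source := hsupp (tsupport_mul_subset_left hq)
  have h1 : ContMDiffAt (𝓡 m) (𝓡 m) ∞ Φ q := contMDiffAt_of_mem_maximalAtlas hΦ hq'
  have h2 : ContMDiffAt (𝓡 m) 𝓘(ℝ, ℝ) ∞ (fun q => crd (Φ q) i) q :=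
    (contDiff_crd i).contMDiff.contMDiffAt.comp q h1
  exact hχ.contMDiffAt.mul h2

/-- A perturbation by a multiple of `x_d` does not change the function on the slice `x_d = 0`. -/
theorem localRep_perturb_pred (χ : M → ℝ) (ε : ℝ) (hdm : d ≤ m) {v : Euc (d - 1)}
    (hv : resize m v ∈ Φ.target) :
    localRep Φ (d - 1) (fun q => g q + ε * (χ q * crd (Φ q) d)) =ᶠ[𝓝 v]
      localRep Φ (d - 1) g := by
  have h1 : ∀ᶠ w in 𝓝 v, resize m w ∈ Φ.target :=
    (contDiff_resize (n := 0)).continuous.continuousAt.eventually (Φ.open_target.mem_nhds hv)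
  filter_upwards [h1] with w hw
  have h2 : crd (resize m w) d = 0 := by
    by_cases hd : 1 ≤ d
    · rw [crd_resize _ hd hdm, crd_of_not (by omega)]
    · exact crd_of_not (by omega) _
  simp only [localRep]
  rw [Φ.right_inv hw, h2, mul_zero, mul_zero, add_zero]

theorem localRep_perturb {χ : M → ℝ} {V : Set M} (hV : IsOpen V) (hχ : ∀ q ∈ V, χ q = 1)
    (hd : 1 ≤ d) (hdm : d ≤ m) {v : Euc d} (hv : resize m v ∈ Φ.target)
    (hvV : Φ.symm (resize m v) ∈ V) :
    localRep Φ d (fun q => χ q * crd (Φ q) d) =ᶠ[𝓝 v] crdL d d := by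
  have h1 : ∀ᶠ w in 𝓝 v, resize m w ∈ Φ.target ∩ Φ.symm ⁻¹' V :=
    (contDiff_resize (n := 0)).continuous.continuousAt.eventually
      ((Φ.symm.isOpen_inter_preimage hV).mem_nhds ⟨hv, hvV⟩)
  filter_upwards [h1] with w hw
  simp only [localRep]
  rw [hχ _ hw.2, Φ.right_inv hw.1, one_mul, crd_resize _ hd hdm, crdL_apply]

end Perturbation

/-! ### The local perturbation theorem. -/

section Main

variable {m d : ℕ} {M : Type*} [TopologicalSpace M] [ChartedSpace (Euc m) M]
  [IsManifold (𝓡 m) ∞ M] {P Q S B : Set M} {Φ : OpenPartialHomeomorph M (Euc m)} {g : M → ℝ}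
  {p q : M}

theorem fderiv_perturb {h κ : Euc d → ℝ} {v : Euc d} {ε : ℝ} (hh : ContDiffAt ℝ ∞ h v)
    (hκ : κ =ᶠ[𝓝 v] crdL d d) :
    fderiv ℝ (h + ε • κ) =ᶠ[𝓝 v] fun w => fderiv ℝ h w + ε • crdL d d := by
  have h1 : ∀ᶠ w in 𝓝 v, ContDiffAt ℝ 1 h w :=
    (hh.of_le (ENat.LEInfty.out : (1 : WithTop ℕ∞) ≤ ∞)).eventually (by simp)
  filter_upwards [h1, hκ.eventuallyEq_nhds] with w hw1 hw2
  have h2 : h + ε • κ =ᶠ[𝓝 w] h + ε • (crdL d d : Euc d → ℝ) := by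
    filter_upwards [hw2] with x hx
    simp [hx]
  rw [h2.fderiv_eq, fderiv_add (hw1.differentiableAt (by simp))
    ((crdL d d).differentiableAt.const_smul ε), fderiv_const_smul (crdL d d).differentiableAt,
    (crdL d d).fderiv]

theorem fderiv_perturb_self {h κ : Euc d → ℝ} {v : Euc d} {ε : ℝ} (hh : ContDiffAt ℝ ∞ h v)
    (hκ : κ =ᶠ[𝓝 v] crdL d d) : fderiv ℝ (h + ε • κ) v = fderiv ℝ h v + ε • crdL d d :=
  (fderiv_perturb hh hκ).self_of_nhds

theorem fderiv_fderiv_perturb {h κ : Euc d → ℝ} {v : Euc d} {ε : ℝ} (hh : ContDiffAt ℝ ∞ h v)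
    (hκ : κ =ᶠ[𝓝 v] crdL d d) :
    fderiv ℝ (fderiv ℝ (h + ε • κ)) v = fderiv ℝ (fderiv ℝ h) v := by
  rw [(fderiv_perturb hh hκ).fderiv_eq, fderiv_add_const]

/-- Perturbation of a non-degenerate critical point on the boundary. -/
theorem exists_perturbation [T2Space M] (hd : 1 ≤ d) (hS : IsSliceChart S d Φ)
    (hB : IsSliceChart B (d - 1) Φ) (hg : ContMDiff (𝓡 m) 𝓘(ℝ, ℝ) ∞ g) (hp : p ∈ Φ.source)
    (h0 : Φ p = 0) (hpS : IsNondegCritOn m S d g p) (hpB : IsNondegCritOn m B (d - 1) g p)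
    {W : Set M} (hWo : IsOpen W) (hpW : p ∈ W) (hPQ : AreSides P Q d (Φ.restr W))
    {O : Set M} (hO : O ∈ 𝓝 p) :
    ∃ U V : Set M, IsOpen U ∧ IsOpen V ∧ p ∈ V ∧ V ⊆ U ∧ U ⊆ O ∧ U ⊆ Φ.source ∧
    ∃ χ : M → ℝ, ContMDiff (𝓡 m) 𝓘(ℝ, ℝ) ∞ χ ∧ tsupport χ ⊆ U ∧ (∀ q ∈ V, χ q = 1) ∧
    ∃ ε₀ : ℝ, 0 < ε₀ ∧ ∀ ε : ℝ, 0 < ε → ε < ε₀ →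
    ∀ G : M → ℝ, G = (fun q => g q + ε * (χ q * crd (Φ q) d)) →
      ContMDiff (𝓡 m) 𝓘(ℝ, ℝ) ∞ G ∧
      IsCorrectMorseOn m (closure P) B d U G ∧ IsCorrectMorseOn m (closure Q) B d U G ∧
      IsCorrectCrit m (closure P) B d G p ∧ IsCorrectCrit m (closure Q) B d G p ∧
      ∃ p' ∈ V, IsNondegCritOn m S d G p' ∧ (∀ q ∈ U, IsCritOn m S d G q → q = p') ∧
        ¬ IsCritOn m S d g p' ∧ p' ∈ P ∪ Q ∧
        boundaryContribution m (closure P) B d G p + interiorContribution m P d G p' =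
          boundaryContribution m (closure Q) B d G p + interiorContribution m Q d G p' := by
  have hdm := hS.dim_le
  have ht0 : (0 : Euc m) ∈ Φ.target := by rw [← h0]; exact Φ.map_source hp
  have hsymm0 : Φ.symm 0 = p := by rw [← h0, Φ.left_inv hp]
  set h := localRep Φ d g with hdef
  have hsm : ∀ v : Euc d, resize m v ∈ Φ.target → ContDiffAt ℝ ∞ h v := fun v hv =>
    contDiffAt_localRep hS.mem_atlas hv hg.contMDiffAt
  have hh : ContDiffAt ℝ ∞ h 0 := hsm 0 (by rwa [resize_zero])
  obtain ⟨hmS, hc0, hn⟩ := (isNondegCritOn_iff hg hS hp).1 hpS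
  obtain ⟨hmB, hc0', hn'⟩ := (isNondegCritOn_iff hg hB hp).1 hpB
  rw [localDeriv, h0, resize_zero] at hc0 hc0'
  simp only [localHess, h0, resize_zero] at hn hn'
  rw [← hdef] at hc0 hn
  have hh' : ContDiffAt ℝ ∞ (h ∘ (resize d : Euc (d - 1) → Euc d)) 0 := by
    rw [hdef, ← localRep_pred]
    exact contDiffAt_localRep hS.mem_atlas (by rwa [resize_zero]) hg.contMDiffAt
  rw [localRep_pred, ← hdef] at hc0' hn'
  obtain ⟨u, X, X', X₀, X₀', hu, hu0, hX, hX₀, hfin⟩ := exists_splitting hd hh hn hc0 hn'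
  obtain ⟨c, hc, r₁, hr₁, hanti⟩ := exists_ball_antilipschitz hh hn
  obtain ⟨c', hc', r₂, hr₂, hanti'⟩ := exists_ball_antilipschitz hh' hn'
  obtain ⟨r₃, hr₃, hsign⟩ := exists_ball_sign hh hn hc0 hu hu0
  obtain ⟨r₄, hr₄, hsplit⟩ := exists_ball_splitting hh hX
  have hnhds : Φ.target ∩ Φ.symm ⁻¹' (interior O ∩ W) ∈ 𝓝 (0 : Euc m) :=
    (Φ.symm.isOpen_inter_preimage (isOpen_interior.inter hWo)).mem_nhds
      ⟨ht0, by rw [Set.mem_preimage, hsymm0]; exact ⟨mem_interior_iff_mem_nhds.2 hO, hpW⟩⟩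
  obtain ⟨r₅, hr₅, hball⟩ := Metric.mem_nhds_iff.1 hnhds
  -- The radii serve, in order, the uniqueness on S, the uniqueness on B, the sign of x_d, the
  -- constancy of the index, and the inclusion in O ∩ W and the chart. Strictness of the last keeps
  -- the closed R-ball in the chart, where compactness will bound Dκ.
  obtain ⟨R, hR, hR₁, hR₂, hR₃, hR₄, hR₅⟩ :
      ∃ R : ℝ, 0 < R ∧ R ≤ r₁ ∧ R ≤ r₂ ∧ R ≤ r₃ ∧ R ≤ r₄ ∧ R < r₅ := by
    have hmin : 0 < min r₁ (min r₂ (min r₃ (min r₄ r₅))) := by positivity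
    refine ⟨min r₁ (min r₂ (min r₃ (min r₄ r₅))) / 2, by positivity, ?_⟩
    have hle := le_refl (min r₁ (min r₂ (min r₃ (min r₄ r₅))))
    simp only [le_min_iff] at hle
    obtain ⟨h1, h2, h3, h4, h5⟩ := hle
    exact ⟨by linarith, by linarith, by linarith, by linarith, by linarith⟩
  have htarget : ∀ v : Euc d, ‖v‖ ≤ R → resize m v ∈ Φ.target := fun v hv =>
    (hball (by rw [mem_ball_zero_iff, norm_resize_of_le hdm]; linarith)).1
  let U : Set M := Φ.source ∩ Φ ⁻¹' Metric.ball 0 R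
  have hUo : IsOpen U := Φ.isOpen_inter_preimage Metric.isOpen_ball
  have hpU : p ∈ U := ⟨hp, by rw [Set.mem_preimage, h0]; exact Metric.mem_ball_self hR⟩
  have hUOW : ∀ x ∈ U, x ∈ O ∧ x ∈ W := fun x hx => by
    have h1 := (hball (Metric.ball_subset_ball hR₅.le hx.2)).2
    rw [Set.mem_preimage, Φ.left_inv hx.1] at h1
    exact ⟨interior_subset h1.1, h1.2⟩
  obtain ⟨χ, -, hχU⟩ := (SmoothBumpFunction.nhds_basis_tsupport (I := 𝓡 m) p).mem_iff.1
    (hUo.mem_nhds hpU)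
  obtain ⟨V₀, hV₀, hV₀o, hpV₀⟩ := mem_nhds_iff.1 χ.eventuallyEq_one
  have hχV : ∀ x ∈ V₀ ∩ U, χ x = 1 := fun x hx => hV₀ hx.1
  have hVo : IsOpen (V₀ ∩ U) := hV₀o.inter hUo
  have hnhdsV : Φ.target ∩ Φ.symm ⁻¹' (V₀ ∩ U) ∈ 𝓝 (0 : Euc m) :=
    (Φ.symm.isOpen_inter_preimage hVo).mem_nhds
      ⟨ht0, by rw [Set.mem_preimage, hsymm0]; exact ⟨hpV₀, hpU⟩⟩
  obtain ⟨ρ₀, hρ₀, hballV⟩ := Metric.mem_nhds_iff.1 hnhdsV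
  obtain ⟨ρ, hρ, hρR, hρρ₀⟩ : ∃ ρ : ℝ, 0 < ρ ∧ ρ ≤ R ∧ ρ ≤ ρ₀ :=
    ⟨min R ρ₀, by positivity, min_le_left _ _, min_le_right _ _⟩
  have hsmκ : ContMDiff (𝓡 m) 𝓘(ℝ, ℝ) ∞ (fun q => χ q * crd (Φ q) d) :=
    contMDiff_mul_crd hS.mem_atlas χ.contMDiff (hχU.trans Set.inter_subset_left) d
  set κ := localRep Φ d (fun q => χ q * crd (Φ q) d) with κdef
  have hκsm : ∀ v : Euc d, ‖v‖ ≤ R → ContDiffAt ℝ ∞ κ v := fun v hv =>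
    contDiffAt_localRep hS.mem_atlas (htarget v hv) hsmκ.contMDiffAt
  obtain ⟨C, hC⟩ := (isCompact_closedBall (0 : Euc d) R).exists_bound_of_continuousOn
    (f := fderiv ℝ κ) fun v hv =>
      ((hκsm v (mem_closedBall_zero_iff.1 hv)).fderiv_right (m := 0)
        (by simp)).continuousAt.continuousWithinAt
  have hC0 : 0 ≤ C := (norm_nonneg _).trans (hC 0 (Metric.mem_closedBall_self hR.le))
  have hκeq : ∀ v ∈ Metric.ball (0 : Euc d) ρ, κ =ᶠ[𝓝 v] crdL d d := fun v hv => by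
    have h1 := @hballV (resize m v) (by
      rw [mem_ball_zero_iff, norm_resize_of_le hdm]
      exact (mem_ball_zero_iff.1 hv).trans_le hρρ₀)
    exact localRep_perturb hVo hχV hd hdm h1.1 h1.2
  -- The solution is sought in the ρ-ball, where χ = 1 and the perturbation is exactly linear; so
  -- the new point will lie in V.
  obtain ⟨ε₁, hε₁, hsol⟩ := exists_solution hh hn hc0 hρ
  refine ⟨U, V₀ ∩ U, hUo, hVo, ⟨hpV₀, hpU⟩, Set.inter_subset_right, fun x hx => (hUOW x hx).1,
    Set.inter_subset_left, χ, χ.contMDiff, hχU, hχV, min ε₁ (c * ρ / (C + 1)),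
    lt_min hε₁ (by positivity), ?_⟩
  intro ε hε hεlt G hGdef
  obtain ⟨v, hv, hveq⟩ := hsol ε hε (hεlt.trans_le (min_le_left _ _))
  have hG : ContMDiff (𝓡 m) 𝓘(ℝ, ℝ) ∞ G := by
    rw [hGdef]
    exact hg.add (contMDiff_const.mul hsmκ)
  have hGrep : localRep Φ d G = h + ε • κ := by
    rw [hGdef]
    rfl
  have hvR : v ∈ Metric.ball (0 : Euc d) R := Metric.ball_subset_ball hρR hv
  have hvt : resize m v ∈ Φ.target := htarget v (mem_ball_zero_iff.1 hvR).le
  let p' : M := Φ.symm (resize m v)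
  have hp's : p' ∈ Φ.source := Φ.map_target hvt
  have hΦp' : Φ p' = resize m v := Φ.right_inv hvt
  have hΦp'd : resize d (Φ p') = v := by rw [hΦp', resize_resize_of_le hdm]
  have hp'V : p' ∈ V₀ ∩ U := (hballV (by
    rw [mem_ball_zero_iff, norm_resize_of_le hdm]
    exact (mem_ball_zero_iff.1 hv).trans_le hρρ₀)).2
  have hp'S : p' ∈ S := hS.symm_mem hvt
  have hcrdp' : crd (Φ p') d = crd v d := by rw [hΦp', crd_resize _ hd hdm]
  have hD1 : localDeriv Φ d G p' = 0 := by
    rw [localDeriv, hΦp'd, hGrep, fderiv_perturb_self (hsm v hvt) (hκeq v hv), hveq]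
    ext w
    change -ε * crdL d d w + ε * crdL d d w = 0
    ring
  have hHess : localHess Φ d G p' = fderiv ℝ (fderiv ℝ h) v := by
    rw [localHess, hΦp'd, hGrep, fderiv_fderiv_perturb (hsm v hvt) (hκeq v hv)]
  have hXv : IsSplitting (fun w => localHess Φ d G p' w w) X X' := by
    rw [hHess]
    exact hsplit v (Metric.ball_subset_ball hR₄ hvR)
  have hnd : IsNondegCritOn m S d G p' := by
    rw [isNondegCritOn_iff hG hS hp's]
    exact ⟨hp'S, hD1, fun w hw => IsSplitting.eq_zero (B := toBilin (localHess Φ d G p')) hXv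
      (fun x y => localHess_symm hG hS hp's hp'S x y) hw⟩
  have hnorm : ∀ {e : ℕ}, e ≤ m → ∀ x : Euc m, resize m (resize e x) = x →
      ‖resize e x‖ = ‖x‖ := fun he x hx => by
    rw [← norm_resize_of_le he, hx]
  have huniq : ∀ x ∈ U, IsCritOn m S d G x → x = p' := by
    intro x hx hcx
    obtain ⟨hxS, hxd⟩ := (isCritOn_iff hG hS hx.1).1 hcx
    have hres := hS.resize_resize hx.1 hxS
    rw [localDeriv, hGrep] at hxd
    have h1 : resize d (Φ x) = v := by
      refine eq_of_fderiv_perturb_eq_zero hc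
        (fun a ha b hb => hanti a (Metric.ball_subset_ball hR₁ ha) b
          (Metric.ball_subset_ball hR₁ hb))
        (fun a ha => (hsm a (htarget a (mem_ball_zero_iff.1 ha).le)).differentiableAt (by simp))
        (fun a ha => (hκsm a (mem_ball_zero_iff.1 ha).le).differentiableAt (by simp))
        (fun a ha => hC a (Metric.ball_subset_closedBall ha))
        (fun a ha => ?_) hc0 hρ hρR hε (hεlt.trans_le (min_le_right _ _)) hv hveq ?_ hxd
      · rw [(hκeq a ha).fderiv_eq, (crdL d d).fderiv]
      · rw [mem_ball_zero_iff, hnorm hdm _ hres]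
        exact mem_ball_zero_iff.1 hx.2
    rw [← Φ.left_inv hx.1, ← hres, h1]
  have hncrit : ¬ IsCritOn m S d g p' := by
    rw [isCritOn_iff hg hS hp's, localDeriv, hΦp'd]
    rintro ⟨-, h1⟩
    rw [hveq] at h1
    exact smul_ne_zero (neg_ne_zero.2 hε.ne') (crdL_ne_zero hd) h1
  -- The added term contains the factor x_d, so derivative, Hessian and critical points on B are
  -- those of g.
  have hGpred : ∀ x ∈ Φ.source, x ∈ B →
      localRep Φ (d - 1) G =ᶠ[𝓝 (resize (d - 1) (Φ x))] localRep Φ (d - 1) g := by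
    intro x hx hxB
    rw [hGdef]
    refine localRep_perturb_pred _ _ hdm ?_
    rw [hB.resize_resize hx hxB]
    exact Φ.map_source hx
  have hHessB : localHess Φ (d - 1) G p =
      fderiv ℝ (fderiv ℝ (h ∘ (resize d : Euc (d - 1) → Euc d))) 0 := by
    rw [localHess, (hGpred p hp hmB).fderiv.fderiv_eq, h0, resize_zero, localRep_pred]
  have hD1B : localDeriv Φ (d - 1) G p = 0 := by
    rw [localDeriv, (hGpred p hp hmB).fderiv_eq, h0, resize_zero, localRep_pred, hc0']
  have hpBG : IsNondegCritOn m B (d - 1) G p := by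
    rw [isNondegCritOn_iff hG hB hp]
    refine ⟨hmB, hD1B, ?_⟩
    rw [hHessB]
    exact hn'
  have hcritB : ∀ x ∈ U, IsCritOn m B (d - 1) G x → x = p := by
    intro x hx hcx
    obtain ⟨hxB, hxd⟩ := (isCritOn_iff hG hB hx.1).1 hcx
    have hres := hB.resize_resize hx.1 hxB
    rw [localDeriv, (hGpred x hx.1 hxB).fderiv_eq, localRep_pred] at hxd
    have hmem : resize (d - 1) (Φ x) ∈ Metric.ball (0 : Euc (d - 1)) r₂ := by
      rw [mem_ball_zero_iff, hnorm hB.dim_le _ hres]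
      exact (mem_ball_zero_iff.1 hx.2).trans_le hR₂
    have h1 := hanti' _ hmem 0 (Metric.mem_ball_self hr₂)
    rw [hxd, hc0', sub_zero, sub_zero, norm_zero] at h1
    have h2 : resize (d - 1) (Φ x) = 0 := by
      by_contra hne
      exact h1.not_gt (mul_pos hc' (norm_pos_iff.2 hne))
    rw [h2, resize_zero] at hres
    rw [← Φ.left_inv hx.1, ← hres, hsymm0]
  have hsgn := hsign v (Metric.ball_subset_ball hR₃ hvR) ε hε hveq
  -- The index of H exceeds that of H₀ by one if u_d < 0, which by `hsgn` means that the new point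
  -- has x_d > 0.
  have hind : morseIndex m S d G p' =
      morseIndex m B (d - 1) G p + if 0 < crd (Φ p') d then 1 else 0 := by
    rw [morseIndex_eq_of_isSplitting hG hS hp's hp'S hD1 hXv,
      morseIndex_eq_of_isSplitting hG hB hp hmB hD1B (W := X₀) (W' := X₀')
        (by rw [hHessB]; exact hX₀), hfin, hcrdp']
    congr 1
    refine if_congr ?_ rfl rfl
    constructor <;> intro h1
    · exact pos_of_mul_neg_left hsgn h1.le
    · exact neg_of_mul_neg_right hsgn h1.le
  have hGp : localDeriv Φ d G p = ε • crdL d d := by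
    have h1 : (0 : Euc d) ∈ Metric.ball (0 : Euc d) ρ := Metric.mem_ball_self hρ
    rw [localDeriv, h0, resize_zero, hGrep, fderiv_perturb_self hh (hκeq 0 h1), hc0,
      zero_add]
  have hsrc : (Φ.restr U).source = U := by
    rw [OpenPartialHomeomorph.restr_source' _ _ hUo]
    exact Set.inter_eq_right.2 Set.inter_subset_left
  have hsides : AreSides P Q d (Φ.restr U) := fun x hx => by
    rw [hsrc] at hx
    refine hPQ x ?_
    rw [OpenPartialHomeomorph.restr_source' _ _ hWo]
    exact ⟨hx.1, (hUOW x hx).2⟩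
  have hfinal := hsides.contributions_eq hd (hS.restr hUo fun _ _ _ => Iff.rfl)
    (hB.restr hUo fun _ _ _ => Iff.rfl) hG (by rwa [hsrc]) h0 hε hGp (by rwa [hsrc]) hpBG
    (p' := p') (by rw [hsrc]; exact hp'V.2) hnd (by rwa [hsrc])
    (fun hz => by
      have hz' : crd (Φ p') d = 0 := hz
      rw [← hcrdp', hz', zero_mul] at hsgn
      exact lt_irrefl _ hsgn) hind
  rw [hsrc] at hfinal
  obtain ⟨f1, f2, f3, f4, f5, f6⟩ := hfinal
  exact ⟨hG, f1, f2, f3, f4, p', hp'V, hnd, huniq, hncrit, f5, f6⟩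

end Main

end MorinPerturbation

end

/-! ### The theorem for Morin maps. -/

open MorinPerturbation in
theorem mainTheorem2 {m n : ℕ} (hnm : n < m) (hodd : Odd (m - n))
    {M : Type*} [TopologicalSpace M] [ChartedSpace (Euc m) M] [IsManifold (𝓡 m) ∞ M]
    [CompactSpace M] [T2Space M]
    (f : M → Euc n) (hf : IsMorinMap m f)
    (a : Euc n) (ha : IsGenericForm m f a)
    (k : ℕ) (hk : Odd k) (hkn : k + 1 ≤ n)
    (p : M) (hp : p ∈ morinSet m f (k + 1))
    (hcrit : IsCritOn m (closure (morinSet m f (k + 1))) (n - (k + 1))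
      (fun q => linForm a (f q)) p)
    (hnoncorrect : IsCritOn m (closure (morinSet m f k)) (n - k)
      (fun q => linForm a (f q)) p) :
    (∃ Φ : OpenPartialHomeomorph M (Euc m), IsAdaptedChart f k p Φ) ∧
    ∀ Φ : OpenPartialHomeomorph M (Euc m), IsAdaptedChart f k p Φ →
    ∀ O ∈ 𝓝 p, ∃ U V : Set M, IsOpen U ∧ IsOpen V ∧ p ∈ V ∧ V ⊆ U ∧ U ⊆ O ∧ U ⊆ Φ.source ∧
    ∃ χ : M → ℝ, ContMDiff (𝓡 m) 𝓘(ℝ, ℝ) ∞ χ ∧ tsupport χ ⊆ U ∧ (∀ q ∈ V, χ q = 1) ∧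
    ∃ ε₀ : ℝ, 0 < ε₀ ∧ ∀ ε : ℝ, 0 < ε → ε < ε₀ →
      ContMDiff (𝓡 m) 𝓘(ℝ, ℝ) ∞ (perturbed f a k Φ χ ε) ∧
      -- 1. a correct Morse function near `p`, with `p` still critical (and now correct)
      IsCorrectMorseOn m (closure (morinSetPos m f k))
        (closure (morinSet m f (k + 1))) (n - k) U (perturbed f a k Φ χ ε) ∧
      IsCorrectMorseOn m (closure (morinSetNeg m f k))
        (closure (morinSet m f (k + 1))) (n - k) U (perturbed f a k Φ χ ε) ∧
      IsCorrectCrit m (closure (morinSetPos m f k))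
        (closure (morinSet m f (k + 1))) (n - k) (perturbed f a k Φ χ ε) p ∧
      IsCorrectCrit m (closure (morinSetNeg m f k))
        (closure (morinSet m f (k + 1))) (n - k) (perturbed f a k Φ χ ε) p ∧
      ∃ p' ∈ V,
        -- 2. the unique new critical point
        IsNondegCritOn m (closure (morinSet m f k)) (n - k)
          (perturbed f a k Φ χ ε) p' ∧
        (∀ q ∈ U, IsCritOn m (closure (morinSet m f k)) (n - k)
          (perturbed f a k Φ χ ε) q → q = p') ∧
        ¬ IsCritOn m (closure (morinSet m f k)) (n - k)
          (fun q => linForm a (f q)) p' ∧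
        p' ∈ morinSetPos m f k ∪ morinSetNeg m f k ∧
        -- 3. the contributions to `χ(closure A_k^+) - χ(closure A_k^-)` cancel
        (boundaryContribution m (closure (morinSetPos m f k))
            (closure (morinSet m f (k + 1))) (n - k) (perturbed f a k Φ χ ε) p
          + interiorContribution m (morinSetPos m f k) (n - k)
            (perturbed f a k Φ χ ε) p')
        - (boundaryContribution m (closure (morinSetNeg m f k))
            (closure (morinSet m f (k + 1))) (n - k) (perturbed f a k Φ χ ε) p
          + interiorContribution m (morinSetNeg m f k) (n - k)
            (perturbed f a k Φ χ ε) p') = 0 := by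
  obtain ⟨Φ₁, hp₁, h0₁, hΦ₁, hB₁, hs₁⟩ := exists_chart_of_mem_morinSet hodd hf hk hp
  have had₁ := isAdaptedChart_of_sides hkn hnm.le hp₁ h0₁ hΦ₁ hB₁ hs₁
  have hd : 1 ≤ n - k := by omega
  have hdm : n - k ≤ m := by omega
  have hg : ContMDiff (𝓡 m) 𝓘(ℝ, ℝ) ∞ (fun q => linForm a (f q)) := by
    have h1 : ContDiff ℝ ∞ (fun x : Euc n => linForm a x) := by
      unfold linForm
      fun_prop
    exact h1.contMDiff.comp hf.1
  -- Genericity of the linear form turns both critical points at p into non-degenerate ones.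
  have hpS := ha.morse_closure k hk.pos (by omega) p hnoncorrect
  have hpB := ha.morse_closure (k + 1) (by omega) hkn p hcrit
  refine ⟨⟨Φ₁, had₁⟩, fun Φ had O hO => ?_⟩
  have hbd : ∀ {Ψ : OpenPartialHomeomorph M (Euc m)}, IsAdaptedChart f k p Ψ → ∀ q ∈ Ψ.source,
      q ∈ closure (morinSet m f (k + 1)) ↔ InSlice (n - k) (Ψ q) ∧ crd (Ψ q) (n - k) = 0 :=
    fun hΨ q hq => (hΨ.slice_succ.mem_iff q hq).trans (inSlice_pred_iff hd hdm _)
  have htransfer : ∀ {P Q : Set M}, AreSides P Q (n - k) Φ₁ → ∃ W : Set M, IsOpen W ∧ p ∈ W ∧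
      (AreSides P Q (n - k) (Φ.restr W) ∨ AreSides Q P (n - k) (Φ.restr W)) := fun h =>
    h.transfer hd hdm hp₁ h0₁ had.mem_source had.map_eq_zero had₁.slice.mem_iff (hbd had₁)
      had.slice.mem_iff (hbd had)
  obtain ⟨W, hWo, hpW, hW⟩ : ∃ W : Set M, IsOpen W ∧ p ∈ W ∧
      (AreSides (morinSetPos m f k) (morinSetNeg m f k) (n - k) (Φ.restr W) ∨
        AreSides (morinSetNeg m f k) (morinSetPos m f k) (n - k) (Φ.restr W)) := by
    rcases hs₁ with h | h
    · exact htransfer h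
    · obtain ⟨W, h1, h2, h3⟩ := htransfer h
      exact ⟨W, h1, h2, h3.symm⟩
  -- Which of A_k^+ and A_k^- is the half x_(n-k) > 0 depends on p and on the chart; the conclusion
  -- is symmetric in the two halves.
  rcases hW with hW | hW
  · obtain ⟨U, V, hU, hV, hpV, hVU, hUO, hUΦ, χ, hχ, hχU, hχV, ε₀, hε₀, H⟩ :=
      exists_perturbation hd had.slice had.slice_succ hg had.mem_source had.map_eq_zero hpS hpB
        hWo hpW hW hO
    refine ⟨U, V, hU, hV, hpV, hVU, hUO, hUΦ, χ, hχ, hχU, hχV, ε₀, hε₀, fun ε h1 h2 => ?_⟩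
    obtain ⟨hG, c1, c2, c3, c4, p', hp'V, e1, e2, e3, e4, e5⟩ := H ε h1 h2 _ rfl
    exact ⟨hG, c1, c2, c3, c4, p', hp'V, e1, e2, e3, e4, sub_eq_zero.2 e5⟩
  · obtain ⟨U, V, hU, hV, hpV, hVU, hUO, hUΦ, χ, hχ, hχU, hχV, ε₀, hε₀, H⟩ :=
      exists_perturbation hd had.slice had.slice_succ hg had.mem_source had.map_eq_zero hpS hpB
        hWo hpW hW hO
    refine ⟨U, V, hU, hV, hpV, hVU, hUO, hUΦ, χ, hχ, hχU, hχV, ε₀, hε₀, fun ε h1 h2 => ?_⟩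
    obtain ⟨hG, c1, c2, c3, c4, p', hp'V, e1, e2, e3, e4, e5⟩ := H ε h1 h2 _ rfl
    exact ⟨hG, c2, c1, c4, c3, p', hp'V, e1, e2, e3, e4.symm, sub_eq_zero.2 e5.symm⟩
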